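/- **Top edge lemma.** Let $x$ be a feasible half-integral solution ($x_{\{u,v\}}\in\{0,\tfrac12,1\}$) of the Held--Karp (subtour elimination) LP on a finite vertex set $V$, and let $e^+$ be a pair with $x_{e^+}=1$. Let $G$ be the support multigraph of $x$, with one edge for each pair of value $\tfrac12$ and two parallel edges for each pair of value $1$; thus $G$ is 4-regular with minimum cuts of size 4. In a graph obtained from $G$ by contractions, a vertex set $S$ is *tight* if $|\delta(S)|=4$, *proper* if $S$ and its complement both have at least two vertices; two sets $S,R$ *cross* if $S\setminus R$, $R\setminus S$, $S\cap R$ and the complement of $S\cup R$ are all non-empty. Consider the following random algorithm, which starts with $T=\varnothing$. While the current graph has a proper tight set that is not crossed by a tight set, choose an inclusion-minimal such set $S$ not containing both ends of $e^+$; independently of everything before, sample a spanning tree of the current graph induced on $S$ from the maximum entropy ($\lambda$-uniform) distribution, i.e. $\mathbb P[F]\propto\prod_{e\in F}\lambda_e$ for some weights $\lambda_e\ge 0$, with marginals $\mathbb P[e\in F]=\tfrac12$ for each edge $e$ (exactly); add its edges to $T$; and contract $S$. When no such set is left, add to $T$ an independent uniformly random Hamiltonian cycle, through a copy of $e^+$,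 of the remaining graph (which is a cycle with doubled edges). Fix any execution (any choice of the selected sets). The *critical sets* are the selected sets (as subsets of $V$) and the single vertices of $G$; a *critical cut* is $\delta(S)$ for $S$ critical. The critical sets together with the root $V$ form a hierarchy under inclusion: the parent of $A$ is the smallest member strictly containing $A$, and $A$ is then a child of it. An edge $e\in\delta(S)$ *goes higher* if the smallest critical set $S'\supsetneq S$ exists and $e\in\delta(S')$. For an edge $e=\{u,v\}$ let $S_{u,e}$ be the largest critical set containing $u$ but not $v$, define $S_{v,e}$ symmetrically, and let $S_e$ be the common parent of $S_{u,e}$ and $S_{v,e}$. Let $G_e$ be the graph obtained from $G$ by contracting each child of $S_e$ and, if $S_e\ne V$, the set $V\setminus S_e$. Call $e$ a *bottom edge* if $G_e$ is a cycle of length at least 3 with two parallel edges between adjacent vertices, and a *top edge* otherwise. A cut $\delta(S)$ is *even* if $|T\cap\delta(S)|$ is even. The edge $e$ is *even at last* if: for a bottom edge, all 4-edge cuts of $G_e$ containing $e$ are even; for a top edge, $\delta(S_{u,e})$ and $\delta(S_{v,e})$ are both even. Then for every critical set $S$ such that exactly one of the four edges of $\delta(S)$ goes higher, at least two of the remaining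 three edges of $\delta(S)$ are good with $p\ge\frac1{16}$, that is, each of them is even at last with probability at least $\frac1{16}$. -/

import Mathlib

open scoped Classical

noncomputable section

open scoped NNReal ENNReal

namespace HalfIntegralTSP

variable {V : Type*} [Fintype V]

/-! ### The Held-Karp relaxation and the support graph -/

/-- `x` is a feasible solution of the subtour elimination (Held-Karp) linear program. -/
structure IsHeldKarp (x : Sym2 V → ℝ) : Prop where
  nonneg : ∀ e, 0 ≤ x e
  loopless : ∀ v, x s(v, v) = 0
  degree : ∀ u, ∑ v, x s(u, v) = 2
  cut : ∀ S : Finset V, S.Nonempty → S ≠ Finset.univ → 2 ≤ ∑ u ∈ S, ∑ v ∈ Sᶜ, x s(u, v)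

/-- All values of `x` lie in `{0, 1/2, 1}`. -/
def IsHalfIntegral (x : Sym2 V → ℝ) : Prop :=
  ∀ e, x e = 0 ∨ x e = 1 / 2 ∨ x e = 1

/-- Labels for the edges of the support multigraph: `(p, i)` is the copy number `i` of the
pair `p`. -/
abbrev Edge (V : Type*) := Sym2 V × Fin 2

/-- The edges of the support graph: one copy of every pair of value `1/2`, and two parallel copies
of every pair of value `1`. -/
def supportEdges (x : Sym2 V → ℝ) : Finset (Edge V) :=
  Finset.univ.filter fun e => ((e.2 : ℕ) + 1 : ℝ) / 2 ≤ x e.1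

/-- The cut `δ(S)` in the support graph. -/
def cut (x : Sym2 V → ℝ) (S : Finset V) : Finset (Edge V) :=
  (supportEdges x).filter fun e => ∃ u v, e.1 = s(u, v) ∧ u ∈ S ∧ v ∉ S

/-- The edges of the support graph between two vertex sets. -/
def edgesBetween (x : Sym2 V → ℝ) (A B : Finset V) : Finset (Edge V) :=
  (supportEdges x).filter fun e => ∃ u v, e.1 = s(u, v) ∧ u ∈ A ∧ v ∈ B

/-! ### Contracted graphs

A graph obtained from the support graph by contractions is represented by the partition `P` of `V`
whose blocks are its (contracted) vertices; a set of its vertices is represented by the union of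
the corresponding blocks. Edges inside a block disappear. -/

/-- The graph before any contraction. -/
def singletons (V : Type*) [Fintype V] : Finset (Finset V) :=
  Finset.univ.image fun v => {v}

/-- `S` is (the union of) a set of vertices of the contracted graph `P`. -/
def IsVertexSet (P : Finset (Finset V)) (S : Finset V) : Prop :=
  ∀ B ∈ P, B ⊆ S ∨ Disjoint B S

/-- The vertices of the contracted graph `P` that lie in `S`. -/
def nodesIn (P : Finset (Finset V)) (S : Finset V) : Finset (Finset V) :=
  P.filter fun B => B ⊆ S

/-- The edges of the contracted graph `P` with both ends in `S`. -/
def innerEdges (x : Sym2 V → ℝ) (P : Finset (Finset V)) (S : Finset V) : Finset (Edge V) :=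
  (supportEdges x).filter fun e => (∀ v ∈ e.1, v ∈ S) ∧ ∀ B ∈ P, ¬ ∀ v ∈ e.1, v ∈ B

/-- The contraction of the vertex set `S`. -/
def contract (P : Finset (Finset V)) (S : Finset V) : Finset (Finset V) :=
  insert S (P.filter fun B => ¬ B ⊆ S)

/-- A tight set: its cut is a minimum cut, i.e. has four edges (fractional value `2`). -/
def IsTight (x : Sym2 V → ℝ) (P : Finset (Finset V)) (S : Finset V) : Prop :=
  IsVertexSet P S ∧ (cut x S).card = 4

/-- Both sides of the cut have at least two vertices of the contracted graph. -/
def IsProper (P : Finset (Finset V)) (S : Finset V) : Prop :=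
  2 ≤ (nodesIn P S).card ∧ 2 ≤ (nodesIn P Sᶜ).card

/-- Two sets cross. -/
def Cross (S R : Finset V) : Prop :=
  (S \ R).Nonempty ∧ (R \ S).Nonempty ∧ (S ∩ R).Nonempty ∧ (S ∪ R)ᶜ.Nonempty

/-- A proper tight set of the contracted graph that is not crossed by a tight set. -/
def IsCandidate (x : Sym2 V → ℝ) (P : Finset (Finset V)) (S : Finset V) : Prop :=
  IsTight x P S ∧ IsProper P S ∧ ∀ R, IsTight x P R → ¬ Cross S R

/-- The choice made in one iteration of the loop: a minimal uncrossed proper tight set that does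
not contain both ends of the special edge `ePlus`. -/
def IsSelectable (x : Sym2 V → ℝ) (ePlus : Sym2 V) (P : Finset (Finset V)) (S : Finset V) : Prop :=
  Minimal (fun R => IsCandidate x P R ∧ ¬ ∀ v ∈ ePlus, v ∈ R) S

/-! ### Random trees -/

/-- All elements of `S` are joined by the edges of `F`, once each block of `P` is contracted. -/
def Connects (P : Finset (Finset V)) (F : Finset (Edge V)) (S : Finset V) : Prop :=
  ∀ u ∈ S, ∀ v ∈ S, Relation.EqvGen
    (fun a b => (∃ B ∈ P, a ∈ B ∧ b ∈ B) ∨ ∃ f ∈ F, f.1 = s(a, b)) u v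

/-- `F` is the edge set of a spanning tree of the subgraph of the contracted graph `P` induced on
`S`: it is connected and has one edge fewer than vertices. -/
def IsSpanningTree (x : Sym2 V → ℝ) (P : Finset (Finset V)) (S : Finset V)
    (F : Finset (Edge V)) : Prop :=
  F ⊆ innerEdges x P S ∧ Connects P F S ∧ F.card + 1 = (nodesIn P S).card

/-- `μ` is a `λ`-uniform distribution on the spanning trees of the contracted graph on `S`: the
probability of a tree is proportional to the product of the weights of its edges. -/
def IsLambdaUniform (x : Sym2 V → ℝ) (P : Finset (Finset V)) (S : Finset V)
    (μ : PMF (Finset (Edge V))) : Prop :=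
  ∃ (w : Edge V → ℝ≥0) (c : ℝ≥0), ∀ F,
    μ F = if IsSpanningTree x P S F then ((c * ∏ e ∈ F, w e : ℝ≥0) : ℝ≥0∞) else 0

/-- The maximum entropy distribution on the spanning trees of the contracted graph on `S` whose
marginals are the values of `x`, i.e. `1/2` for each edge of the support graph (a pair of value `1`
being split into two edges). -/
def IsMaxEntropy (x : Sym2 V → ℝ) (P : Finset (Finset V)) (S : Finset V)
    (μ : PMF (Finset (Edge V))) : Prop :=
  IsLambdaUniform x P S μ ∧ ∀ e ∈ innerEdges x P S, μ.toOuterMeasure {F | e ∈ F} = 1 / 2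

/-- `F` is the edge set of a Hamiltonian cycle of the contracted graph `P` through (a copy of) the
special edge: a connected spanning subgraph in which all vertices have degree two. -/
def IsCycleThrough (x : Sym2 V → ℝ) (ePlus : Sym2 V) (P : Finset (Finset V))
    (F : Finset (Edge V)) : Prop :=
  F ⊆ innerEdges x P Finset.univ ∧ Connects P F Finset.univ ∧
    (∀ B ∈ P, (F ∩ cut x B).card = 2) ∧ ∃ i, (ePlus, i) ∈ F

/-- `τ` is the uniform distribution on the Hamiltonian cycles through the special edge. -/
def IsUniformCycle (x : Sym2 V → ℝ) (ePlus : Sym2 V) (P : Finset (Finset V))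
    (τ : PMF (Finset (Edge V))) : Prop :=
  ∀ F, τ F = if IsCycleThrough x ePlus P F then
    ((Finset.univ.filter fun F' => IsCycleThrough x ePlus P F').card : ℝ≥0∞)⁻¹ else 0

/-- `IsExecution x ePlus P l τ`: started on the contracted graph `P`, the algorithm can select
successively the sets in the list `l`, and then the set of edges that it samples (a 1-tree, when
`P` is the original graph) has law `τ`. In each iteration it samples independently a tree from the
maximum entropy distribution on the selected set, adds it, and contracts the set; when no uncrossed
proper tight set is left, it adds a uniformly random cycle through the special edge. -/
def IsExecution (x : Sym2 V → ℝ) (ePlus : Sym2 V) :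
    Finset (Finset V) → List (Finset V) → PMF (Finset (Edge V)) → Prop
  | P, [], τ => (∀ S, ¬ IsCandidate x P S) ∧ IsUniformCycle x ePlus P τ
  | P, S :: l, τ => IsSelectable x ePlus P S ∧
      ∃ μ τ' : PMF (Finset (Edge V)), IsMaxEntropy x P S μ ∧
        IsExecution x ePlus (contract P S) l τ' ∧
        τ = μ.bind fun F => τ'.map fun F' => F ∪ F'

/-! ### The hierarchy of critical sets -/

/-- The critical sets: the selected sets and, as degenerate ones, the vertices. -/
def critical (l : List (Finset V)) : Finset (Finset V) :=
  singletons V ∪ l.toFinset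

/-- The nodes of the hierarchy: the critical sets and the root, which is the whole graph. -/
def hierarchy (l : List (Finset V)) : Finset (Finset V) :=
  insert Finset.univ (critical l)

/-- `A` is a child of `D`: the lowest node of the hierarchy above `A` is `D`. -/
def IsChild (l : List (Finset V)) (A D : Finset V) : Prop :=
  A ∈ critical l ∧ Minimal (fun R => R ∈ hierarchy l ∧ A ⊂ R) D

/-- The edge `e` of `δ(S)` goes higher: the lowest critical set `S'` with `S ⊊ S'` satisfies
`e ∈ δ(S')`. -/
def GoesHigher (x : Sym2 V → ℝ) (l : List (Finset V)) (S : Finset V) (e : Edge V) : Prop :=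
  ∃ S', Minimal (fun R => R ∈ critical l ∧ S ⊂ R) S' ∧ e ∈ cut x S'

/-- `δ(A)` is a highest critical cut containing `e`. For `e = {u, v}` there are two such sets `A`:
the highest critical set containing `u` but not `v`, and the highest one containing `v` but not
`u`. -/
def IsHighestCut (x : Sym2 V → ℝ) (l : List (Finset V)) (e : Edge V) (A : Finset V) : Prop :=
  Maximal (fun R => R ∈ critical l ∧ e ∈ cut x R) A

/-- `D` is the set `S_e`, in which both sets `A` giving a highest critical cut of `e` are
vertices. -/
def IsJoin (x : Sym2 V → ℝ) (l : List (Finset V)) (e : Edge V) (D : Finset V) : Prop :=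
  ∀ A, IsHighestCut x l e A → IsChild l A D

/-- The vertices of the graph `G / (V ∖ D)` at the moment when `D` is selected: the children of `D`
and, unless `D` is the root, the contracted vertex `V ∖ D`. -/
def localNodes (l : List (Finset V)) (D : Finset V) : Finset (Finset V) :=
  Finset.univ.filter fun A => IsChild l A D ∨ (A = Dᶜ ∧ A.Nonempty)

/-- The contracted graph with vertices `N` is a cycle of length at least three with two parallel
edges between adjacent vertices. -/
def IsDoubledCycle (x : Sym2 V → ℝ) (N : Finset (Finset V)) : Prop :=
  ∃ (k : ℕ) (c : ZMod k → Finset V), 3 ≤ k ∧ Function.Injective c ∧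
    (∀ A, A ∈ N ↔ ∃ i, c i = A) ∧
    ∀ i j, i ≠ j →
      (edgesBetween x (c i) (c j)).card = if j = i + 1 ∨ i = j + 1 then 2 else 0

/-- `e` is a bottom edge: `δ(S_e)` is a cycle cut (or `S_e` is the final cycle). Otherwise `e` is a
top edge. -/
def IsBottom (x : Sym2 V → ℝ) (l : List (Finset V)) (e : Edge V) : Prop :=
  ∃ D, IsJoin x l e D ∧ IsDoubledCycle x (localNodes l D)

/-- The cut `δ(S)` is even in `T`. -/
def IsEvenCut (x : Sym2 V → ℝ) (T : Finset (Edge V)) (S : Finset V) : Prop :=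
  Even (T ∩ cut x S).card

/-- `e` is even at last in `T`. If `e` is a bottom edge: all minimum cuts containing `e` of the
cycle `G / (V ∖ S_e)` are even. If `e` is a top edge: its two highest critical cuts are even. -/
def EvenAtLast (x : Sym2 V → ℝ) (l : List (Finset V)) (T : Finset (Edge V)) (e : Edge V) : Prop :=
  (IsBottom x l e → ∀ D, IsJoin x l e D →
    ∀ C, IsTight x (localNodes l D) C → e ∈ cut x C → IsEvenCut x T C) ∧
  (¬ IsBottom x l e → ∀ A, IsHighestCut x l e A → IsEvenCut x T A)

/-- The edge `e` is good with parameter `p`: it is even at last with probability at least `p` when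
`T` has law `τ`. -/
def IsGood (x : Sym2 V → ℝ) (l : List (Finset V)) (τ : PMF (Finset (Edge V))) (p : ℝ≥0∞)
    (e : Edge V) : Prop :=
  p ≤ τ.toOuterMeasure {T | EvenAtLast x l T e}

end HalfIntegralTSP

end

open scoped Classical

noncomputable section

set_option linter.unusedSectionVars false

open scoped NNReal ENNReal

namespace HalfIntegralTSP

/-! Let `D` be the parent of `S`. Exactly one edge of δ(S) leaves `D`, so three stay inside, and it
suffices that among any two of these one is good: then at most one of the three fails (`isGood_or`,
`two_le_card_filter`).

Structure. In the graph from which `D` is selected, contract the complement of `D`. Since `D` is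
minimal and crossed by no tight set, every proper tight set of this local graph is crossed by a
tight set of the local graph. Uncrossing shows that such a graph, if it has three vertices or any
proper tight set at all, consists of parallel pairs (`flow_eq_zero_or_one_of_crossed`). The single
edge between `S` and the complement of `D` forbids this, so the local graph is simple
(`local_simple`). The three edges are therefore top edges, and an edge joining `S` to `W` is even at
last as soon as δ(S) and δ(W) are even.

Randomness. The sample meets these cuts in edges of the tree F drawn inside `D` and in edges of
δ(D). The latter are drawn later, independently of F, each with probability 1/2
(`IsExecution.pr_mem`); earlier samples lie inside single vertices and play no role
(`IsExecution.split`). If `W` has no edge leaving `D`, then |F ∩ δ(W)| is even with probability at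
least 1/8, and the leaving edge at `S` repairs the parity of δ(S) with conditional probability 1/2.
If `S` and `W` have one leaving edge each, let r be the probability that both are drawn. The
marginals make r also the probability that neither is drawn, and give each mixed outcome 1/2 − r.
Given F, the outcome needed has probability r or 1/2 − r, according to whether the numbers of tree
edges at `S` and at `W` have equal parities or not. Hence, whatever r is, 1/16 follows once each of
these two events has probability at least 1/8.

Parity. Modulo 2, the sum of the two numbers counts the tree edges among the four edges inside `D`
that leave the pair `S`, `W`. A λ-uniform tree is negatively correlated, also after conditioning on
edges being present or absent; this comes from the matrix tree theorem (`isRayleigh_of_det`,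
`isRayleigh_spanningTrees`). It makes the even case have probability at least 1/8
(`IsNegDep.even_four`). The bound for the odd case may fail for one edge, but for two edges at `S`
the two odd probabilities add up to at least 1/4 (`IsNegDep.odd_four`). -/

section

/-! ### Negative correlation in weighted families of sets. -/

section Rayleigh

variable {α : Type*}

/-- The total weight of the members of a family of sets that satisfy a predicate. -/
def weightSum (T : Finset (Finset α)) (w : α → ℝ) (X : Finset α → Prop) : ℝ :=
  ∑ F ∈ T.filter X, ∏ e ∈ F, w e

/-- A family of sets is Rayleigh if, under every nonnegative weighting, any two elements are
negatively correlated. -/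
def IsRayleigh (T : Finset (Finset α)) : Prop :=
  ∀ w : α → ℝ, (∀ e, 0 ≤ w e) → ∀ e f, e ≠ f →
    weightSum T w (fun F => e ∈ F ∧ f ∈ F) * weightSum T w (fun F => e ∉ F ∧ f ∉ F) ≤
      weightSum T w (fun F => e ∈ F ∧ f ∉ F) * weightSum T w (fun F => e ∉ F ∧ f ∈ F)

theorem weightSum_nonneg (T : Finset (Finset α)) {w : α → ℝ} (hw : ∀ e, 0 ≤ w e)
    (X : Finset α → Prop) : 0 ≤ weightSum T w X :=
  Finset.sum_nonneg fun _ _ => Finset.prod_nonneg fun e _ => hw e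

theorem weightSum_congr {T T' : Finset (Finset α)} {w w' : α → ℝ} {X X' : Finset α → Prop}
    (h : ∀ F, (F ∈ T ∧ X F) ↔ (F ∈ T' ∧ X' F))
    (hw : ∀ F ∈ T, X F → ∏ e ∈ F, w e = ∏ e ∈ F, w' e) :
    weightSum T w X = weightSum T' w' X' := by
  unfold weightSum
  have : T.filter X = T'.filter X' := by ext F; simpa using h F
  rw [← this]
  exact Finset.sum_congr rfl fun F hF => hw F (Finset.mem_filter.1 hF).1 (Finset.mem_filter.1 hF).2

theorem weightSum_split (T : Finset (Finset α)) (w : α → ℝ) (X Y : Finset α → Prop) :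
    weightSum T w X = weightSum T w (fun F => X F ∧ Y F) +
        weightSum T w (fun F => X F ∧ ¬ Y F) := by
  simp only [weightSum, Finset.sum_filter, ← Finset.sum_add_distrib]
  refine Finset.sum_congr rfl fun F _ => ?_
  by_cases hX : X F <;> by_cases hY : Y F <;> simp [hX, hY]

theorem weightSum_eq_zero {T : Finset (Finset α)} {w : α → ℝ} {X : Finset α → Prop}
    (h : ∀ F ∈ T, X F → ∏ e ∈ F, w e = 0) : weightSum T w X = 0 :=
  Finset.sum_eq_zero fun F hF => h F (Finset.mem_filter.1 hF).1 (Finset.mem_filter.1 hF).2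

/-- Each set containing `g` carries the factor `w g` exactly once, so every such sum is affine in
the scale `t`. Scale 0 gives deletion, large scales give contraction. -/
theorem weightSum_mul_update (T : Finset (Finset α)) (w : α → ℝ) (X : Finset α → Prop) (g : α)
    (t : ℝ) : weightSum T (Function.update w g (t * w g)) X =
      weightSum T w (fun F => X F ∧ g ∉ F) + t * weightSum T w (fun F => X F ∧ g ∈ F) := by
  rw [weightSum_split _ _ X (fun F => g ∉ F)]
  congr 1
  · refine weightSum_congr (fun _ => Iff.rfl) fun F _ hF => Finset.prod_congr rfl fun e he => ?_
    rw [Function.update_of_ne (fun h : e = g => hF.2 (h ▸ he))]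
  · simp only [not_not, weightSum, Finset.sum_filter, Finset.mul_sum]
    refine Finset.sum_congr rfl fun F _ => ?_
    by_cases hF : X F ∧ g ∈ F
    swap
    · simp only [if_neg hF, mul_zero]
    simp only [if_pos hF]
    have hg : g ∈ F := hF.2
    rw [← Finset.mul_prod_erase _ _ hg, ← Finset.mul_prod_erase _ _ hg, Function.update_self,
      mul_assoc]
    congr 2
    refine Finset.prod_congr rfl fun e he => ?_
    rw [Function.update_of_ne (Finset.ne_of_mem_erase he)]

theorem IsRayleigh.deletion {T : Finset (Finset α)} (hT : IsRayleigh T) (k : α) :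
    IsRayleigh (T.filter fun F => k ∉ F) := by
  intro w hw e f hef
  -- Weight zero at `k` kills the sets containing `k`; the form `0 * w k` matches
  -- `weightSum_mul_update`.
  have key := hT (Function.update w k (0 * w k)) (fun a => by
    by_cases h : a = k
    · subst h; simp
    · simpa [Function.update_of_ne h] using hw a) e f hef
  simp only [weightSum_mul_update] at key
  simp only [zero_mul, add_zero] at key
  have : ∀ X, weightSum (T.filter fun F => k ∉ F) w X = weightSum T w (fun F => X F ∧ k ∉ F) :=
    fun X => weightSum_congr (fun F => by simp only [Finset.mem_filter]; tauto) fun _ _ _ => rfl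
  simpa only [this] using key

/-- A negative quadratic term would win for large `t`. This replaces a limit in the contraction
argument. -/
theorem leading_coeff_nonneg {a b c : ℝ} (h : ∀ t : ℝ, 0 ≤ t → 0 ≤ a + b * t + c * t ^ 2) :
    0 ≤ c := by
  by_contra hc
  push Not at hc
  have hpos : 0 < -c := by linarith
  -- Here `t ≥ 1` and `-c * t` exceeds `|a| + |b|`, so the quadratic term outweighs the other two.
  set t : ℝ := (|a| + |b| + 1) / (-c) + 1 with ht
  have ht1 : 1 ≤ t := by
    have : 0 ≤ (|a| + |b| + 1) / (-c) := by positivity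
    linarith
  have hct : (-c) * t = |a| + |b| + 1 + (-c) := by
    rw [ht, mul_add, mul_div_cancel₀ _ hpos.ne', mul_one]
  have h1 := h t (by linarith)
  have ha := le_abs_self a
  have hb := le_abs_self b
  have h2 : a ≤ |a| * t := by nlinarith [abs_nonneg a]
  have h3 : b * t ≤ |b| * t := by nlinarith
  have h4 : c * t ^ 2 = -((|a| + |b| + 1 + (-c)) * t) := by rw [← hct]; ring
  nlinarith

/-- Scaling the weight of `g` by `t` turns the Rayleigh inequality into a quadratic in `t` that is
nonnegative for all `t ≥ 0`. Its leading coefficient involves only the sets containing `g`. -/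
theorem IsRayleigh.contraction {T : Finset (Finset α)} (hT : IsRayleigh T) (g : α) :
    IsRayleigh (T.filter fun F => g ∈ F) := by
  intro w hw e f hef
  have this : ∀ X, weightSum (T.filter fun F => g ∈ F) w X = weightSum T w (fun F => X F ∧ g ∈ F) :=
    fun X => weightSum_congr (fun F => by simp only [Finset.mem_filter]; tauto) fun _ _ _ => rfl
  simp only [this]
  have key : ∀ t : ℝ, 0 ≤ t → _ := fun t ht => hT (Function.update w g (t * w g)) (fun a => by
    by_cases h : a = g
    · subst h; simpa using mul_nonneg ht (hw a)
    · simpa [Function.update_of_ne h] using hw a) e f hef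
  simp only [weightSum_mul_update] at key
  rw [← sub_nonneg]
  generalize weightSum T w (fun F => (e ∈ F ∧ f ∈ F) ∧ g ∈ F) = x1 at *
  generalize weightSum T w (fun F => (e ∈ F ∧ f ∈ F) ∧ g ∉ F) = y1 at *
  generalize weightSum T w (fun F => (e ∈ F ∧ f ∉ F) ∧ g ∈ F) = x2 at *
  generalize weightSum T w (fun F => (e ∈ F ∧ f ∉ F) ∧ g ∉ F) = y2 at *
  generalize weightSum T w (fun F => (e ∉ F ∧ f ∈ F) ∧ g ∈ F) = x3 at *
  generalize weightSum T w (fun F => (e ∉ F ∧ f ∈ F) ∧ g ∉ F) = y3 at *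
  generalize weightSum T w (fun F => (e ∉ F ∧ f ∉ F) ∧ g ∈ F) = x4 at *
  generalize weightSum T w (fun F => (e ∉ F ∧ f ∉ F) ∧ g ∉ F) = y4 at *
  apply leading_coeff_nonneg (a := y2 * y3 - y1 * y4)
    (b := x2 * y3 + y2 * x3 - x1 * y4 - y1 * x4)
  intro t ht
  have := key t ht
  nlinarith

end Rayleigh

/-! ### Spanning trees and determinants -/

section MatrixTree

variable {α ι : Type*} [Fintype ι] [DecidableEq ι] {R : Type*} [CommRing R]

/-- The weighted sum of the rank one matrices of a family of vectors. -/
def gram (E : Finset α) (w : α → R) (b : α → ι → R) : Matrix ι ι R :=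
  Matrix.of fun i j => ∑ e ∈ E, w e * b e i * b e j

/-- Row `i` is a combination of the vectors `b e`, so multilinearity in the rows chooses one element
`φ i` for each row independently. -/
theorem det_gram_expand (E : Finset α) (w : α → R) (b : α → ι → R) :
    (gram E w b).det = ∑ φ ∈ Fintype.piFinset fun _ : ι => E,
      (∏ i, w (φ i)) * ((∏ i, b (φ i) i) * (Matrix.of fun i j => b (φ i) j).det) := by
  have h1 : gram E w b = fun i => ∑ e ∈ E, (w e * b e i) • b e := by
    ext i j
    simp [gram, Finset.sum_apply]
  have h2 := (Matrix.detRowAlternating (R := R) (n := ι)).toMultilinearMap.map_sum_finset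
    (fun i e => (w e * b e i) • b e) (fun _ => E)
  rw [h1]
  refine Eq.trans h2 (Finset.sum_congr rfl fun φ _ => ?_)
  have h3 := (Matrix.detRowAlternating (R := R) (n := ι)).toMultilinearMap.map_smul_univ
    (fun i => w (φ i) * b (φ i) i) (fun i => b (φ i))
  refine Eq.trans h3 ?_
  rw [Finset.prod_mul_distrib, smul_eq_mul, mul_assoc]
  rfl

/-- A form of the Cauchy–Binet formula. Choices that repeat an element produce equal rows and
vanish; the injective ones are grouped by their image `F`, and each group is the same expansion for
the unweighted matrix of `F`. -/
theorem det_gram (E : Finset α) (w : α → R) (b : α → ι → R) :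
    (gram E w b).det = ∑ F ∈ E.powersetCard (Fintype.card ι),
      (∏ e ∈ F, w e) * (gram F 1 b).det := by
  have hzero : ∀ φ : ι → α, ¬ Function.Injective φ →
      (Matrix.of fun i j => b (φ i) j).det = 0 := by
    intro φ hφ
    rw [Function.not_injective_iff] at hφ
    obtain ⟨i, j, hij, hne⟩ := hφ
    exact Matrix.det_zero_of_row_eq hne (by ext k; simp [hij])
  have hinj : ∀ (E : Finset α) (w : α → R), (gram E w b).det =
      ∑ φ ∈ (Fintype.piFinset fun _ : ι => E).filter Function.Injective,
      (∏ i, w (φ i)) * ((∏ i, b (φ i) i) * (Matrix.of fun i j => b (φ i) j).det) := by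
    intro E w
    rw [det_gram_expand]
    refine (Finset.sum_filter_of_ne fun φ _ h => ?_).symm
    by_contra hφ
    exact h (by rw [hzero φ hφ]; ring)
  rw [hinj]
  rw [← Finset.sum_fiberwise_of_maps_to (g := fun φ : ι → α => Finset.univ.image φ)
    (t := E.powersetCard (Fintype.card ι))]
  · refine Finset.sum_congr rfl fun F hF => ?_
    rw [Finset.mem_powersetCard] at hF
    rw [hinj, Finset.mul_sum]
    refine Finset.sum_congr ?_ ?_
    · ext φ
      simp only [Finset.mem_filter, Fintype.mem_piFinset]
      constructor
      · rintro ⟨⟨h1, h2⟩, h3⟩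
        exact ⟨fun i => h3 ▸ Finset.mem_image_of_mem _ (Finset.mem_univ i), h2⟩
      · rintro ⟨h1, h2⟩
        refine ⟨⟨fun i => hF.1 (h1 i), h2⟩, ?_⟩
        refine Finset.eq_of_subset_of_card_le ?_ ?_
        · intro a ha
          obtain ⟨i, -, rfl⟩ := Finset.mem_image.1 ha
          exact h1 i
        · rw [Finset.card_image_of_injective _ h2, hF.2, Finset.card_univ]
    · intro φ hφ
      simp only [Finset.mem_filter, Fintype.mem_piFinset] at hφ
      have himg : Finset.univ.image φ = F := by
        refine Finset.eq_of_subset_of_card_le ?_ ?_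
        · intro a ha
          obtain ⟨i, -, rfl⟩ := Finset.mem_image.1 ha
          exact hφ.1 i
        · rw [Finset.card_image_of_injective _ hφ.2, hF.2, Finset.card_univ]
      rw [← himg, Finset.prod_image (fun i _ j _ h => hφ.2 h)]
      simp
  · intro φ hφ
    simp only [Finset.mem_filter, Fintype.mem_piFinset] at hφ
    rw [Finset.mem_powersetCard]
    refine ⟨?_, ?_⟩
    · intro a ha
      obtain ⟨i, -, rfl⟩ := Finset.mem_image.1 ha
      exact hφ.1 i
    · rw [Finset.card_image_of_injective _ hφ.2, Finset.card_univ]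

/-- The perturbation factors through a two-dimensional space, so the determinant reduces to a 2 × 2
one. Symmetry of `A` makes the two off-diagonal pairings equal, whence the square of `δ`; its sign
is the source of the negative correlation. -/
theorem det_add_two_rank_one (A : Matrix ι ι ℝ) (hA : A.IsSymm) (hdet : A.det ≠ 0)
    (b c : ι → ℝ) : ∃ β γ δ : ℝ, ∀ s t : ℝ,
      (A + s • Matrix.vecMulVec b b + t • Matrix.vecMulVec c c).det =
        A.det * ((1 + s * β) * (1 + t * γ) - s * t * δ ^ 2) := by
  have hu : IsUnit A.det := isUnit_iff_ne_zero.2 hdet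
  let U : ℝ → ℝ → Matrix ι (Fin 2) ℝ := fun s t =>
    Matrix.of fun i k => if k = 0 then s * b i else t * c i
  let W : Matrix (Fin 2) ι ℝ := Matrix.of fun k i => if k = 0 then b i else c i
  refine ⟨b ⬝ᵥ (A⁻¹.mulVec b), c ⬝ᵥ (A⁻¹.mulVec c), b ⬝ᵥ (A⁻¹.mulVec c), fun s t => ?_⟩
  have hsymm : c ⬝ᵥ (A⁻¹.mulVec b) = b ⬝ᵥ (A⁻¹.mulVec c) := by
    have hAi : (A⁻¹).transpose = A⁻¹ := by rw [Matrix.transpose_nonsing_inv, hA.eq]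
    rw [dotProduct_comm, ← Matrix.vecMul_transpose, hAi, ← Matrix.dotProduct_mulVec]
  have h1 : A + s • Matrix.vecMulVec b b + t • Matrix.vecMulVec c c =
      A * (1 + (A⁻¹ * U s t) * W) := by
    rw [Matrix.mul_add, Matrix.mul_one, Matrix.mul_assoc, Matrix.mul_nonsing_inv_cancel_left _ _ hu,
      add_assoc]
    congr 1
    ext i j
    simp [U, W, Matrix.mul_apply, Matrix.vecMulVec_apply, Fin.sum_univ_two]
    ring
  rw [h1, Matrix.det_mul, Matrix.det_one_add_mul_comm, Matrix.det_fin_two]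
  have hent : ∀ (k : Fin 2) (m : Fin 2), (W * (A⁻¹ * U s t)) k m =
      (if m = 0 then s else t) *
          ((if k = 0 then b else c) ⬝ᵥ (A⁻¹.mulVec (if m = 0 then b else c))) := by
    intro k m
    simp only [U, W, Matrix.mul_apply, dotProduct, Matrix.mulVec, Finset.mul_sum, Matrix.of_apply]
    refine Finset.sum_congr rfl fun i _ => Finset.sum_congr rfl fun j _ => ?_
    split_ifs <;> ring
  simp only [Matrix.add_apply, hent]
  simp only [hsymm, Matrix.one_apply_eq, if_true, Fin.isValue, one_ne_zero, if_false, ne_eq,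
    not_false_eq_true, Matrix.one_apply_ne, zero_ne_one]
  ring

/-- The members of `T` are weighted by a determinant of a weighted sum of rank one matrices. -/
theorem isRayleigh_of_det (T : Finset (Finset α)) (E : Finset α) (b : α → ι → ℝ)
    (hT : ∀ w : α → ℝ, (gram E w b).det = ∑ F ∈ T, ∏ e ∈ F, w e)
    (hTE : ∀ F ∈ T, F ⊆ E) : IsRayleigh T := by
  intro w hw e f hef
  have hnn := fun X => weightSum_nonneg T hw X
  by_cases heE : e ∈ E
  swap
  · rw [weightSum_eq_zero (X := fun F => e ∈ F ∧ f ∈ F) (fun F hF h => (heE (hTE F hF h.1)).elim),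
      zero_mul]
    exact mul_nonneg (hnn _) (hnn _)
  by_cases hfE : f ∈ E
  swap
  · rw [weightSum_eq_zero (X := fun F => e ∈ F ∧ f ∈ F) (fun F hF h => (hfE (hTE F hF h.2)).elim),
      zero_mul]
    exact mul_nonneg (hnn _) (hnn _)
  set A : Matrix ι ι ℝ := gram ((E.erase e).erase f) w b with hA
  -- With the weights of `e` and `f` scaled by `s` and `t`, the determinant is a polynomial whose
  -- four coefficients are the sums to be compared. Its values at `s, t ∈ {0, 1}` recover them.
  have hG : ∀ s t : ℝ, (A + (s * w e) • Matrix.vecMulVec (b e) (b e) +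
      (t * w f) • Matrix.vecMulVec (b f) (b f)).det =
      weightSum T w (fun F => e ∉ F ∧ f ∉ F) + s * weightSum T w (fun F => e ∈ F ∧ f ∉ F) +
        t * weightSum T w (fun F => e ∉ F ∧ f ∈ F) +
        s * t * weightSum T w (fun F => e ∈ F ∧ f ∈ F) := by
    intro s t
    have h1 := hT (Function.update (Function.update w e (s * w e)) f
      (t * (Function.update w e (s * w e)) f))
    have h2 : ∑ F ∈ T, ∏ a ∈ F, (Function.update (Function.update w e (s * w e)) f
      (t * (Function.update w e (s * w e)) f)) a = weightSum T (Function.update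
        (Function.update w e (s * w e)) f (t * (Function.update w e (s * w e)) f))
        (fun _ => True) := by
      simp [weightSum]
    rw [h2, weightSum_mul_update, weightSum_mul_update, weightSum_mul_update] at h1
    have h3 : gram E (Function.update (Function.update w e (s * w e)) f
      (t * (Function.update w e (s * w e)) f)) b = A + (s * w e) • Matrix.vecMulVec (b e) (b e) +
      (t * w f) • Matrix.vecMulVec (b f) (b f) := by
      ext i j
      simp only [gram, hA, Matrix.add_apply, Matrix.of_apply, Matrix.smul_apply,
        Matrix.vecMulVec_apply, smul_eq_mul]
      rw [← Finset.sum_erase_add _ _ heE,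
        ← Finset.sum_erase_add _ _ (Finset.mem_erase.2 ⟨hef.symm, hfE⟩)]
      rw [Function.update_of_ne hef, Function.update_self, Function.update_self,
        Function.update_of_ne hef.symm]
      rw [Finset.sum_congr rfl (fun a ha => ?_ :
          ∀ a ∈ (E.erase e).erase f, _ = w a * b a i * b a j)]
      · ring
      · have h4 := Finset.ne_of_mem_erase ha
        have h5 := Finset.ne_of_mem_erase (Finset.mem_of_mem_erase ha)
        rw [Function.update_of_ne h4, Function.update_of_ne h5]
    rw [← h3, h1]
    simp only [true_and, and_comm (a := e ∉ _), and_comm (a := e ∈ _)]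
    ring
  have h00 := hG 0 0
  have h10 := hG 1 0
  have h01 := hG 0 1
  have h11 := hG 1 1
  -- If `A` is singular, the sets avoiding both elements have total weight zero and the left side
  -- vanishes.
  by_cases hdet : A.det = 0
  · have : weightSum T w (fun F => e ∉ F ∧ f ∉ F) = 0 := by
      simpa [hdet] using h00.symm
    rw [this, mul_zero]
    exact mul_nonneg (hnn _) (hnn _)
  have hsymm : A.IsSymm := by
    ext i j
    simp only [hA, gram, Matrix.transpose_apply, Matrix.of_apply]
    exact Finset.sum_congr rfl fun a _ => by ring
  obtain ⟨β, γ, δ, h⟩ := det_add_two_rank_one A hsymm hdet (b e) (b f)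
  rw [h] at h00 h10 h01 h11
  generalize weightSum T w (fun F => e ∈ F ∧ f ∈ F) = z11 at *
  generalize weightSum T w (fun F => e ∉ F ∧ f ∉ F) = z00 at *
  generalize weightSum T w (fun F => e ∈ F ∧ f ∉ F) = z10 at *
  generalize weightSum T w (fun F => e ∉ F ∧ f ∈ F) = z01 at *
  have e00 : z00 = A.det := by linarith
  have e10 : z10 = A.det * (w e * β) := by linarith
  have e01 : z01 = A.det * (w f * γ) := by linarith
  have e11 : z11 = A.det * (w e * w f * (β * γ - δ ^ 2)) := by linarith
  rw [e00, e10, e01, e11]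
  -- This quantity is exactly the right side minus the left side.
  have : 0 ≤ A.det ^ 2 * (w e * w f) * δ ^ 2 := by
    have := mul_nonneg (hw e) (hw f)
    positivity
  nlinarith

end MatrixTree

/-! ### The matrix tree theorem -/

section Graph

variable {α N : Type*} [Fintype N]

/-- The edges of `F`, with ends given by `s` and `t`, connect all nodes. -/
def NodeConnected (s t : α → N) (F : Finset α) : Prop :=
  ∀ a b, Relation.EqvGen (fun a b => ∃ f ∈ F, s f = a ∧ t f = b) a b

/-- The rows of the oriented incidence matrix, without the column of the root. -/
def incidence (s t : α → N) (r : N) (R : Type*) [CommRing R] (e : α) (j : {n : N // n ≠ r}) : R :=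
  (if s e = j then 1 else 0) - (if t e = j then 1 else 0)

/-- The indicator of a component that misses the root is orthogonal to the incidence row of every
edge of `F`, so it is a nonzero kernel vector. -/
theorem det_gram_incidence_of_not_connected (s t : α → N) (r : N) (F : Finset α)
    (h : ¬ NodeConnected s t F) : (gram F 1 (incidence s t r ℤ)).det = 0 := by
  have hr : ∃ a, ¬ Relation.EqvGen (fun a b => ∃ f ∈ F, s f = a ∧ t f = b) a r := by
    by_contra hcon
    push Not at hcon
    exact h fun a b => (hcon a).trans _ _ _ (hcon b).symm
  obtain ⟨a, ha⟩ := hr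
  let y : N → ℤ := fun n => if Relation.EqvGen (fun a b => ∃ f ∈ F, s f = a ∧ t f = b) a n
    then 1 else 0
  have hyr : y r = 0 := if_neg ha
  rw [← Matrix.exists_mulVec_eq_zero_iff]
  refine ⟨fun j => y j, ?_, ?_⟩
  · intro h0
    have har : a ≠ r := fun h => ha (h ▸ .refl _)
    have := congrFun h0 ⟨a, har⟩
    simp [y, Relation.EqvGen.refl] at this
  -- Omitting the column of the root loses nothing, because `y` vanishes there.
  · have hsum : ∀ n : N, ∑ j : {n : N // n ≠ r}, (if n = j then (1 : ℤ) else 0) * y j = y n := by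
      intro n
      by_cases hn : n = r
      · rw [hn, hyr]
        refine Finset.sum_eq_zero fun j _ => ?_
        rw [if_neg (fun h => j.2 h.symm), zero_mul]
      · rw [Finset.sum_eq_single ⟨n, hn⟩]
        · simp
        · intro j _ hj
          rw [if_neg, zero_mul]
          exact fun h => hj (Subtype.ext h.symm)
        · simp
    ext i
    simp only [Matrix.mulVec, dotProduct, gram, Matrix.of_apply, Pi.zero_apply, Finset.sum_mul]
    rw [Finset.sum_comm]
    refine Finset.sum_eq_zero fun e he => ?_
    simp only [Pi.one_apply, one_mul, mul_assoc, ← Finset.mul_sum]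
    simp only [incidence, sub_mul, Finset.sum_sub_distrib, hsum]
    have : y (s e) = y (t e) := by
      have hst : Relation.EqvGen (fun a b => ∃ f ∈ F, s f = a ∧ t f = b) (s e) (t e) :=
        .rel _ _ ⟨e, he, rfl, rfl⟩
      have : Relation.EqvGen (fun a b => ∃ f ∈ F, s f = a ∧ t f = b) a (s e) ↔
        Relation.EqvGen (fun a b => ∃ f ∈ F, s f = a ∧ t f = b) a (t e) :=
        ⟨fun h => h.trans _ _ _ hst, fun h => h.trans _ _ _ hst.symm⟩
      simp only [y, this]
    rw [this]
    ring

/-- The matrix is `Bᵀ B` with `B` a square incidence matrix. Telescoping along paths to the root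
puts every unit vector in the integer row span of `B`, so `B` is invertible over the integers and
has determinant ±1. -/
theorem det_gram_incidence_of_connected (s t : α → N) (r : N) (F : Finset α)
    (h : NodeConnected s t F) (hF : F.card = Fintype.card {n : N // n ≠ r}) :
    (gram F 1 (incidence s t r ℤ)).det = 1 := by
  have hcard : Fintype.card {n : N // n ≠ r} = Fintype.card F := by simpa using hF.symm
  let σ : {n : N // n ≠ r} ≃ F := Fintype.equivOfCardEq hcard
  let B : Matrix {n : N // n ≠ r} {n : N // n ≠ r} ℤ := Matrix.of fun i => incidence s t r ℤ (σ i)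
  have hB : gram F 1 (incidence s t r ℤ) = B.transpose * B := by
    ext i j
    simp only [gram, Matrix.of_apply, Matrix.mul_apply, Matrix.transpose_apply, B, Pi.one_apply,
      one_mul]
    rw [← Finset.sum_coe_sort F]
    exact (Equiv.sum_comp σ (fun e : F => incidence s t r ℤ e i * incidence s t r ℤ e j)).symm
  let v : N → ({n : N // n ≠ r} → ℤ) := fun n j => if n = j then 1 else 0
  have hspan : ∀ a b, Relation.EqvGen (fun a b => ∃ f ∈ F, s f = a ∧ t f = b) a b →
      v a - v b ∈ Submodule.span ℤ (Set.range fun i => B i) := by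
    intro a b hab
    induction hab with
    | rel a b hab =>
      obtain ⟨f, hf, rfl, rfl⟩ := hab
      refine Submodule.subset_span ⟨σ.symm ⟨f, hf⟩, ?_⟩
      ext j
      simp [B, v, incidence]
    | refl => simp
    | symm a b _ ih => simpa using neg_mem ih
    | trans a b c _ _ ih1 ih2 => simpa using add_mem ih1 ih2
  have hX : ∀ j : {n : N // n ≠ r}, ∃ c : {n : N // n ≠ r} → ℤ,
      ∑ i, c i • B i = v j := by
    intro j
    have h1 := hspan j r (h _ _)
    have h2 : v r = 0 := by
      ext k
      simp only [v, Pi.zero_apply]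
      rw [if_neg (fun h => k.2 h.symm)]
    rw [h2, sub_zero] at h1
    exact (Submodule.mem_span_range_iff_exists_fun ℤ).1 h1
  choose c hc using hX
  have hXB : (Matrix.of c) * B = 1 := by
    ext j k
    have := congrFun (hc j) k
    simp only [Finset.sum_apply, Pi.smul_apply, smul_eq_mul, v] at this
    simp only [Matrix.mul_apply, Matrix.of_apply, this, Matrix.one_apply, Subtype.ext_iff]
  have hunit : IsUnit B.det := by
    have := congrArg Matrix.det hXB
    rw [Matrix.det_mul, Matrix.det_one] at this
    exact IsUnit.of_mul_eq_one_right _ this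
  rw [hB, Matrix.det_mul, Matrix.det_transpose]
  rcases Int.isUnit_iff.1 hunit with h | h <;> rw [h] <;> norm_num

theorem gram_incidence_cast (s t : α → N) (r : N) (F : Finset α) :
    (gram F 1 (incidence s t r ℝ)).det = ((gram F 1 (incidence s t r ℤ)).det : ℝ) := by
  have : gram F 1 (incidence s t r ℝ) = (gram F 1 (incidence s t r ℤ)).map (Int.castRingHom ℝ) := by
    ext i j
    simp [gram, incidence]
  rw [this, ← RingHom.mapMatrix_apply, ← RingHom.map_det]
  simp

/-- The matrix tree theorem: among the sets with one edge fewer than nodes, the spanning trees have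
Gram determinant 1 and all others 0. -/
theorem isRayleigh_spanningTrees (s t : α → N) [Nonempty N] (E : Finset α) :
    IsRayleigh ((E.powersetCard (Fintype.card N - 1)).filter (NodeConnected s t)) := by
  obtain ⟨r⟩ := ‹Nonempty N›
  have hc : Fintype.card {n : N // n ≠ r} = Fintype.card N - 1 := by
    rw [Fintype.card_subtype_compl]; simp
  refine isRayleigh_of_det _ E (incidence s t r ℝ) (fun w => ?_) (fun F hF => ?_)
  · rw [det_gram, hc, Finset.sum_filter]
    refine Finset.sum_congr rfl fun F hF => ?_
    rw [gram_incidence_cast]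
    split_ifs with h
    · rw [det_gram_incidence_of_connected s t r F h (by rw [(Finset.mem_powersetCard.1 hF).2, hc])]
      simp
    · rw [det_gram_incidence_of_not_connected s t r F h]
      simp
  · exact (Finset.mem_powersetCard.1 (Finset.mem_filter.1 hF).1).1

end Graph

end

section

variable {V : Type*} [Fintype V]

/-! ### The total value between two vertex sets -/

/-- The total value of the pairs between `A` and `B`. -/
def flow (x : Sym2 V → ℝ) (A B : Finset V) : ℝ := ∑ u ∈ A, ∑ v ∈ B, x s(u, v)

theorem flow_comm (x : Sym2 V → ℝ) (A B : Finset V) : flow x A B = flow x B A := by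
  unfold flow
  rw [Finset.sum_comm]
  exact Finset.sum_congr rfl fun u _ => Finset.sum_congr rfl fun v _ => by rw [Sym2.eq_swap]

theorem flow_union_left (x : Sym2 V → ℝ) {A B : Finset V} (C : Finset V) (h : Disjoint A B) :
    flow x (A ∪ B) C = flow x A C + flow x B C := Finset.sum_union h

theorem flow_union_right (x : Sym2 V → ℝ) {A B : Finset V} (C : Finset V) (h : Disjoint A B) :
    flow x C (A ∪ B) = flow x C A + flow x C B := by
  rw [flow_comm, flow_union_left x C h, flow_comm, flow_comm x B]

theorem IsHeldKarp.flow_nonneg {x : Sym2 V → ℝ} (hx : IsHeldKarp x) (A B : Finset V) :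
    0 ≤ flow x A B := Finset.sum_nonneg fun _ _ => Finset.sum_nonneg fun _ _ => hx.nonneg _

theorem IsHeldKarp.flow_mono_right {x : Sym2 V → ℝ} (hx : IsHeldKarp x) (A : Finset V)
    {B C : Finset V} (h : B ⊆ C) : flow x A B ≤ flow x A C := by
  rw [← Finset.union_sdiff_of_subset h, flow_union_right x A Finset.disjoint_sdiff]
  linarith [hx.flow_nonneg A (C \ B)]

theorem IsHeldKarp.two_le_flow {x : Sym2 V → ℝ} (hx : IsHeldKarp x) {A : Finset V}
    (h : A.Nonempty) (h' : Aᶜ.Nonempty) : 2 ≤ flow x A Aᶜ :=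
  hx.cut A h fun hA => by simp [hA] at h'

theorem flow_compl (x : Sym2 V → ℝ) (A : Finset V) : flow x Aᶜ Aᶜᶜ = flow x A Aᶜ := by
  rw [compl_compl, flow_comm]

theorem mem_cut {x : Sym2 V → ℝ} {S : Finset V} {e : Edge V} :
    e ∈ cut x S ↔ e ∈ supportEdges x ∧ ∃ u v, e.1 = s(u, v) ∧ u ∈ S ∧ v ∉ S := Finset.mem_filter

theorem cut_eq_edgesBetween (x : Sym2 V → ℝ) (S : Finset V) : cut x S = edgesBetween x S Sᶜ := by
  simp [cut, edgesBetween]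

theorem card_copies {x : Sym2 V → ℝ} (hhalf : IsHalfIntegral x) (p : Sym2 V) :
    ((Finset.univ.filter fun i : Fin 2 => (p, i) ∈ supportEdges x).card : ℝ) = 2 * x p := by
  simp only [supportEdges, Finset.mem_filter, Finset.mem_univ, true_and]
  rw [Finset.card_filter, Fin.sum_univ_two]
  rcases hhalf p with h | h | h <;> simp only [h] <;> norm_num

/-- Disjointness lets an unordered edge determine the ordered pair of its ends, so that no edge is
counted twice by the double sum. -/
theorem card_edgesBetween {x : Sym2 V → ℝ} (hhalf : IsHalfIntegral x) {A B : Finset V}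
    (hAB : Disjoint A B) : ((edgesBetween x A B).card : ℝ) = 2 * flow x A B := by
  have h1 : edgesBetween x A B = (A ×ˢ B).biUnion fun q =>
      (Finset.univ.filter fun i : Fin 2 => (s(q.1, q.2), i) ∈ supportEdges x).image
        fun i => (s(q.1, q.2), i) := by
    ext ⟨p, i⟩
    simp only [edgesBetween, Finset.mem_filter, Finset.mem_biUnion, Finset.mem_product,
      Finset.mem_image, Finset.mem_univ, true_and, Prod.exists]
    constructor
    · rintro ⟨h, u, v, rfl, hu, hv⟩
      exact ⟨u, v, ⟨hu, hv⟩, i, h, rfl⟩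
    · rintro ⟨u, v, ⟨hu, hv⟩, j, h, hj⟩
      obtain ⟨rfl, rfl⟩ := Prod.mk.inj hj
      exact ⟨h, u, v, rfl, hu, hv⟩
  rw [h1, Finset.card_biUnion]
  · push_cast
    rw [flow, Finset.mul_sum, Finset.sum_product]
    refine Finset.sum_congr rfl fun u _ => ?_
    rw [Finset.mul_sum]
    refine Finset.sum_congr rfl fun v _ => ?_
    rw [Finset.card_image_of_injective _ (fun i j h => (Prod.mk.inj h).2)]
    exact card_copies hhalf _
  · rintro ⟨u, v⟩ h ⟨u', v'⟩ h' hne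
    simp only [Finset.mem_coe, Finset.mem_product] at h h'
    rw [Function.onFun, Finset.disjoint_left]
    rintro _ he he'
    simp only [Finset.mem_image] at he he'
    obtain ⟨i, -, rfl⟩ := he
    obtain ⟨j, -, hj⟩ := he'
    have := (Prod.mk.inj hj).1
    rw [Sym2.eq_iff] at this
    rcases this with ⟨rfl, rfl⟩ | ⟨rfl, rfl⟩
    · exact hne rfl
    · exact Finset.disjoint_left.1 hAB h.1 h'.2

theorem card_cut {x : Sym2 V → ℝ} (hhalf : IsHalfIntegral x) (S : Finset V) :
    ((cut x S).card : ℝ) = 2 * flow x S Sᶜ := by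
  rw [cut_eq_edgesBetween, card_edgesBetween hhalf disjoint_compl_right]

theorem isTight_iff {x : Sym2 V → ℝ} (hhalf : IsHalfIntegral x) {P : Finset (Finset V)}
    {S : Finset V} : IsTight x P S ↔ IsVertexSet P S ∧ flow x S Sᶜ = 2 := by
  unfold IsTight
  have := card_cut hhalf S
  refine and_congr_right fun _ => ⟨fun h => ?_, fun h => ?_⟩
  · rw [h] at this; push_cast at this; linarith
  · rw [h] at this
    have h4 : ((cut x S).card : ℝ) = (4 : ℕ) := by rw [this]; norm_num
    exact_mod_cast h4

/-! ### Partitions -/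

/-- The sets in `P` partition the vertex set. -/
structure IsPart (P : Finset (Finset V)) : Prop where
  nonempty : ∀ B ∈ P, B.Nonempty
  eq_of_mem : ∀ B ∈ P, ∀ C ∈ P, ∀ v, v ∈ B → v ∈ C → B = C
  cover : ∀ v, ∃ B ∈ P, v ∈ B

theorem IsPart.disjoint {P : Finset (Finset V)} (hP : IsPart P) {B C : Finset V} (hB : B ∈ P)
    (hC : C ∈ P) (h : B ≠ C) : Disjoint B C :=
  Finset.disjoint_left.2 fun v hv hv' => h (hP.eq_of_mem B hB C hC v hv hv')

theorem isPart_singletons : IsPart (singletons V) where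
  nonempty B hB := by
    simp only [singletons, Finset.mem_image] at hB
    obtain ⟨v, -, rfl⟩ := hB
    simp
  eq_of_mem B hB C hC v h h' := by
    simp only [singletons, Finset.mem_image] at hB hC
    obtain ⟨u, -, rfl⟩ := hB
    obtain ⟨w, -, rfl⟩ := hC
    rw [Finset.mem_singleton] at h h'
    rw [← h, ← h']
  cover v := ⟨{v}, by simp [singletons], by simp⟩

theorem isVertexSet_iff {P : Finset (Finset V)} {S : Finset V} :
    IsVertexSet P S ↔ ∀ B ∈ P, ∀ u ∈ B, ∀ v ∈ B, u ∈ S → v ∈ S := by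
  constructor
  · intro h B hB u hu v hv huS
    rcases h B hB with h | h
    · exact h hv
    · exact (Finset.disjoint_left.1 h hu huS).elim
  · intro h B hB
    by_cases hd : Disjoint B S
    · exact .inr hd
    · rw [Finset.not_disjoint_iff] at hd
      obtain ⟨u, hu, huS⟩ := hd
      exact .inl fun v hv => h B hB u hu v hv huS

/-! ### Unions of blocks and contraction. -/

section VertexSet

variable {P : Finset (Finset V)} {S R : Finset V}

theorem IsVertexSet.compl (hS : IsVertexSet P S) : IsVertexSet P Sᶜ := by
  rw [isVertexSet_iff] at *
  intro B hB u hu v hv h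
  rw [Finset.mem_compl] at *
  exact fun h' => h (hS B hB v hv u hu h')

theorem IsVertexSet.inter (hS : IsVertexSet P S) (hR : IsVertexSet P R) :
    IsVertexSet P (S ∩ R) := by
  rw [isVertexSet_iff] at *
  intro B hB u hu v hv h
  rw [Finset.mem_inter] at *
  exact ⟨hS B hB u hu v hv h.1, hR B hB u hu v hv h.2⟩

theorem IsVertexSet.union (hS : IsVertexSet P S) (hR : IsVertexSet P R) :
    IsVertexSet P (S ∪ R) := by
  have := (hS.compl.inter hR.compl).compl
  rwa [Finset.compl_inter, compl_compl, compl_compl] at this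

theorem IsVertexSet.sdiff (hS : IsVertexSet P S) (hR : IsVertexSet P R) :
    IsVertexSet P (S \ R) := by
  rw [Finset.sdiff_eq_inter_compl]
  exact hS.inter hR.compl

theorem IsPart.isVertexSet (hP : IsPart P) (hS : S ∈ P) : IsVertexSet P S := by
  rw [isVertexSet_iff]
  intro B hB u hu v hv h
  rwa [← hP.eq_of_mem B hB S hS u hu h]

theorem IsPart.exists_subset (hP : IsPart P) (hS : IsVertexSet P S) (h : S.Nonempty) :
    ∃ B ∈ P, B ⊆ S := by
  obtain ⟨v, hv⟩ := h
  obtain ⟨B, hB, hvB⟩ := hP.cover v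
  exact ⟨B, hB, fun u hu => isVertexSet_iff.1 hS B hB v hvB u hu hv⟩

theorem mem_nodesIn {B : Finset V} : B ∈ nodesIn P S ↔ B ∈ P ∧ B ⊆ S := Finset.mem_filter

theorem two_le_card_nodesIn : 2 ≤ (nodesIn P S).card ↔
    ∃ B C, B ∈ P ∧ C ∈ P ∧ B ⊆ S ∧ C ⊆ S ∧ B ≠ C := by
  rw [show (2 ≤ (nodesIn P S).card) = (1 < (nodesIn P S).card) from rfl, Finset.one_lt_card]
  simp only [mem_nodesIn]
  constructor
  · rintro ⟨B, ⟨h1, h2⟩, C, ⟨h3, h4⟩, h⟩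
    exact ⟨B, C, h1, h3, h2, h4, h⟩
  · rintro ⟨B, C, h1, h3, h2, h4, h⟩
    exact ⟨B, ⟨h1, h2⟩, C, ⟨h3, h4⟩, h⟩

/-- A set that fails to be proper for lack of vertices is itself a single vertex of the contracted
graph. -/
theorem IsPart.mem_of_card_nodesIn (hP : IsPart P) (hS : IsVertexSet P S) (h : S.Nonempty)
    (hcard : ¬ 2 ≤ (nodesIn P S).card) : S ∈ P := by
  obtain ⟨B, hB, hBS⟩ := hP.exists_subset hS h
  suffices S = B by rwa [this]
  refine (Finset.Subset.antisymm hBS fun v hv => ?_).symm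
  obtain ⟨C, hC, hvC⟩ := hP.cover v
  have hCS : C ⊆ S := fun u hu => isVertexSet_iff.1 hS C hC v hvC u hu hv
  by_contra hvB
  exact hcard (two_le_card_nodesIn.2 ⟨B, C, hB, hC, hBS, hCS, fun h => hvB (h ▸ hvC)⟩)

theorem IsPart.not_two_le_card_nodesIn (hP : IsPart P) (hS : S ∈ P) :
    ¬ 2 ≤ (nodesIn P S).card := by
  rw [two_le_card_nodesIn]
  rintro ⟨B, C, hB, hC, hBS, hCS, h⟩
  have : ∀ D ∈ P, D ⊆ S → D = S := fun D hD hDS => by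
    obtain ⟨v, hv⟩ := hP.nonempty D hD
    exact hP.eq_of_mem D hD S hS v hv (hDS hv)
  exact h ((this B hB hBS).trans (this C hC hCS).symm)

theorem two_le_card_nodesIn_mono (hSR : S ⊆ R) (h : 2 ≤ (nodesIn P S).card) :
    2 ≤ (nodesIn P R).card := by
  rw [two_le_card_nodesIn] at *
  obtain ⟨B, C, hB, hC, hBS, hCS, h⟩ := h
  exact ⟨B, C, hB, hC, hBS.trans hSR, hCS.trans hSR, h⟩

/-- Every block of `P'` is a union of blocks of `P`. -/
def Coarser (P P' : Finset (Finset V)) : Prop := ∀ B ∈ P', IsVertexSet P B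

theorem Coarser.isVertexSet {P' : Finset (Finset V)} (h : Coarser P P') (hP' : IsPart P')
    (hS : IsVertexSet P' S) : IsVertexSet P S := by
  rw [isVertexSet_iff] at *
  intro B hB u hu v hv huS
  obtain ⟨C, hC, huC⟩ := hP'.cover u
  exact hS C hC u huC v (isVertexSet_iff.1 (h C hC) B hB u hu v hv huC) huS

theorem Coarser.two_le_card_nodesIn {P' : Finset (Finset V)} (h : Coarser P P') (hP : IsPart P)
    (hP' : IsPart P') (hS : 2 ≤ (nodesIn P' S).card) : 2 ≤ (nodesIn P S).card := by
  rw [HalfIntegralTSP.two_le_card_nodesIn] at *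
  obtain ⟨B, C, hB, hC, hBS, hCS, hne⟩ := hS
  obtain ⟨B', hB', hBB⟩ := hP.exists_subset (h B hB) (hP'.nonempty B hB)
  obtain ⟨C', hC', hCC⟩ := hP.exists_subset (h C hC) (hP'.nonempty C hC)
  refine ⟨B', C', hB', hC', hBB.trans hBS, hCC.trans hCS, fun heq => ?_⟩
  obtain ⟨v, hv⟩ := hP.nonempty B' hB'
  exact hne (hP'.eq_of_mem B hB C hC v (hBB hv) (hCC (heq ▸ hv)))

theorem Coarser.trans {P' P'' : Finset (Finset V)} (h : Coarser P P') (hP' : IsPart P')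
    (h' : Coarser P' P'') : Coarser P P'' := fun B hB => h.isVertexSet hP' (h' B hB)

theorem IsPart.coarser_refl (hP : IsPart P) : Coarser P P := fun _ hB => hP.isVertexSet hB

theorem Coarser.exists_superset {P' : Finset (Finset V)} (h : Coarser P P') (hP : IsPart P)
    (hP' : IsPart P') {B : Finset V} (hB : B ∈ P) : ∃ C ∈ P', B ⊆ C := by
  obtain ⟨v, hv⟩ := hP.nonempty B hB
  obtain ⟨C, hC, hvC⟩ := hP'.cover v
  exact ⟨C, hC, fun u hu => isVertexSet_iff.1 (h C hC) B hB v hv u hu hvC⟩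

theorem mem_contract {B : Finset V} : B ∈ contract P S ↔ B = S ∨ (B ∈ P ∧ ¬ B ⊆ S) := by
  simp [contract]

theorem IsPart.contract (hP : IsPart P) (hS : IsVertexSet P S) (h : S.Nonempty) :
    IsPart (contract P S) := by
  have key : ∀ B ∈ P, ¬ B ⊆ S → ∀ v, v ∈ B → v ∉ S := fun B hB hBS v hv hvS =>
    hBS fun u hu => isVertexSet_iff.1 hS B hB v hv u hu hvS
  refine ⟨fun B hB => ?_, fun B hB C hC v hvB hvC => ?_, fun v => ?_⟩
  · rcases mem_contract.1 hB with rfl | ⟨hB, -⟩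
    · exact h
    · exact hP.nonempty B hB
  · rcases mem_contract.1 hB with hB' | ⟨hB', hBS⟩ <;>
      rcases mem_contract.1 hC with hC' | ⟨hC', hCS⟩
    · rw [hB', hC']
    · exact (key C hC' hCS v hvC (hB' ▸ hvB)).elim
    · exact (key B hB' hBS v hvB (hC' ▸ hvC)).elim
    · exact hP.eq_of_mem B hB' C hC' v hvB hvC
  · by_cases hv : v ∈ S
    · exact ⟨S, mem_contract.2 (.inl rfl), hv⟩
    · obtain ⟨B, hB, hvB⟩ := hP.cover v
      exact ⟨B, mem_contract.2 (.inr ⟨hB, fun h => hv (h hvB)⟩), hvB⟩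

theorem IsPart.coarser_contract (hP : IsPart P) (hS : IsVertexSet P S) :
    Coarser P (HalfIntegralTSP.contract P S) := by
  intro B hB
  rcases mem_contract.1 hB with rfl | ⟨hB, -⟩
  · exact hS
  · exact hP.isVertexSet hB

theorem isVertexSet_contract (hR : IsVertexSet P R) (h : S ⊆ R ∨ Disjoint S R) :
    IsVertexSet (contract P S) R := by
  intro B hB
  rcases mem_contract.1 hB with rfl | ⟨hB, -⟩
  · exact h
  · exact hR B hB

theorem card_contract (hP : IsPart P) (hS : 2 ≤ (nodesIn P S).card) :
    (contract P S).card + (nodesIn P S).card = P.card + 1 := by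
  have hSP : S ∉ P := fun h => hP.not_two_le_card_nodesIn h hS
  rw [contract, Finset.card_insert_of_notMem (fun h => hSP (Finset.mem_filter.1 h).1)]
  have := Finset.card_filter_add_card_filter_not (s := P) (fun B => B ⊆ S)
  unfold nodesIn
  omega

end VertexSet

/-! ### Crossing sets -/

theorem cross_iff {S R : Finset V} : Cross S R ↔ (∃ v, v ∈ S ∧ v ∉ R) ∧ (∃ v, v ∈ R ∧ v ∉ S) ∧
    (∃ v, v ∈ S ∧ v ∈ R) ∧ ∃ v, v ∉ S ∧ v ∉ R := by
  simp [Cross, Finset.Nonempty]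

theorem Cross.compl_left {S R : Finset V} (h : Cross S R) : Cross Sᶜ R := by
  rw [cross_iff] at *
  obtain ⟨⟨a, ha, ha'⟩, ⟨b, hb, hb'⟩, ⟨c, hc, hc'⟩, ⟨d, hd, hd'⟩⟩ := h
  simp only [Finset.mem_compl, not_not]
  exact ⟨⟨d, hd, hd'⟩, ⟨c, hc', hc⟩, ⟨b, hb', hb⟩, ⟨a, ha, ha'⟩⟩

/-- The total values between the four parts of two crossing tight sets. -/
theorem cross_flow {x : Sym2 V → ℝ} (hx : IsHeldKarp x) {A Q : Finset V} (h : Cross A Q)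
    (hA : flow x A Aᶜ = 2) (hQ : flow x Q Qᶜ = 2) :
    flow x (A ∩ Q) (A \ Q) = 1 ∧ flow x (A ∩ Q) (A ∪ Q)ᶜ = 0 ∧ flow x (A \ Q) (Q \ A) = 0 ∧
      flow x (A ∩ Q) (A ∩ Q)ᶜ = 2 ∧ flow x (A \ Q) (A \ Q)ᶜ = 2 ∧
      flow x (Q \ A) (Q \ A)ᶜ = 2 ∧ flow x (A ∪ Q)ᶜ (A ∪ Q)ᶜᶜ = 2 := by
  obtain ⟨hY, hZ, hX, hW⟩ := h
  have eX : (A ∩ Q)ᶜ = (A \ Q) ∪ ((Q \ A) ∪ (A ∪ Q)ᶜ) := by ext v; simp; tauto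
  have eY : (A \ Q)ᶜ = (A ∩ Q) ∪ ((Q \ A) ∪ (A ∪ Q)ᶜ) := by ext v; simp; tauto
  have eZ : (Q \ A)ᶜ = (A ∩ Q) ∪ ((A \ Q) ∪ (A ∪ Q)ᶜ) := by ext v; simp; tauto
  have eW : (A ∪ Q)ᶜᶜ = (A ∩ Q) ∪ ((A \ Q) ∪ (Q \ A)) := by ext v; simp; tauto
  have eA : A = (A ∩ Q) ∪ (A \ Q) := by ext v; simp; tauto
  have eAc : Aᶜ = (Q \ A) ∪ (A ∪ Q)ᶜ := by ext v; simp; tauto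
  have eQ : Q = (A ∩ Q) ∪ (Q \ A) := by ext v; simp; tauto
  have eQc : Qᶜ = (A \ Q) ∪ (A ∪ Q)ᶜ := by ext v; simp; tauto
  have dXY : Disjoint (A ∩ Q) (A \ Q) := by rw [Finset.disjoint_left]; intro v; simp; tauto
  have dXZ : Disjoint (A ∩ Q) (Q \ A) := by rw [Finset.disjoint_left]; intro v; simp; tauto
  have dXW : Disjoint (A ∩ Q) (A ∪ Q)ᶜ := by rw [Finset.disjoint_left]; intro v; simp; tauto
  have dYZ : Disjoint (A \ Q) (Q \ A) := by rw [Finset.disjoint_left]; intro v; simp; tauto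
  have dYW : Disjoint (A \ Q) (A ∪ Q)ᶜ := by rw [Finset.disjoint_left]; intro v; simp; tauto
  have dZW : Disjoint (Q \ A) (A ∪ Q)ᶜ := by rw [Finset.disjoint_left]; intro v; simp; tauto
  have fX := hx.two_le_flow hX (by rw [eX]; exact hY.inl)
  have fY := hx.two_le_flow hY (by rw [eY]; exact hX.inl)
  have fZ := hx.two_le_flow hZ (by rw [eZ]; exact hX.inl)
  have fW := hx.two_le_flow hW (by rw [eW]; exact hX.inl)
  rw [eX, flow_union_right x _ (Finset.disjoint_union_right.2 ⟨dYZ, dYW⟩),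
    flow_union_right x _ dZW] at *
  rw [eY, flow_union_right x _ (Finset.disjoint_union_right.2 ⟨dXZ, dXW⟩),
    flow_union_right x _ dZW, flow_comm x (A \ Q) (A ∩ Q)] at *
  rw [eZ, flow_union_right x _ (Finset.disjoint_union_right.2 ⟨dXY, dXW⟩),
    flow_union_right x _ dYW, flow_comm x (Q \ A) (A ∩ Q), flow_comm x (Q \ A) (A \ Q)] at *
  rw [eW, flow_union_right x _ (Finset.disjoint_union_right.2 ⟨dXY, dXZ⟩),
    flow_union_right x _ dYZ, flow_comm x (A ∪ Q)ᶜ (A ∩ Q), flow_comm x (A ∪ Q)ᶜ (A \ Q),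
    flow_comm x (A ∪ Q)ᶜ (Q \ A)] at *
  have gA : flow x (A ∩ Q) (Q \ A) + flow x (A ∩ Q) (A ∪ Q)ᶜ + (flow x (A \ Q) (Q \ A) +
      flow x (A \ Q) (A ∪ Q)ᶜ) = 2 := by
    rw [← hA]
    conv_rhs => rw [eAc]
    conv_rhs => enter [2]; rw [eA]
    rw [flow_union_left x _ dXY, flow_union_right x _ dZW, flow_union_right x _ dZW]
  have gQ : flow x (A ∩ Q) (A \ Q) + flow x (A ∩ Q) (A ∪ Q)ᶜ + (flow x (A \ Q) (Q \ A) +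
      flow x (Q \ A) (A ∪ Q)ᶜ) = 2 := by
    rw [← hQ]
    conv_rhs => rw [eQc]
    conv_rhs => enter [2]; rw [eQ]
    rw [flow_union_left x _ dXZ, flow_union_right x _ dYW, flow_union_right x _ dYW,
      flow_comm x (Q \ A) (A \ Q)]
  -- The cuts of two opposite parts add up to 4 minus twice the flow between the other two opposite
  -- parts. Each cut being at least 2, both diagonal flows vanish and all four parts are tight.
  have n1 := hx.flow_nonneg (A ∩ Q) (A ∪ Q)ᶜ
  have n2 := hx.flow_nonneg (A \ Q) (Q \ A)
  clear hA hQ eX eY eZ eW eA eAc eQ eQc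
  refine ⟨?_, ?_, ?_, ?_, ?_, ?_, ?_⟩ <;> linarith

end

section

variable {V : Type*} [Fintype V]

/-! ### Contracted graphs in which all proper tight sets are crossed -/

/-- In a triangle whose three degrees are 2, the three degree equations determine the sides. -/
theorem flow_eq_one_of_card_eq_three {x : Sym2 V → ℝ} {P : Finset (Finset V)} (hP : IsPart P)
    (hcard : P.card = 3) (hdeg : ∀ B ∈ P, flow x B Bᶜ = 2) {B C : Finset V} (hB : B ∈ P)
    (hC : C ∈ P) (hBC : B ≠ C) : flow x B C = 1 := by
  have h2 : ((P.erase B).erase C).card = 1 := by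
    rw [Finset.card_erase_of_mem (Finset.mem_erase.2 ⟨hBC.symm, hC⟩), Finset.card_erase_of_mem hB,
      hcard]
  obtain ⟨D, hD⟩ := Finset.card_eq_one.1 h2
  have hD' : D ∈ (P.erase B).erase C := by rw [hD]; simp
  have hDC : D ≠ C := Finset.ne_of_mem_erase hD'
  have hDB : D ≠ B := Finset.ne_of_mem_erase (Finset.mem_of_mem_erase hD')
  have hDP : D ∈ P := Finset.mem_of_mem_erase (Finset.mem_of_mem_erase hD')
  have hcov : ∀ v, v ∈ B ∨ v ∈ C ∨ v ∈ D := by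
    intro v
    obtain ⟨E, hE, hv⟩ := hP.cover v
    by_cases h1 : E = B
    · exact .inl (h1 ▸ hv)
    by_cases h2 : E = C
    · exact .inr (.inl (h2 ▸ hv))
    have : E ∈ (P.erase B).erase C := Finset.mem_erase.2 ⟨h2, Finset.mem_erase.2 ⟨h1, hE⟩⟩
    rw [hD, Finset.mem_singleton] at this
    exact .inr (.inr (this ▸ hv))
  have compl : ∀ X Y Z : Finset V, X ∈ P → Y ∈ P → Z ∈ P → X ≠ Y → X ≠ Z → Y ≠ Z →
      (∀ v, v ∈ X ∨ v ∈ Y ∨ v ∈ Z) → flow x X Y + flow x X Z = 2 := by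
    intro X Y Z hX hY hZ hXY hXZ hYZ hc
    rw [← hdeg X hX, ← flow_union_right x X (hP.disjoint hY hZ hYZ)]
    congr 1
    ext v
    have := hc v
    have h1 : v ∈ X → v ∉ Y := fun h => Finset.disjoint_left.1 (hP.disjoint hX hY hXY) h
    have h2 : v ∈ X → v ∉ Z := fun h => Finset.disjoint_left.1 (hP.disjoint hX hZ hXZ) h
    simp only [Finset.mem_union, Finset.mem_compl]
    tauto
  have e1 := compl B C D hB hC hDP hBC hDB.symm hDC.symm hcov
  have e2 := compl C B D hC hB hDP hBC.symm hDC.symm hDB.symm (fun v => by have := hcov v; tauto)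
  have e3 := compl D B C hDP hB hC hDB hDC hBC (fun v => by have := hcov v; tauto)
  rw [flow_comm x C B] at e2
  rw [flow_comm x D B, flow_comm x D C] at e3
  linarith

/-- A crossing tight set can be modified so as not to separate the vertices of a tight set. -/
theorem exists_cross_contract {x : Sym2 V → ℝ} (hx : IsHeldKarp x) {P : Finset (Finset V)}
    {R R' Q : Finset V} (hR : IsVertexSet P R) (hRt : flow x R Rᶜ = 2)
    (hRR' : R ⊂ R') (hQ : IsVertexSet P Q) (hQt : flow x Q Qᶜ = 2) (hc : Cross R' Q) :
    ∃ Q', IsVertexSet (contract P R) Q' ∧ flow x Q' Q'ᶜ = 2 ∧ Cross R' Q' := by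
  by_cases h1 : R ⊆ Q ∨ Disjoint R Q
  · exact ⟨Q, isVertexSet_contract hQ h1, hQt, hc⟩
  push Not at h1
  obtain ⟨h1, h2⟩ := h1
  rw [Finset.not_subset] at h1
  rw [Finset.not_disjoint_iff] at h2
  obtain ⟨p, hpR, hpQ⟩ := h1
  obtain ⟨q, hqR, hqQ⟩ := h2
  rw [cross_iff] at hc
  obtain ⟨⟨a, ha, ha'⟩, ⟨b, hb, hb'⟩, -, ⟨d, hd, hd'⟩⟩ := hc
  have hRQ : Cross R Q := cross_iff.2 ⟨⟨p, hpR, hpQ⟩, ⟨b, hb, fun h => hb' (hRR'.1 h)⟩,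
      ⟨q, hqR, hqQ⟩,
    ⟨d, fun h => hd (hRR'.1 h), hd'⟩⟩
  obtain ⟨-, -, -, -, -, f3, f4⟩ := cross_flow hx hRQ hRt hQt
  rw [flow_compl] at f4
  obtain ⟨c, hc, hcR⟩ := Finset.exists_of_ssubset hRR'
  -- `Q` splits `R`, and both `Q \ R` and `R ∪ Q` are tight sets that do not. The position of a
  -- point of `R'` outside `R` decides which of them still crosses `R'`.
  by_cases hcQ : c ∈ Q
  · refine ⟨Q \ R, isVertexSet_contract (hQ.sdiff hR) (.inr Finset.disjoint_sdiff), f3, ?_⟩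
    rw [cross_iff]
    simp only [Finset.mem_sdiff, not_and, not_not]
    exact ⟨⟨p, hRR'.1 hpR, fun _ => hpR⟩, ⟨b, ⟨hb, fun h => hb' (hRR'.1 h)⟩, hb'⟩,
        ⟨c, hc, hcQ, hcR⟩,
      ⟨d, hd, fun h => (hd' h).elim⟩⟩
  · refine ⟨R ∪ Q, isVertexSet_contract (hR.union hQ) (.inl Finset.subset_union_left), f4, ?_⟩
    rw [cross_iff]
    simp only [Finset.mem_union, not_or]
    exact ⟨⟨c, hc, hcR, hcQ⟩, ⟨b, .inr hb, hb'⟩, ⟨p, hRR'.1 hpR, .inl hpR⟩,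
      ⟨d, hd, fun h => hd (hRR'.1 h), hd'⟩⟩

/-- If every proper tight set is crossed by a tight set, and there is a proper tight set (or there
are only three vertices), then the edges come in parallel pairs. -/
theorem flow_eq_zero_or_one_of_crossed {x : Sym2 V → ℝ} (hx : IsHeldKarp x) (n : ℕ) :
    ∀ P : Finset (Finset V), P.card = n → 3 ≤ n → IsPart P → (∀ B ∈ P, flow x B Bᶜ = 2) →
    (∀ R, IsVertexSet P R → flow x R Rᶜ = 2 → IsProper P R →
      ∃ Q, IsVertexSet P Q ∧ flow x Q Qᶜ = 2 ∧ Cross R Q) →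
    (P.card = 3 ∨ ∃ R, IsVertexSet P R ∧ flow x R Rᶜ = 2 ∧ IsProper P R) →
    ∀ B ∈ P, ∀ C ∈ P, B ≠ C → flow x B C = 0 ∨ flow x B C = 1 := by
  induction n with
  | zero => intro P _ h; omega
  | succ n ih =>
  intro P hcard hn hP hdeg hcross hex
  by_cases h3 : P.card = 3
  · exact fun B hB C hC hBC => .inr (flow_eq_one_of_card_eq_three hP h3 hdeg hB hC hBC)
  replace hex := hex.resolve_left h3
  -- A smallest proper tight set has just two vertices: a tight set crossing it splits it into two
  -- smaller tight sets, which must be single vertices. Contracting it gives the induction.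
  obtain ⟨R, hRm, hmin⟩ := Finset.exists_min_image
    (Finset.univ.filter fun R => IsVertexSet P R ∧ flow x R Rᶜ = 2 ∧ IsProper P R) Finset.card
    (by obtain ⟨R, hR⟩ := hex; exact ⟨R, Finset.mem_filter.2 ⟨Finset.mem_univ _, hR⟩⟩)
  obtain ⟨-, hR, hRt, hRp⟩ := Finset.mem_filter.1 hRm
  obtain ⟨Q, hQ, hQt, hRQ⟩ := hcross R hR hRt hRp
  obtain ⟨fXY, fXW, fYZ, fX, fY, fZ, fW⟩ := cross_flow hx hRQ hRt hQt
  have small : ∀ A ⊂ R, IsVertexSet P A → flow x A Aᶜ = 2 → A.Nonempty → A ∈ P := by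
    intro A hA hAv hAt hAne
    refine hP.mem_of_card_nodesIn hAv hAne fun hcard => ?_
    have := hmin A (Finset.mem_filter.2 ⟨Finset.mem_univ _, hAv, hAt, hcard,
      two_le_card_nodesIn_mono (Finset.compl_subset_compl.2 hA.1) hRp.2⟩)
    exact absurd (Finset.card_lt_card hA) (by omega)
  obtain ⟨hYne, hZne, hXne, hWne⟩ := hRQ
  have hXP : R ∩ Q ∈ P := small _ (by
    refine Finset.ssubset_iff_subset_ne.2 ⟨Finset.inter_subset_left, fun h => ?_⟩
    rw [Finset.inter_eq_left, ← Finset.sdiff_eq_empty_iff_subset] at h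
    simp [h] at hYne) (hR.inter hQ) fX hXne
  have hYP : R \ Q ∈ P := small _ (by
    refine Finset.ssubset_iff_subset_ne.2 ⟨Finset.sdiff_subset, fun h => ?_⟩
    rw [Finset.sdiff_eq_self_iff_disjoint, Finset.disjoint_iff_inter_eq_empty] at h
    simp [h] at hXne) (hR.sdiff hQ) fY hYne
  have hXY : R ∩ Q ≠ R \ Q := by
    intro h
    obtain ⟨v, hv⟩ := hXne
    have hv' := h ▸ hv
    exact (Finset.mem_sdiff.1 hv').2 (Finset.mem_inter.1 hv).2
  have hin : ∀ B ∈ P, B ⊆ R → B = R ∩ Q ∨ B = R \ Q := by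
    intro B hB hBR
    obtain ⟨v, hv⟩ := hP.nonempty B hB
    by_cases hvQ : v ∈ Q
    · exact .inl (hP.eq_of_mem B hB _ hXP v hv (Finset.mem_inter.2 ⟨hBR hv, hvQ⟩))
    · exact .inr (hP.eq_of_mem B hB _ hYP v hv (Finset.mem_sdiff.2 ⟨hBR hv, hvQ⟩))
  have hnodes : nodesIn P R = {R ∩ Q, R \ Q} := by
    ext B
    rw [mem_nodesIn, Finset.mem_insert, Finset.mem_singleton]
    refine ⟨fun h => hin B h.1 h.2, ?_⟩
    rintro (rfl | rfl)
    · exact ⟨hXP, Finset.inter_subset_left⟩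
    · exact ⟨hYP, Finset.sdiff_subset⟩
  have hRne : R.Nonempty := hXne.mono Finset.inter_subset_left
  have hP1 := hP.contract hR hRne
  have hco := hP.coarser_contract hR
  have hcard1 : (contract P R).card = n := by
    have := card_contract hP hRp.1
    rw [hnodes, Finset.card_pair hXY] at this
    omega
  have hdeg1 : ∀ B ∈ contract P R, flow x B Bᶜ = 2 := by
    intro B hB
    rcases mem_contract.1 hB with rfl | ⟨hB, -⟩
    · exact hRt
    · exact hdeg B hB
  have hRmem : R ∈ contract P R := mem_contract.2 (.inl rfl)
  -- Crossings survive the contraction; when `R` lies outside `R'`, the complement of `R'` is used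
  -- instead.
  have hcross1 : ∀ R', IsVertexSet (contract P R) R' → flow x R' R'ᶜ = 2 →
      IsProper (contract P R) R' →
      ∃ Q, IsVertexSet (contract P R) Q ∧ flow x Q Qᶜ = 2 ∧ Cross R' Q := by
    intro R' hR' hR't hR'p
    have hvs := hco.isVertexSet hP1 hR'
    obtain ⟨Q', hQ', hQ't, hc⟩ := hcross R' hvs hR't
      ⟨hco.two_le_card_nodesIn hP hP1 hR'p.1, hco.two_le_card_nodesIn hP hP1 hR'p.2⟩
    rcases hR' R hRmem with h | h
    · refine exists_cross_contract hx hR hRt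
        (Finset.ssubset_iff_subset_ne.2 ⟨h, fun h => ?_⟩) hQ' hQ't hc
      exact hP1.not_two_le_card_nodesIn hRmem (h ▸ hR'p.1)
    · obtain ⟨Q'', h1, h2, h3⟩ := exists_cross_contract (R' := R'ᶜ) hx hR hRt
        (Finset.ssubset_iff_subset_ne.2 ⟨fun v hv => Finset.mem_compl.2
          (Finset.disjoint_left.1 h hv), fun h' => hP1.not_two_le_card_nodesIn hRmem
            (h' ▸ hR'p.2)⟩) hQ' hQ't hc.compl_left
      refine ⟨Q'', h1, h2, ?_⟩
      simpa using h3.compl_left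
  have hZv : IsVertexSet P (Q \ R) := hQ.sdiff hR
  have hWv : IsVertexSet P (R ∪ Q)ᶜ := (hR.union hQ).compl
  have hZ1 : IsVertexSet (contract P R) (Q \ R) :=
    isVertexSet_contract hZv (.inr Finset.disjoint_sdiff)
  have hW1 : IsVertexSet (contract P R) (R ∪ Q)ᶜ := isVertexSet_contract hWv (.inr (by
    rw [Finset.disjoint_left]; intro v hv; simp [hv]))
  -- Without a proper tight set, the tight sets `Q \ R` and `(R ∪ Q)ᶜ` are single vertices, and
  -- together with `R` they are all the vertices.
  have hex1 : (contract P R).card = 3 ∨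
      ∃ R', IsVertexSet (contract P R) R' ∧ flow x R' R'ᶜ = 2 ∧ IsProper (contract P R) R' := by
    by_contra hcon
    push Not at hcon
    obtain ⟨hne3, hcon⟩ := hcon
    obtain ⟨ZB, hZB, hZB'⟩ := hP1.exists_subset hZ1 hZne
    obtain ⟨WB, hWB, hWB'⟩ := hP1.exists_subset hW1 hWne
    have dZ : ∀ v ∈ Q \ R, v ∉ R := fun v hv => (Finset.mem_sdiff.1 hv).2
    have dW : ∀ v ∈ (R ∪ Q)ᶜ, v ∉ R ∧ v ∉ Q := fun v hv => by simpa using hv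
    have hRW : R ≠ WB := by
      rintro rfl
      obtain ⟨v, hv⟩ := hRne
      exact (dW v (hWB' hv)).1 hv
    have hRZ : R ≠ ZB := by
      rintro rfl
      obtain ⟨v, hv⟩ := hRne
      exact (dZ v (hZB' hv)) hv
    have hZp : ¬ 2 ≤ (nodesIn (contract P R) (Q \ R)).card := fun h =>
      hcon _ hZ1 fZ ⟨h, two_le_card_nodesIn.2 ⟨R, WB, hRmem, hWB,
        fun v hv => by simp [hv], fun v hv => by
          have := dW v (hWB' hv)
          simp [this.2], hRW⟩⟩
    have hWp : ¬ 2 ≤ (nodesIn (contract P R) (R ∪ Q)ᶜ).card := fun h =>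
      hcon _ hW1 fW ⟨h, two_le_card_nodesIn.2 ⟨R, ZB, hRmem, hZB,
        fun v hv => by simp [hv], fun v hv => by
          have := Finset.mem_sdiff.1 (hZB' hv)
          simp [this.1], hRZ⟩⟩
    have hZP := hP1.mem_of_card_nodesIn hZ1 hZne hZp
    have hWP := hP1.mem_of_card_nodesIn hW1 hWne hWp
    have : contract P R = {R, Q \ R, (R ∪ Q)ᶜ} := by
      ext B
      simp only [Finset.mem_insert, Finset.mem_singleton]
      constructor
      · intro hB
        obtain ⟨v, hv⟩ := hP1.nonempty B hB
        by_cases hvR : v ∈ R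
        · exact .inl (hP1.eq_of_mem B hB R hRmem v hv hvR)
        by_cases hvQ : v ∈ Q
        · exact .inr (.inl (hP1.eq_of_mem B hB _ hZP v hv (Finset.mem_sdiff.2 ⟨hvQ, hvR⟩)))
        · exact .inr (.inr (hP1.eq_of_mem B hB _ hWP v hv (by simp [hvR, hvQ])))
      · rintro (rfl | rfl | rfl)
        · exact hRmem
        · exact hZP
        · exact hWP
    have hle : (contract P R).card ≤ 3 := by rw [this]; exact Finset.card_le_three
    omega
  have key := ih (contract P R) hcard1 (by omega) hP1 hdeg1 hcross1 hex1
  have inner : ∀ B ∈ P, ∀ C ∈ P, B ⊆ R → ¬ C ⊆ R → flow x B C = 0 ∨ flow x B C = 1 := by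
    intro B hB C hC hBR hCR
    have hC1 : C ∈ contract P R := mem_contract.2 (.inr ⟨hC, hCR⟩)
    have h1 := key R hRmem C hC1 (by rintro rfl; exact hCR le_rfl)
    have hunion : flow x R C = flow x (R ∩ Q) C + flow x (R \ Q) C := by
      rw [← flow_union_left x C (by rw [Finset.disjoint_left]; intro v; simp; tauto)]
      congr 1
      ext v; simp; tauto
    have hCdR : Disjoint C R := (hR C hC).resolve_left hCR
    -- The diagonal flows of the crossing vanish, so a vertex outside `R` sees only one of the two
    -- halves of `R`, and that half carries the whole flow of `R` to it.
    have hz : flow x (R ∩ Q) C = 0 ∨ flow x (R \ Q) C = 0 := by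
      rcases hQ C hC with h | h
      · right
        refine le_antisymm ?_ (hx.flow_nonneg _ _)
        rw [← fYZ]
        exact hx.flow_mono_right _ fun v hv =>
          Finset.mem_sdiff.2 ⟨h hv, Finset.disjoint_left.1 hCdR hv⟩
      · left
        refine le_antisymm ?_ (hx.flow_nonneg _ _)
        rw [← fXW]
        refine hx.flow_mono_right _ fun v hv => ?_
        simp [Finset.disjoint_left.1 hCdR hv, Finset.disjoint_left.1 h hv]
    rw [hunion] at h1
    rcases hin B hB hBR with rfl | rfl <;> rcases hz with hz | hz <;>
        simp only [hz, zero_add, add_zero] at h1 ⊢ <;> simp [h1]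
  intro B hB C hC hBC
  by_cases hBR : B ⊆ R <;> by_cases hCR : C ⊆ R
  · right
    rcases hin B hB hBR with rfl | rfl <;> rcases hin C hC hCR with rfl | rfl
    · exact (hBC rfl).elim
    · exact fXY
    · rw [flow_comm]; exact fXY
    · exact (hBC rfl).elim
  · exact inner B hB C hC hBR hCR
  · rw [flow_comm]
    exact inner C hC B hB hCR hBR
  · exact key B (mem_contract.2 (.inr ⟨hB, hBR⟩)) C (mem_contract.2 (.inr ⟨hC, hCR⟩)) hBC

end

section

/-! ### Probabilities as finite sums -/

section Pr

variable {β : Type*} [Fintype β]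

/-- The probability of an event under a distribution on a finite type, as a real number. -/
def pr (μ : PMF β) (X : β → Prop) : ℝ := ∑ b, if X b then (μ b).toReal else 0

theorem toReal_toOuterMeasure (μ : PMF β) (X : β → Prop) :
    (μ.toOuterMeasure {b | X b}).toReal = pr μ X := by
  rw [PMF.toOuterMeasure_apply_fintype, ENNReal.toReal_sum]
  · refine Finset.sum_congr rfl fun b _ => ?_
    by_cases h : X b <;> simp [h]
  · intro b _
    by_cases h : X b <;> simp [h, μ.apply_ne_top]

theorem toOuterMeasure_ne_top (μ : PMF β) (X : Set β) : μ.toOuterMeasure X ≠ ⊤ := by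
  rw [PMF.toOuterMeasure_apply_fintype]
  refine ENNReal.sum_ne_top.2 fun b _ => ?_
  by_cases h : b ∈ X <;> simp [h, μ.apply_ne_top]

theorem pr_nonneg (μ : PMF β) (X : β → Prop) : 0 ≤ pr μ X :=
  Finset.sum_nonneg fun b _ => by split_ifs <;> simp

theorem pr_true (μ : PMF β) : pr μ (fun _ => True) = 1 := by
  rw [← toReal_toOuterMeasure]
  have : μ.toOuterMeasure {b | True} = 1 := by
    rw [PMF.toOuterMeasure_apply_eq_one_iff]; simp
  rw [this]; simp

theorem pr_congr {μ : PMF β} {X Y : β → Prop} (h : ∀ b, μ b ≠ 0 → (X b ↔ Y b)) :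
    pr μ X = pr μ Y := by
  refine Finset.sum_congr rfl fun b _ => ?_
  by_cases hb : μ b = 0
  · simp [hb]
  · simp [h b hb]

theorem pr_mono {μ : PMF β} {X Y : β → Prop} (h : ∀ b, μ b ≠ 0 → X b → Y b) :
    pr μ X ≤ pr μ Y := by
  refine Finset.sum_le_sum fun b _ => ?_
  by_cases hb : μ b = 0
  · simp [hb]
  · by_cases hX : X b
    · simp [hX, h b hb hX]
    · simp only [hX, if_false]; split_ifs <;> simp

theorem pr_eq_zero {μ : PMF β} {X : β → Prop} (h : ∀ b, μ b ≠ 0 → ¬ X b) : pr μ X = 0 := by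
  refine Finset.sum_eq_zero fun b _ => ?_
  by_cases hb : μ b = 0
  · simp [hb]
  · simp [h b hb]

theorem pr_split (μ : PMF β) (X Y : β → Prop) :
    pr μ X = pr μ (fun b => X b ∧ Y b) + pr μ (fun b => X b ∧ ¬ Y b) := by
  simp only [pr, ← Finset.sum_add_distrib]
  refine Finset.sum_congr rfl fun b _ => ?_
  by_cases hX : X b <;> by_cases hY : Y b <;> simp [hX, hY]

theorem pr_compl (μ : PMF β) (X : β → Prop) : pr μ (fun b => ¬ X b) = 1 - pr μ X := by
  have := pr_split μ (fun _ => True) X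
  simp only [pr_true, true_and] at this
  linarith

theorem sum_pmf (μ : PMF β) : ∑ b, (μ b).toReal = 1 := by
  simpa [pr] using pr_true μ

end Pr

/-! ### Unions of independent samples. -/

section Union

variable {α : Type*} [Fintype α] [DecidableEq α]

theorem pr_bind_union (μ ν : PMF (Finset α)) (X : Finset α → Prop) :
    pr (μ.bind fun F => ν.map fun F' => F ∪ F') X =
      ∑ F, (μ F).toReal * pr ν (fun F' => X (F ∪ F')) := by
  rw [← toReal_toOuterMeasure, PMF.toOuterMeasure_bind_apply, tsum_fintype, ENNReal.toReal_sum]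
  · refine Finset.sum_congr rfl fun F _ => ?_
    rw [ENNReal.toReal_mul, PMF.toOuterMeasure_map_apply, ← toReal_toOuterMeasure]
    rfl
  · intro F _
    exact ENNReal.mul_ne_top (μ.apply_ne_top F) (toOuterMeasure_ne_top _ _)

theorem bind_union_ne_zero {μ ν : PMF (Finset α)} {T : Finset α}
    (h : (μ.bind fun F => ν.map fun F' => F ∪ F') T ≠ 0) :
    ∃ F F', μ F ≠ 0 ∧ ν F' ≠ 0 ∧ T = F ∪ F' := by
  rw [← PMF.mem_support_iff, PMF.mem_support_bind_iff] at h
  obtain ⟨F, hF, h⟩ := h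
  rw [PMF.mem_support_map_iff] at h
  obtain ⟨F', hF', h⟩ := h
  exact ⟨F, F', hF, hF', h.symm⟩

end Union

variable {V : Type*} [Fintype V]

/-! ### Invariants of the algorithm -/

/-- The properties shared by all contracted graphs that occur in the algorithm. -/
structure IsState (x : Sym2 V → ℝ) (ePlus : Sym2 V) (P : Finset (Finset V)) : Prop where
  part : IsPart P
  deg : ∀ B ∈ P, flow x B Bᶜ = 2
  plus : ∀ B ∈ P, ¬ ∀ v ∈ ePlus, v ∈ B
  card : 3 ≤ P.card

theorem IsHeldKarp.isState_singletons {x : Sym2 V → ℝ} (hx : IsHeldKarp x)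
    (hhalf : IsHalfIntegral x) {ePlus : Sym2 V} (hePlus : x ePlus = 1) :
    IsState x ePlus (singletons V) where
  part := isPart_singletons
  deg B hB := by
    simp only [singletons, Finset.mem_image] at hB
    obtain ⟨u, -, rfl⟩ := hB
    have h := hx.degree u
    rw [← Finset.sum_add_sum_compl {u}, Finset.sum_singleton, hx.loopless, zero_add] at h
    rw [flow, Finset.sum_singleton, h]
  plus B hB h := by
    simp only [singletons, Finset.mem_image] at hB
    obtain ⟨u, -, rfl⟩ := hB
    induction ePlus using Sym2.ind with
    | _ a b =>
      have ha := Finset.mem_singleton.1 (h a (by simp))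
      have hb := Finset.mem_singleton.1 (h b (by simp))
      rw [ha, hb, hx.loopless] at hePlus
      norm_num at hePlus
  card := by
    obtain ⟨u⟩ : Nonempty V := by
      induction ePlus using Sym2.ind with
      | _ a b => exact ⟨a⟩
    have h := hx.degree u
    rw [← Finset.sum_add_sum_compl {u}, Finset.sum_singleton, hx.loopless, zero_add] at h
    -- Degree 2 with values at most 1 requires two neighbours, hence three vertices.
    have hle : ∑ v ∈ ({u} : Finset V)ᶜ, x s(u, v) ≤ ∑ v ∈ ({u} : Finset V)ᶜ, (1 : ℝ) := by
      refine Finset.sum_le_sum fun v _ => ?_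
      rcases hhalf s(u, v) with h | h | h <;> rw [h] <;> norm_num
    rw [h, Finset.sum_const, Finset.card_compl, Finset.card_singleton, nsmul_eq_mul, mul_one] at hle
    have h2 : 2 ≤ Fintype.card V - 1 := by exact_mod_cast hle
    rw [singletons, Finset.card_image_of_injective _ Finset.singleton_injective, Finset.card_univ]
    omega

/-! ### One iteration, and the execution up to a selected set. -/

section Step

variable {x : Sym2 V → ℝ} {ePlus : Sym2 V} {P : Finset (Finset V)} {S : Finset V}

theorem nonempty_of_two_le (hP : IsPart P) (h : 2 ≤ (nodesIn P S).card) : S.Nonempty := by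
  obtain ⟨B, C, hB, -, hBS, -, -⟩ := two_le_card_nodesIn.1 h
  exact (hP.nonempty B hB).mono hBS

theorem IsState.step (hhalf : IsHalfIntegral x) (hP : IsState x ePlus P)
    (hS : IsSelectable x ePlus P S) : IsState x ePlus (contract P S) := by
  obtain ⟨⟨⟨ht, hp, -⟩, hplus⟩, -⟩ := hS
  rw [isTight_iff hhalf] at ht
  have hne := nonempty_of_two_le hP.part hp.1
  refine ⟨hP.part.contract ht.1 hne, fun B hB => ?_, fun B hB => ?_, ?_⟩
  · rcases mem_contract.1 hB with rfl | ⟨hB, -⟩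
    · exact ht.2
    · exact hP.deg B hB
  · rcases mem_contract.1 hB with rfl | ⟨hB, -⟩
    · exact hplus
    · exact hP.plus B hB
  -- The new vertex and the at least two vertices outside `S` remain.
  · have hsub : insert S (nodesIn P Sᶜ) ⊆ contract P S := by
      intro B hB
      rw [Finset.mem_insert, mem_nodesIn] at hB
      rw [mem_contract]
      refine hB.imp id fun h => ⟨h.1, fun hBS => ?_⟩
      obtain ⟨v, hv⟩ := hP.part.nonempty B h.1
      exact Finset.mem_compl.1 (h.2 hv) (hBS hv)
    have := Finset.card_le_card hsub
    rw [Finset.card_insert_of_notMem] at this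
    · have := hp.2
      omega
    · rw [mem_nodesIn]
      rintro ⟨-, h⟩
      obtain ⟨v, hv⟩ := hne
      exact Finset.mem_compl.1 (h hv) hv

theorem mem_innerEdges {e : Edge V} : e ∈ innerEdges x P S ↔
    e ∈ supportEdges x ∧ (∀ v ∈ e.1, v ∈ S) ∧ ∀ B ∈ P, ¬ ∀ v ∈ e.1, v ∈ B := Finset.mem_filter

theorem innerEdges_mono (h : S ⊆ Finset.univ) : innerEdges x P S ⊆ innerEdges x P Finset.univ := by
  intro e he
  rw [mem_innerEdges] at *
  exact ⟨he.1, fun v hv => h (he.2.1 v hv), he.2.2⟩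

theorem Coarser.innerEdges_subset {P' : Finset (Finset V)} (h : Coarser P P') (hP : IsPart P)
    (hP' : IsPart P') (S : Finset V) : innerEdges x P' S ⊆ innerEdges x P S := by
  intro e he
  rw [mem_innerEdges] at *
  refine ⟨he.1, he.2.1, fun B hB hcon => ?_⟩
  obtain ⟨C, hC, hBC⟩ := h.exists_superset hP hP' hB
  exact he.2.2 C hC fun v hv => hBC (hcon v hv)

theorem mem_innerEdges_contract {e : Edge V} (he : e ∈ innerEdges x P Finset.univ)
    (heS : e ∉ innerEdges x P S) : e ∈ innerEdges x (contract P S) Finset.univ := by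
  rw [mem_innerEdges] at *
  refine ⟨he.1, he.2.1, fun B hB hcon => ?_⟩
  rcases mem_contract.1 hB with rfl | ⟨hB, -⟩
  · exact heS ⟨he.1, hcon, he.2.2⟩
  · exact he.2.2 B hB hcon

/-- Once `S` lies in a block, its edges are loops and are never sampled again; different iterations
thus sample disjoint sets of edges. -/
theorem disjoint_innerEdges {Q : Finset (Finset V)} (hS : ∃ B ∈ Q, S ⊆ B) :
    Disjoint (innerEdges x P S) (innerEdges x Q Finset.univ) := by
  obtain ⟨B, hB, hSB⟩ := hS
  rw [Finset.disjoint_left]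
  intro e he he'
  exact (mem_innerEdges.1 he').2.2 B hB fun v hv => hSB ((mem_innerEdges.1 he).2.1 v hv)

theorem IsMaxEntropy.isSpanningTree {μ : PMF (Finset (Edge V))} (hμ : IsMaxEntropy x P S μ)
    {F : Finset (Edge V)} (hF : μ F ≠ 0) : IsSpanningTree x P S F := by
  obtain ⟨⟨w, c, h⟩, -⟩ := hμ
  by_contra hcon
  exact hF (by rw [h, if_neg hcon])

theorem IsUniformCycle.isCycleThrough {τ : PMF (Finset (Edge V))}
    (hτ : IsUniformCycle x ePlus P τ) {F : Finset (Edge V)} (hF : τ F ≠ 0) :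
    IsCycleThrough x ePlus P F := by
  by_contra hcon
  exact hF (by rw [hτ, if_neg hcon])

/-- A connected set of edges crosses every cut. -/
theorem Connects.exists_cut {F : Finset (Edge V)} {R : Finset V} (h : Connects P F R)
    {A : Finset V} (hA : IsVertexSet P A) {u v : V} (hu : u ∈ R) (hv : v ∈ R) (huA : u ∈ A)
    (hvA : v ∉ A) : ∃ f ∈ F, ∃ p q, f.1 = s(p, q) ∧ p ∈ A ∧ q ∉ A := by
  by_contra hcon
  push Not at hcon
  have key : ∀ a b, Relation.EqvGen
      (fun a b => (∃ B ∈ P, a ∈ B ∧ b ∈ B) ∨ ∃ f ∈ F, f.1 = s(a, b)) a b → (a ∈ A ↔ b ∈ A) := by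
    intro a b hab
    induction hab with
    | rel a b hab =>
      rcases hab with ⟨B, hB, ha, hb⟩ | ⟨f, hf, hfab⟩
      · exact ⟨isVertexSet_iff.1 hA B hB a ha b hb, isVertexSet_iff.1 hA B hB b hb a ha⟩
      · exact ⟨hcon f hf a b hfab, hcon f hf b a (by rw [hfab, Sym2.eq_swap])⟩
    | refl => rfl
    | symm a b _ ih => exact ih.symm
    | trans a b c _ _ ih1 ih2 => exact ih1.trans ih2
  exact hvA ((key u v (h u hu v hv)).1 huA)

theorem IsExecution.subset_innerEdges (hhalf : IsHalfIntegral x) {l : List (Finset V)} :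
    ∀ {P : Finset (Finset V)} {τ : PMF (Finset (Edge V))}, IsState x ePlus P →
    IsExecution x ePlus P l τ → ∀ T, τ T ≠ 0 → T ⊆ innerEdges x P Finset.univ := by
  induction l with
  | nil =>
    intro P τ _ h T hT
    exact (h.2.isCycleThrough hT).1
  | cons S l ih =>
    rintro P τ hP ⟨hS, μ, τ', hμ, hτ', rfl⟩ T hT
    obtain ⟨F, F', hF, hF', rfl⟩ := bind_union_ne_zero hT
    have hst := hP.step hhalf hS
    refine Finset.union_subset ?_ ?_
    · exact (hμ.isSpanningTree hF).1.trans (innerEdges_mono (Finset.subset_univ _))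
    · exact (ih hst hτ' F' hF').trans
        ((hP.part.coarser_contract hS.1.1.1.1).innerEdges_subset hP.part hst.part _)

theorem IsExecution.isVertexSet (hhalf : IsHalfIntegral x) {l : List (Finset V)} :
    ∀ {P : Finset (Finset V)} {τ : PMF (Finset (Edge V))}, IsState x ePlus P →
    IsExecution x ePlus P l τ → ∀ R ∈ l, IsVertexSet P R ∧ R.Nonempty := by
  induction l with
  | nil => simp
  | cons S l ih =>
    rintro P τ hP ⟨hS, μ, τ', hμ, hτ', -⟩ R hR
    rcases List.mem_cons.1 hR with rfl | hR
    · exact ⟨hS.1.1.1.1, nonempty_of_two_le hP.part hS.1.1.2.1.1⟩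
    · have hst := hP.step hhalf hS
      obtain ⟨h1, h2⟩ := ih hst hτ' R hR
      exact ⟨(hP.part.coarser_contract hS.1.1.1.1).isVertexSet hst.part h1, h2⟩

/-- The execution up to the selection of a given set. -/
theorem IsExecution.split (hhalf : IsHalfIntegral x) {l₁ l₂ : List (Finset V)} :
    ∀ {P₀ : Finset (Finset V)} {τ : PMF (Finset (Edge V))}, IsState x ePlus P₀ →
    IsExecution x ePlus P₀ (l₁ ++ S :: l₂) τ →
    ∃ (P : Finset (Finset V)) (μ τ' : PMF (Finset (Edge V))), IsState x ePlus P ∧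
      Coarser P₀ P ∧ IsSelectable x ePlus P S ∧ IsMaxEntropy x P S μ ∧
      IsExecution x ePlus (contract P S) l₂ τ' ∧ (∀ R ∈ l₁, ∃ B ∈ P, R ⊆ B) ∧
      (∀ B ∈ P, B ∈ P₀ ∨ B ∈ l₁) ∧
      ∀ X : Finset (Edge V) → Prop, (∀ T, X T ↔ X (T ∩ innerEdges x P Finset.univ)) →
        pr τ X = ∑ F, (μ F).toReal * pr τ' (fun F' => X (F ∪ F')) := by
  induction l₁ with
  | nil =>
    rintro P τ hP ⟨hS, μ, τ', hμ, hτ', rfl⟩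
    exact ⟨P, μ, τ', hP, hP.part.coarser_refl, hS, hμ, hτ', by simp, fun B hB => .inl hB,
      fun X _ => pr_bind_union μ τ' X⟩
  | cons R l₁ ih =>
    rintro P₀ τ hP₀ ⟨hR, μ₁, τ₁, hμ₁, hτ₁, rfl⟩
    have hst := hP₀.step hhalf hR
    obtain ⟨P, μ, τ', hP, hco, hS, hμ, hτ', hl, hB, hX⟩ := ih hst hτ₁
    have hRB : ∃ B ∈ P, R ⊆ B := hco.exists_superset hst.part hP.part (mem_contract.2 (.inl rfl))
    refine ⟨P, μ, τ', hP, (hP₀.part.coarser_contract hR.1.1.1.1).trans hst.part hco,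
        hS, hμ, hτ', ?_,
      ?_, ?_⟩
    · intro R' hR'
      rcases List.mem_cons.1 hR' with rfl | hR'
      · exact hRB
      · exact hl R' hR'
    · intro B hBP
      rcases hB B hBP with h | h
      · rcases mem_contract.1 h with rfl | ⟨h, -⟩
        · exact .inr (by simp)
        · exact .inl h
      · exact .inr (by simp [h])
    · intro X hXi
      rw [pr_bind_union, ← hX X hXi]
      -- The first tree lies inside a block of `P`, so an event about edges between blocks does not
      -- see it, and it averages out.
      have : ∀ F, (μ₁ F).toReal * pr τ₁ (fun F' => X (F ∪ F')) = (μ₁ F).toReal * pr τ₁ X := by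
        intro F
        by_cases hF : μ₁ F = 0
        · simp [hF]
        have hd := disjoint_innerEdges (x := x) (P := P₀) hRB
        have hFs := (hμ₁.isSpanningTree hF).1
        congr 1
        refine pr_congr fun F' _ => ?_
        rw [hXi (F ∪ F'), hXi F', Finset.union_inter_distrib_right,
          Finset.disjoint_iff_inter_eq_empty.1 (hd.mono_left hFs), Finset.empty_union]
      simp only [this, ← Finset.sum_mul, sum_pmf, one_mul]

end Step

end

section

variable {V : Type*} [Fintype V] {x : Sym2 V → ℝ} {ePlus : Sym2 V} {P : Finset (Finset V)}

/-! ### Edges between the vertices of a contracted graph. -/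

theorem mem_edgesBetween {A B : Finset V} {e : Edge V} : e ∈ edgesBetween x A B ↔
    e ∈ supportEdges x ∧ ∃ u v, e.1 = s(u, v) ∧ u ∈ A ∧ v ∈ B := Finset.mem_filter

theorem edgesBetween_comm (A B : Finset V) : edgesBetween x A B = edgesBetween x B A := by
  ext e
  simp only [mem_edgesBetween]
  constructor <;> rintro ⟨h, u, v, h1, h2, h3⟩ <;> exact ⟨h, v, u, by rw [h1, Sym2.eq_swap], h3, h2⟩

theorem edgesBetween_subset_cut {A B : Finset V} (h : Disjoint A B) :
    edgesBetween x A B ⊆ cut x A := by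
  intro e he
  obtain ⟨he, u, v, h1, h2, h3⟩ := mem_edgesBetween.1 he
  exact mem_cut.2 ⟨he, u, v, h1, h2, fun hv => Finset.disjoint_left.1 h hv h3⟩

theorem IsPart.exists_edgesBetween_of_mem_cut (hP : IsPart P) {A : Finset V}
    {e : Edge V} (he : e ∈ cut x A) : ∃ B ∈ P, B ≠ A ∧ e ∈ edgesBetween x A B := by
  obtain ⟨hs, u, v, h1, h2, h3⟩ := mem_cut.1 he
  obtain ⟨B, hB, hv⟩ := hP.cover v
  exact ⟨B, hB, fun h => h3 (h ▸ hv), mem_edgesBetween.2 ⟨hs, u, v, h1, h2, hv⟩⟩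

theorem IsPart.mem_innerEdges_univ (hP : IsPart P) {e : Edge V} :
    e ∈ innerEdges x P Finset.univ ↔ ∃ A ∈ P, ∃ B ∈ P, A ≠ B ∧ e ∈ edgesBetween x A B := by
  rw [mem_innerEdges]
  constructor
  · rintro ⟨hs, -, h⟩
    obtain ⟨⟨u, v⟩, huv⟩ := Quot.exists_rep e.1
    change s(u, v) = e.1 at huv
    obtain ⟨A, hA, hu⟩ := hP.cover u
    obtain ⟨B, hB, hv⟩ := hP.cover v
    refine ⟨A, hA, B, hB, ?_, mem_edgesBetween.2 ⟨hs, u, v, huv.symm, hu, hv⟩⟩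
    rintro rfl
    refine h A hA fun w hw => ?_
    rw [← huv, Sym2.mem_iff] at hw
    rcases hw with rfl | rfl <;> assumption
  · rintro ⟨A, hA, B, hB, hne, he⟩
    obtain ⟨hs, u, v, huv, hu, hv⟩ := mem_edgesBetween.1 he
    refine ⟨hs, by simp, fun C hC h => hne ?_⟩
    rw [huv] at h
    rw [hP.eq_of_mem A hA C hC u hu (h u (by simp)), hP.eq_of_mem B hB C hC v hv (h v (by simp))]

theorem card_edgesBetween_eq_two (hhalf : IsHalfIntegral x) {A B : Finset V} (h : Disjoint A B) :
    (edgesBetween x A B).card = 2 ↔ flow x A B = 1 := by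
  have := card_edgesBetween hhalf h
  constructor
  · intro h2; rw [h2] at this; push_cast at this; linarith
  · intro h2
    rw [h2] at this
    have h4 : ((edgesBetween x A B).card : ℝ) = (2 : ℕ) := by rw [this]; norm_num
    exact_mod_cast h4

theorem flow_pos_of_mem (hhalf : IsHalfIntegral x) {A B : Finset V} (h : Disjoint A B)
    {e : Edge V} (he : e ∈ edgesBetween x A B) : 0 < flow x A B := by
  have h1 := card_edgesBetween hhalf h
  have h2 : (0 : ℝ) < (edgesBetween x A B).card := by
    exact_mod_cast Finset.card_pos.2 ⟨e, he⟩
  linarith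

theorem IsPart.isVertexSet_union (hP : IsPart P) {A B : Finset V} (hA : A ∈ P) (hB : B ∈ P) :
    IsVertexSet P (A ∪ B) := (hP.isVertexSet hA).union (hP.isVertexSet hB)

theorem exists_third (hcard : 3 ≤ P.card) (A B : Finset V) :
    ∃ C ∈ P, C ≠ A ∧ C ≠ B := by
  have : ((P.erase A).erase B).Nonempty := by
    rw [← Finset.card_pos]
    have h1 := Finset.pred_card_le_card_erase (s := P) (a := A)
    have h2 := Finset.pred_card_le_card_erase (s := P.erase A) (a := B)
    omega
  obtain ⟨C, hC⟩ := this
  exact ⟨C, Finset.mem_of_mem_erase (Finset.mem_of_mem_erase hC),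
    Finset.ne_of_mem_erase (Finset.mem_of_mem_erase hC), Finset.ne_of_mem_erase hC⟩

theorem IsPart.notMem_union (hP : IsPart P) {A B C : Finset V} (hA : A ∈ P) (hB : B ∈ P)
    (hC : C ∈ P) (hCA : C ≠ A) (hCB : C ≠ B) {v : V} (hv : v ∈ C) : v ∉ A ∪ B := by
  rw [Finset.mem_union]
  rintro (h | h)
  · exact hCA (hP.eq_of_mem C hC A hA v hv h)
  · exact hCB (hP.eq_of_mem C hC B hB v hv h)

theorem IsPart.two_le_card_compl_union (hP : IsPart P) (hcard : 4 ≤ P.card) {A B : Finset V}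
    (hA : A ∈ P) (hB : B ∈ P) : 2 ≤ (nodesIn P (A ∪ B)ᶜ).card := by
  have hsub : (P.erase A).erase B ⊆ nodesIn P (A ∪ B)ᶜ := by
    intro C hC
    have hC' := Finset.mem_of_mem_erase hC
    exact mem_nodesIn.2 ⟨Finset.mem_of_mem_erase hC', fun v hv => Finset.mem_compl.2
      (hP.notMem_union hA hB (Finset.mem_of_mem_erase hC') (Finset.ne_of_mem_erase hC')
        (Finset.ne_of_mem_erase hC) hv)⟩
  have h1 := Finset.pred_card_le_card_erase (s := P) (a := A)
  have h2 := Finset.pred_card_le_card_erase (s := P.erase A) (a := B)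
  have h3 := Finset.card_le_card hsub
  omega

/-- The flow between `A` and `B` is counted in both cuts but not in that of the union. In
particular, the union of two vertices is tight exactly when they are joined by a parallel pair. -/
theorem flow_union_compl {A B : Finset V} (h : Disjoint A B)
    (hA : flow x A Aᶜ = 2) (hB : flow x B Bᶜ = 2) :
    flow x (A ∪ B) (A ∪ B)ᶜ = 4 - 2 * flow x A B := by
  have eA : Aᶜ = B ∪ (A ∪ B)ᶜ := by
    ext v
    have h1 : v ∈ A → v ∉ B := fun h' => Finset.disjoint_left.1 h h'
    simp only [Finset.mem_compl, Finset.mem_union]; tauto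
  have eB : Bᶜ = A ∪ (A ∪ B)ᶜ := by
    ext v
    have h1 : v ∈ A → v ∉ B := fun h' => Finset.disjoint_left.1 h h'
    simp only [Finset.mem_compl, Finset.mem_union]; tauto
  have hd : Disjoint B (A ∪ B)ᶜ := by rw [Finset.disjoint_left]; intro v hv; simp [hv]
  have hd' : Disjoint A (A ∪ B)ᶜ := by rw [Finset.disjoint_left]; intro v hv; simp [hv]
  rw [eA, flow_union_right x A hd] at hA
  rw [eB, flow_union_right x B hd', flow_comm x B A] at hB
  rw [flow_union_left x _ h]
  linarith

/-- A larger flow would make the cut of the union smaller than 2; the third vertex guarantees that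
this cut is a genuine one. -/
theorem IsPart.flow_le_one (hx : IsHeldKarp x) (hP : IsPart P) (hcard : 3 ≤ P.card)
    (hdeg : ∀ B ∈ P, flow x B Bᶜ = 2) {A B : Finset V} (hA : A ∈ P) (hB : B ∈ P) (hAB : A ≠ B) :
    flow x A B ≤ 1 := by
  have h1 := flow_union_compl (hP.disjoint hA hB hAB) (hdeg A hA) (hdeg B hB)
  obtain ⟨C, hC, hCA, hCB⟩ := exists_third hcard A B
  obtain ⟨v, hv⟩ := hP.nonempty C hC
  have h2 := hx.two_le_flow (A := A ∪ B) ((hP.nonempty A hA).mono Finset.subset_union_left)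
    ⟨v, Finset.mem_compl.2 (hP.notMem_union hA hB hC hCA hCB hv)⟩
  linarith

/-! ### The final cycle -/

theorem exists_cross_of_not_isCandidate (hhalf : IsHalfIntegral x) {R : Finset V}
    (hR : IsVertexSet P R) (hRt : flow x R Rᶜ = 2) (hRp : IsProper P R)
    (h : ¬ IsCandidate x P R) : ∃ Q, IsVertexSet P Q ∧ flow x Q Qᶜ = 2 ∧ Cross R Q := by
  by_contra hcon
  refine h ⟨(isTight_iff hhalf).2 ⟨hR, hRt⟩, hRp, fun Q hQ hc => hcon ?_⟩
  obtain ⟨h1, h2⟩ := (isTight_iff hhalf).1 hQ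
  exact ⟨Q, h1, h2, hc⟩

/-- No block contains both ends of the special edge, so both of its copies survive every
contraction. -/
theorem IsState.exists_plus (hePlus : x ePlus = 1)
    (hP : IsState x ePlus P) : ∃ A ∈ P, ∃ B ∈ P, A ≠ B ∧ ∀ i, (ePlus, i) ∈ edgesBetween x A B := by
  have hs : ∀ i, (ePlus, i) ∈ supportEdges x := by
    intro i
    simp only [supportEdges, Finset.mem_filter, Finset.mem_univ, true_and, hePlus]
    fin_cases i <;> norm_num
  have h0 : (ePlus, (0 : Fin 2)) ∈ innerEdges x P Finset.univ :=
    mem_innerEdges.2 ⟨hs 0, by simp, hP.plus⟩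
  obtain ⟨A, hA, B, hB, hAB, h⟩ := hP.part.mem_innerEdges_univ.1 h0
  refine ⟨A, hA, B, hB, hAB, fun i => ?_⟩
  rw [mem_edgesBetween] at *
  exact ⟨hs i, h.2⟩

theorem IsState.flow_plus (hx : IsHeldKarp x) (hhalf : IsHalfIntegral x)
    (hP : IsState x ePlus P) {A B : Finset V} (hA : A ∈ P) (hB : B ∈ P) (hAB : A ≠ B)
    (h : ∀ i, (ePlus, i) ∈ edgesBetween x A B) : flow x A B = 1 := by
  refine le_antisymm (hP.part.flow_le_one hx hP.card hP.deg hA hB hAB) ?_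
  have h1 := card_edgesBetween hhalf (hP.part.disjoint hA hB hAB)
  have h2 : 2 ≤ (edgesBetween x A B).card := by
    have hsub : {(ePlus, (0 : Fin 2)), (ePlus, (1 : Fin 2))} ⊆ edgesBetween x A B := by
      intro e he
      simp only [Finset.mem_insert, Finset.mem_singleton] at he
      rcases he with rfl | rfl
      · exact h 0
      · exact h 1
    have := Finset.card_le_card hsub
    rwa [Finset.card_pair (by simp)] at this
  have h3 : (2 : ℝ) ≤ (edgesBetween x A B).card := by exact_mod_cast h2
  linarith

/-- In the final graph, the edges come in parallel pairs. -/
theorem IsState.flow_eq_zero_or_one (hx : IsHeldKarp x) (hhalf : IsHalfIntegral x)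
    (hePlus : x ePlus = 1) (hP : IsState x ePlus P) (hcand : ∀ S, ¬ IsCandidate x P S) :
    ∀ B ∈ P, ∀ C ∈ P, B ≠ C → flow x B C = 0 ∨ flow x B C = 1 := by
  refine flow_eq_zero_or_one_of_crossed hx _ P rfl hP.card hP.part hP.deg
    (fun R hR hRt hRp => exists_cross_of_not_isCandidate hhalf hR hRt hRp (hcand R)) ?_
  by_cases h3 : P.card = 3
  · exact .inl h3
  right
  -- The two ends of the special edge form a proper tight set, the one needed to start the
  -- uncrossing argument. This is where the special edge matters.
  obtain ⟨A, hA, B, hB, hAB, h⟩ := hP.exists_plus hePlus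
  refine ⟨A ∪ B, hP.part.isVertexSet_union hA hB, ?_, two_le_card_nodesIn.2
    ⟨A, B, hA, hB, Finset.subset_union_left, Finset.subset_union_right, hAB⟩,
    hP.part.two_le_card_compl_union (by have := hP.card; omega) hA hB⟩
  rw [flow_union_compl (hP.part.disjoint hA hB hAB) (hP.deg A hA) (hP.deg B hB),
    hP.flow_plus hx hhalf hA hB hAB h]
  norm_num

/-- A Hamiltonian cycle does not contain two parallel edges. -/
theorem IsCycleThrough.not_edgesBetween_subset {F : Finset (Edge V)} (hP : IsPart P)
    (hcard : 3 ≤ P.card) (hF : IsCycleThrough x ePlus P F) {A B : Finset V} (hA : A ∈ P)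
    (hB : B ∈ P) (hAB : A ≠ B) (h2 : (edgesBetween x A B).card = 2) :
    ¬ edgesBetween x A B ⊆ F := by
  intro hsub
  obtain ⟨hFi, hconn, hdeg, -⟩ := hF
  have key : ∀ A B, A ∈ P → B ∈ P → A ≠ B → (edgesBetween x A B).card = 2 →
      edgesBetween x A B ⊆ F → F ∩ cut x A = edgesBetween x A B := by
    intro A B hA hB hAB h2 hsub
    symm
    refine Finset.eq_of_subset_of_card_le (Finset.subset_inter hsub
      (edgesBetween_subset_cut (hP.disjoint hA hB hAB))) ?_
    rw [hdeg A hA, h2]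
  have kA := key A B hA hB hAB h2 hsub
  rw [edgesBetween_comm] at h2 hsub
  have kB := key B A hB hA hAB.symm h2 hsub
  obtain ⟨C, hC, hCA, hCB⟩ := exists_third hcard A B
  obtain ⟨v, hv⟩ := hP.nonempty C hC
  obtain ⟨u, hu⟩ := hP.nonempty A hA
  -- The parallel pair would exhaust the degree 2 at both ends, yet a connected `F` must leave `A ∪
  -- B`.
  obtain ⟨f, hf, p, q, hpq, hp, hq⟩ := hconn.exists_cut (hP.isVertexSet_union hA hB)
    (Finset.mem_univ u) (Finset.mem_univ v) (Finset.mem_union_left _ hu)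
    (hP.notMem_union hA hB hC hCA hCB hv)
  have hfs := (mem_innerEdges.1 (hFi hf)).1
  have final : ∀ A' B', f ∈ edgesBetween x A' B' → A' ⊆ A ∪ B → B' ⊆ A ∪ B → False := by
    intro A' B' h hA' hB'
    obtain ⟨-, p', q', h', hp', hq'⟩ := mem_edgesBetween.1 h
    rw [hpq, Sym2.eq_iff] at h'
    rcases h' with ⟨-, rfl⟩ | ⟨-, rfl⟩
    · exact hq (hB' hq')
    · exact hq (hA' hp')
  rw [Finset.mem_union, not_or] at hq
  rcases Finset.mem_union.1 hp with hp | hp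
  · have : f ∈ F ∩ cut x A := Finset.mem_inter.2 ⟨hf, mem_cut.2 ⟨hfs, p, q, hpq, hp, hq.1⟩⟩
    rw [kA] at this
    exact final A B this Finset.subset_union_left Finset.subset_union_right
  · have : f ∈ F ∩ cut x B := Finset.mem_inter.2 ⟨hf, mem_cut.2 ⟨hfs, p, q, hpq, hp, hq.2⟩⟩
    rw [kB] at this
    exact final B A this Finset.subset_union_right Finset.subset_union_left

theorem IsState.card_cut (hhalf : IsHalfIntegral x) (hP : IsState x ePlus P) {A : Finset V}
    (hA : A ∈ P) : (cut x A).card = 4 :=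
  ((isTight_iff (P := P) hhalf).2 ⟨hP.part.isVertexSet hA, hP.deg A hA⟩).2

/-- A Hamiltonian cycle of a doubled cycle meets every pair of parallel edges. -/
theorem IsCycleThrough.edgesBetween_inter {F : Finset (Edge V)} (hhalf : IsHalfIntegral x)
    (hP : IsState x ePlus P)
    (hdbl : ∀ B ∈ P, ∀ C ∈ P, B ≠ C → flow x B C = 0 ∨ flow x B C = 1)
    (hF : IsCycleThrough x ePlus P F) {A B : Finset V} (hA : A ∈ P)
    (hB : B ∈ P) (hAB : A ≠ B) (h2 : (edgesBetween x A B).card = 2) :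
    ¬ Disjoint (edgesBetween x A B) F := by
  intro hd
  have hsub : edgesBetween x A B ⊆ cut x A := edgesBetween_subset_cut (hP.part.disjoint hA hB hAB)
  have h4 := hP.card_cut hhalf hA
  have hrest : (cut x A \ edgesBetween x A B).card = 2 := by
    rw [Finset.card_sdiff_of_subset hsub, h4, h2]
  -- The other two edges at `A` also form a parallel pair. A cycle avoiding the first pair would
  -- contain the whole second pair, which is impossible.
  obtain ⟨f, hf⟩ : (cut x A \ edgesBetween x A B).Nonempty := by rw [← Finset.card_pos]; omega
  rw [Finset.mem_sdiff] at hf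
  obtain ⟨D, hD, hDA, hfD⟩ := hP.part.exists_edgesBetween_of_mem_cut hf.1
  have hDB : D ≠ B := by rintro rfl; exact hf.2 hfD
  have hAD := hP.part.disjoint hA hD hDA.symm
  have h2' : (edgesBetween x A D).card = 2 := by
    rw [card_edgesBetween_eq_two hhalf hAD]
    exact (hdbl A hA D hD hDA.symm).resolve_left (flow_pos_of_mem hhalf hAD hfD).ne'
  have hdis : Disjoint (edgesBetween x A D) (edgesBetween x A B) := by
    rw [Finset.disjoint_left]
    intro e h h'
    obtain ⟨-, u, v, huv, hu, hv⟩ := mem_edgesBetween.1 h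
    obtain ⟨-, u', v', huv', hu', hv'⟩ := mem_edgesBetween.1 h'
    rw [huv, Sym2.eq_iff] at huv'
    rcases huv' with ⟨-, rfl⟩ | ⟨rfl, rfl⟩
    · exact hDB (hP.part.eq_of_mem D hD B hB _ hv hv')
    · exact hAB (hP.part.eq_of_mem A hA B hB _ hu hv')
  have heq : edgesBetween x A D = cut x A \ edgesBetween x A B := by
    refine Finset.eq_of_subset_of_card_le (fun e he => Finset.mem_sdiff.2
      ⟨edgesBetween_subset_cut hAD he, Finset.disjoint_left.1 hdis he⟩) (by omega)
  have hFc : F ∩ cut x A = edgesBetween x A D := by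
    refine Finset.eq_of_subset_of_card_le (fun e he => ?_) (by rw [h2', hF.2.2.1 A hA])
    rw [Finset.mem_inter] at he
    rw [heq, Finset.mem_sdiff]
    exact ⟨he.2, fun h => Finset.disjoint_left.1 hd h he.1⟩
  exact hF.not_edgesBetween_subset hP.part hP.card hA hD hDA.symm h2'
    (hFc ▸ Finset.inter_subset_left)

/-- Exchanging two parallel edges changes neither degrees nor connectivity. If one of them is a copy
of the special edge, the two copies are the whole pair, so the cycle still uses a copy. -/
theorem IsCycleThrough.swap {F : Finset (Edge V)} (hP : IsPart P)
    (hePlus : x ePlus = 1) {A B : Finset V} (hA : A ∈ P)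
    (hB : B ∈ P) (hAB : A ≠ B) {e e' : Edge V} (hee : e ≠ e')
    (h : edgesBetween x A B = {e, e'}) (hF : IsCycleThrough x ePlus P F) :
    IsCycleThrough x ePlus P (F.map (Equiv.swap e e').toEmbedding) := by
  obtain ⟨hFi, hconn, hdeg, hpl⟩ := hF
  have hbetween : ∀ f, f = e ∨ f = e' → f ∈ edgesBetween x A B := by
    intro f hf; rw [h]; simpa using hf
  have hσ : ∀ f, Equiv.swap e e' f = f ∨
      (f ∈ edgesBetween x A B ∧ Equiv.swap e e' f ∈ edgesBetween x A B) := by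
    intro f
    by_cases h1 : f = e
    · right; rw [h1, Equiv.swap_apply_left]; exact ⟨hbetween _ (.inl rfl), hbetween _ (.inr rfl)⟩
    by_cases h2 : f = e'
    · right; rw [h2, Equiv.swap_apply_right]; exact ⟨hbetween _ (.inr rfl), hbetween _ (.inl rfl)⟩
    exact .inl (Equiv.swap_apply_of_ne_of_ne h1 h2)
  have hinner : edgesBetween x A B ⊆ innerEdges x P Finset.univ := fun f hf =>
    hP.mem_innerEdges_univ.2 ⟨A, hA, B, hB, hAB, hf⟩
  have hmem : ∀ f ∈ F, Equiv.swap e e' f ∈ F.map (Equiv.swap e e').toEmbedding := fun f hf =>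
    Finset.mem_map_of_mem _ hf
  refine ⟨?_, ?_, ?_, ?_⟩
  · intro f hf
    obtain ⟨f, hfF, rfl⟩ := Finset.mem_map.1 hf
    change Equiv.swap e e' f ∈ _
    rcases hσ f with hs | hs
    · rw [hs]; exact hFi hfF
    · exact hinner hs.2
  · intro u hu v hv
    have hrel := hconn u hu v hv
    clear hu hv
    induction hrel with
    | rel a b hab =>
      rcases hab with hab | ⟨f, hf, hab⟩
      · exact .rel _ _ (.inl hab)
      rcases hσ f with hs | ⟨hs, hs'⟩
      · exact .rel _ _ (.inr ⟨f, hs ▸ hmem f hf, hab⟩)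
      obtain ⟨-, p, q, hpq, hp, hq⟩ := mem_edgesBetween.1 hs
      obtain ⟨-, p', q', hpq', hp', hq'⟩ := mem_edgesBetween.1 hs'
      have e1 : Relation.EqvGen (fun a b => (∃ B ∈ P, a ∈ B ∧ b ∈ B) ∨
          ∃ f ∈ F.map (Equiv.swap e e').toEmbedding, f.1 = s(a, b)) p q :=
        .trans _ _ _ (.rel _ _ (.inl ⟨A, hA, hp, hp'⟩))
          (.trans _ _ _ (.rel _ _ (.inr ⟨_, hmem f hf, hpq'⟩)) (.rel _ _ (.inl ⟨B, hB, hq', hq⟩)))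
      rw [hab, Sym2.eq_iff] at hpq
      rcases hpq with ⟨rfl, rfl⟩ | ⟨rfl, rfl⟩
      · exact e1
      · exact e1.symm
    | refl => exact .refl _
    | symm a b _ ih => exact ih.symm
    | trans a b c _ _ ih1 ih2 => exact ih1.trans _ _ _ ih2
  · intro D hD
    have hcutD : ∀ f ∈ edgesBetween x A B, f ∈ cut x D ↔ D = A ∨ D = B := by
      intro f hf
      obtain ⟨hfs, p, q, hpq, hp, hq⟩ := mem_edgesBetween.1 hf
      constructor
      · intro hc
        obtain ⟨-, u, v, huv, hu, -⟩ := mem_cut.1 hc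
        rw [hpq, Sym2.eq_iff] at huv
        rcases huv with ⟨rfl, -⟩ | ⟨-, rfl⟩
        · exact .inl (hP.eq_of_mem D hD A hA _ hu hp)
        · exact .inr (hP.eq_of_mem D hD B hB _ hu hq)
      · rintro (rfl | rfl)
        · exact edgesBetween_subset_cut (hP.disjoint hA hB hAB) hf
        · rw [edgesBetween_comm] at hf
          exact edgesBetween_subset_cut (hP.disjoint hA hB hAB).symm hf
    have hcσ : ∀ f, Equiv.swap e e' f ∈ cut x D ↔ f ∈ cut x D := by
      intro f
      rcases hσ f with hs | hs
      · rw [hs]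
      · rw [hcutD _ hs.1, hcutD _ hs.2]
    have : F.map (Equiv.swap e e').toEmbedding ∩ cut x D =
        (F ∩ cut x D).map (Equiv.swap e e').toEmbedding := by
      ext f
      simp only [Finset.mem_inter, Finset.mem_map, Equiv.coe_toEmbedding]
      constructor
      · rintro ⟨⟨f, hf, rfl⟩, hc⟩
        exact ⟨f, ⟨hf, (hcσ f).1 hc⟩, rfl⟩
      · rintro ⟨f, ⟨hf, hc⟩, rfl⟩
        exact ⟨⟨f, hf, rfl⟩, (hcσ f).2 hc⟩
    rw [this, Finset.card_map, hdeg D hD]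
  · obtain ⟨i, hi⟩ := hpl
    rcases hσ (ePlus, i) with hs | ⟨hs, hs'⟩
    · exact ⟨i, hs ▸ hmem _ hi⟩
    have hall : ∀ j, (ePlus, j) ∈ ({e, e'} : Finset (Edge V)) := by
      intro j
      rw [← h, mem_edgesBetween]
      refine ⟨?_, (mem_edgesBetween.1 hs).2⟩
      simp only [supportEdges, Finset.mem_filter, Finset.mem_univ, true_and, hePlus]
      fin_cases j <;> norm_num
    have hpair : ({(ePlus, 0), (ePlus, 1)} : Finset (Edge V)) = {e, e'} := by
      refine Finset.eq_of_subset_of_card_le (fun f hf => ?_) ?_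
      · simp only [Finset.mem_insert, Finset.mem_singleton] at hf
        rcases hf with rfl | rfl
        · exact hall 0
        · exact hall 1
      · rw [Finset.card_pair hee, Finset.card_pair (by simp)]
    rw [h, ← hpair] at hs'
    simp only [Finset.mem_insert, Finset.mem_singleton] at hs'
    rcases hs' with hs' | hs'
    · exact ⟨0, hs' ▸ hmem _ hi⟩
    · exact ⟨1, hs' ▸ hmem _ hi⟩

/-- A cycle uses exactly one edge of each parallel pair, and swapping the pair preserves the uniform
distribution. -/
theorem IsUniformCycle.pr_mem (hx : IsHeldKarp x) (hhalf : IsHalfIntegral x)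
    (hePlus : x ePlus = 1) (hP : IsState x ePlus P) (hcand : ∀ S, ¬ IsCandidate x P S)
    {τ : PMF (Finset (Edge V))} (hτ : IsUniformCycle x ePlus P τ) {e : Edge V}
    (he : e ∈ innerEdges x P Finset.univ) : pr τ (fun F => e ∈ F) = 1 / 2 := by
  have hdbl := hP.flow_eq_zero_or_one hx hhalf hePlus hcand
  obtain ⟨A, hA, B, hB, hAB, heAB⟩ := hP.part.mem_innerEdges_univ.1 he
  have hd := hP.part.disjoint hA hB hAB
  have h2 : (edgesBetween x A B).card = 2 := by
    rw [card_edgesBetween_eq_two hhalf hd]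
    exact (hdbl A hA B hB hAB).resolve_left (flow_pos_of_mem hhalf hd heAB).ne'
  obtain ⟨e', hee, hpair⟩ : ∃ e', e ≠ e' ∧ edgesBetween x A B = {e, e'} := by
    obtain ⟨a, b, hab, h⟩ := Finset.card_eq_two.1 h2
    rw [h] at heAB ⊢
    simp only [Finset.mem_insert, Finset.mem_singleton] at heAB
    rcases heAB with rfl | rfl
    · exact ⟨b, hab, rfl⟩
    · exact ⟨a, hab.symm, Finset.pair_comm _ _⟩
  have hone : ∀ F, τ F ≠ 0 → (e' ∈ F ↔ ¬ e ∈ F) := by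
    intro F hF
    have hc := hτ.isCycleThrough hF
    have h3 := hc.not_edgesBetween_subset hP.part hP.card hA hB hAB h2
    have h4 := hc.edgesBetween_inter hhalf hP hdbl hA hB hAB h2
    rw [hpair] at h3 h4
    constructor
    · intro h' h
      exact h3 (by intro f hf; simp only [Finset.mem_insert, Finset.mem_singleton] at hf
                   rcases hf with rfl | rfl <;> assumption)
    · intro h
      by_contra h'
      refine h4 (Finset.disjoint_left.2 fun f hf => ?_)
      simp only [Finset.mem_insert, Finset.mem_singleton] at hf
      rcases hf with rfl | rfl <;> assumption
  have hswap : ∀ F, IsCycleThrough x ePlus P (F.map (Equiv.swap e e').toEmbedding) ↔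
      IsCycleThrough x ePlus P F := by
    intro F
    refine ⟨fun h => ?_, fun h => h.swap hP.part hePlus hA hB hAB hee hpair⟩
    have := h.swap hP.part hePlus hA hB hAB hee hpair
    rw [Finset.map_map] at this
    convert this
    ext f
    simp
  have hinv : ∀ F, τ (F.map (Equiv.swap e e').toEmbedding) = τ F := by
    intro F
    rw [hτ, hτ, hswap]
  have hsum : pr τ (fun F => e ∈ F) = pr τ (fun F => e' ∈ F) := by
    unfold pr
    rw [← Equiv.sum_comp (Equiv.finsetCongr (Equiv.swap e e'))]
    refine Finset.sum_congr rfl fun F _ => ?_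
    rw [Equiv.finsetCongr_apply, hinv]
    have : e ∈ F.map (Equiv.swap e e').toEmbedding ↔ e' ∈ F := by
      rw [Finset.mem_map_equiv, Equiv.symm_swap, Equiv.swap_apply_left]
    by_cases h : e' ∈ F
    · rw [if_pos (this.2 h), if_pos h]
    · rw [if_neg (mt this.1 h), if_neg h]
  rw [pr_congr hone, pr_compl] at hsum
  linarith

/-- Every edge is sampled with probability one half. -/
theorem IsExecution.pr_mem (hx : IsHeldKarp x) (hhalf : IsHalfIntegral x) (hePlus : x ePlus = 1)
    {l : List (Finset V)} : ∀ {P : Finset (Finset V)} {τ : PMF (Finset (Edge V))},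
    IsState x ePlus P → IsExecution x ePlus P l τ → ∀ e ∈ innerEdges x P Finset.univ,
    pr τ (fun F => e ∈ F) = 1 / 2 := by
  induction l with
  | nil =>
    intro P τ hP h e he
    exact h.2.pr_mem hx hhalf hePlus hP h.1 he
  | cons S l ih =>
    rintro P τ hP ⟨hS, μ, τ', hμ, hτ', rfl⟩ e he
    have hst := hP.step hhalf hS
    have hdis : Disjoint (innerEdges x P S) (innerEdges x (contract P S) Finset.univ) :=
      disjoint_innerEdges ⟨S, mem_contract.2 (.inl rfl), le_rfl⟩
    rw [pr_bind_union]
    -- An edge inside `S` is decided by the tree, whose marginals are prescribed; any other edge is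
    -- left to the later samples.
    by_cases heS : e ∈ innerEdges x P S
    · have h1 : ∀ F, (μ F).toReal * pr τ' (fun F' => e ∈ F ∪ F') =
          if e ∈ F then (μ F).toReal else 0 := by
        intro F
        by_cases heF : e ∈ F
        · simp [heF, pr_true]
        · rw [if_neg heF, pr_eq_zero, mul_zero]
          intro F' hF' h
          rcases Finset.mem_union.1 h with h | h
          · exact heF h
          · exact Finset.disjoint_left.1 hdis heS (hτ'.subset_innerEdges hhalf hst F' hF' h)
      have h2 : ∑ F, (μ F).toReal * pr τ' (fun F' => e ∈ F ∪ F') = pr μ (fun F => e ∈ F) :=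
        Finset.sum_congr rfl fun F _ => (h1 F).trans (by congr)
      rw [h2, ← toReal_toOuterMeasure, hμ.2 e heS]
      simp
    · have h1 : ∀ F, (μ F).toReal * pr τ' (fun F' => e ∈ F ∪ F') = (μ F).toReal * (1 / 2) := by
        intro F
        by_cases hF : μ F = 0
        · simp [hF]
        rw [← ih hst hτ' e (mem_innerEdges_contract he heS)]
        congr 1
        refine pr_congr fun F' _ => ?_
        rw [Finset.mem_union, or_iff_right]
        exact fun h => heS ((hμ.isSpanningTree hF).1 h)
      rw [Finset.sum_congr rfl fun F _ => h1 F, ← Finset.sum_mul, sum_pmf]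
      norm_num

end

section

/-! ### Spanning trees of the contracted graph -/

section Transfer

variable {V : Type*} [Fintype V] {x : Sym2 V → ℝ} {P : Finset (Finset V)} {S : Finset V}

/-- The blocks inside `S` are taken as the nodes of an abstract graph, with each edge oriented
arbitrarily; connectivity of the points of `S` becomes connectivity of these nodes. -/
theorem isRayleigh_isSpanningTree (hP : IsPart P) (hS : IsVertexSet P S) (hne : S.Nonempty) :
    IsRayleigh (Finset.univ.filter (IsSpanningTree x P S)) := by
  let N := {B // B ∈ nodesIn P S}
  obtain ⟨B₀, hB₀, hB₀S⟩ := hP.exists_subset hS hne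
  have r : N := ⟨B₀, mem_nodesIn.2 ⟨hB₀, hB₀S⟩⟩
  have : Nonempty N := ⟨r⟩
  have hex : ∀ v, ∃ n : N, v ∈ S → v ∈ n.1 := by
    intro v
    by_cases hv : v ∈ S
    · obtain ⟨B, hB, hvB⟩ := hP.cover v
      exact ⟨⟨B, mem_nodesIn.2 ⟨hB, fun u hu => isVertexSet_iff.1 hS B hB v hvB u hu hv⟩⟩,
        fun _ => hvB⟩
    · exact ⟨r, fun h => (hv h).elim⟩
  choose blk' hblk' using hex
  -- Points outside `S` go to the default node `r`, so that a block disjoint from `S` also has a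
  -- single image.
  let blk : V → N := fun v => if v ∈ S then blk' v else r
  have hblk : ∀ v ∈ S, v ∈ (blk v).1 := fun v hv => by
    have : blk v = blk' v := if_pos hv
    rw [this]; exact hblk' v hv
  have hblk_eq : ∀ n : N, ∀ v ∈ n.1, blk v = n := fun n v hv => by
    have hn := mem_nodesIn.1 n.2
    have hm := mem_nodesIn.1 (blk v).2
    exact Subtype.ext (hP.eq_of_mem _ hm.1 _ hn.1 v (hblk v (hn.2 hv)) hv)
  let s : Edge V → N := fun e => blk (Quot.out e.1).1
  let t : Edge V → N := fun e => blk (Quot.out e.1).2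
  have hout : ∀ e : Edge V, e.1 = s((Quot.out e.1).1, (Quot.out e.1).2) := fun e =>
    (Quot.out_eq e.1).symm
  have hconn : ∀ F ⊆ innerEdges x P S, Connects P F S ↔ NodeConnected s t F := by
    intro F hF
    constructor
    · intro h a b
      have key : ∀ u v, Relation.EqvGen
          (fun a b => (∃ B ∈ P, a ∈ B ∧ b ∈ B) ∨ ∃ f ∈ F, f.1 = s(a, b)) u v →
          Relation.EqvGen (fun a b => ∃ f ∈ F, s f = a ∧ t f = b) (blk u) (blk v) := by
        intro u v huv
        induction huv with
        | rel u v huv =>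
          rcases huv with ⟨B, hB, hu, hv⟩ | ⟨f, hf, huv⟩
          · have : blk u = blk v := by
              rcases hS B hB with h | h
              · rw [hblk_eq ⟨B, mem_nodesIn.2 ⟨hB, h⟩⟩ u hu,
                  hblk_eq ⟨B, mem_nodesIn.2 ⟨hB, h⟩⟩ v hv]
              · have h1 : blk u = r := if_neg (Finset.disjoint_left.1 h hu)
                have h2 : blk v = r := if_neg (Finset.disjoint_left.1 h hv)
                rw [h1, h2]
            rw [this]
            exact .refl _
          · have h1 : Relation.EqvGen (fun a b => ∃ f ∈ F, s f = a ∧ t f = b)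
              (blk (Quot.out f.1).1) (blk (Quot.out f.1).2) := .rel _ _ ⟨f, hf, rfl, rfl⟩
            have h2 := (hout f).symm.trans huv
            rw [Sym2.eq_iff] at h2
            rcases h2 with ⟨h2, h3⟩ | ⟨h2, h3⟩
            · rw [h2, h3] at h1; exact h1
            · rw [h2, h3] at h1; exact h1.symm
        | refl => exact .refl _
        | symm a b _ ih => exact ih.symm
        | trans a b c _ _ ih1 ih2 => exact ih1.trans _ _ _ ih2
      have ha := mem_nodesIn.1 a.2
      have hb := mem_nodesIn.1 b.2
      obtain ⟨u, hu⟩ := hP.nonempty a.1 ha.1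
      obtain ⟨v, hv⟩ := hP.nonempty b.1 hb.1
      have := key u v (h u (ha.2 hu) v (hb.2 hv))
      rwa [hblk_eq a u hu, hblk_eq b v hv] at this
    · intro h
      have key : ∀ a b : N, Relation.EqvGen (fun a b => ∃ f ∈ F, s f = a ∧ t f = b) a b →
          ∀ u ∈ a.1, ∀ v ∈ b.1, Relation.EqvGen
          (fun a b => (∃ B ∈ P, a ∈ B ∧ b ∈ B) ∨ ∃ f ∈ F, f.1 = s(a, b)) u v := by
        intro a b hab
        induction hab with
        | rel a b hab =>
          obtain ⟨f, hf, rfl, rfl⟩ := hab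
          intro u hu v hv
          have hfS := (mem_innerEdges.1 (hF hf)).2.1
          have h1 := hfS (Quot.out f.1).1 (Sym2.out_fst_mem f.1)
          have h2 := hfS (Quot.out f.1).2 (Sym2.out_snd_mem f.1)
          exact .trans _ _ _ (.rel _ _ (.inl ⟨(s f).1, (mem_nodesIn.1 (s f).2).1, hu, hblk _ h1⟩))
            (.trans _ _ _ (.rel _ _ (.inr ⟨f, hf, hout f⟩))
              (.rel _ _ (.inl ⟨(t f).1, (mem_nodesIn.1 (t f).2).1, hblk _ h2, hv⟩)))
        | refl a =>
          intro u hu v hv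
          exact .rel _ _ (.inl ⟨a.1, (mem_nodesIn.1 a.2).1, hu, hv⟩)
        | symm a b _ ih => exact fun u hu v hv => (ih v hv u hu).symm
        | trans a b c _ _ ih1 ih2 =>
          intro u hu v hv
          obtain ⟨w, hw⟩ := hP.nonempty b.1 (mem_nodesIn.1 b.2).1
          exact (ih1 u hu w hw).trans _ _ _ (ih2 w hw v hv)
      exact fun u hu v hv => key _ _ (h (blk u) (blk v)) u (hblk u hu) v (hblk v hv)
  have hcardN : Fintype.card N = (nodesIn P S).card := Fintype.card_coe _
  have hpos : 0 < Fintype.card N := Fintype.card_pos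
  have heq : Finset.univ.filter (IsSpanningTree x P S) =
      ((innerEdges x P S).powersetCard (Fintype.card N - 1)).filter (NodeConnected s t) := by
    ext F
    simp only [Finset.mem_filter, Finset.mem_univ, true_and, Finset.mem_powersetCard,
      IsSpanningTree]
    constructor
    · rintro ⟨h1, h2, h3⟩
      exact ⟨⟨h1, by omega⟩, (hconn F h1).1 h2⟩
    · rintro ⟨⟨h1, h2⟩, h3⟩
      exact ⟨h1, (hconn F h1).2 h3, by omega⟩
  rw [heq]
  exact isRayleigh_spanningTrees s t _

end Transfer

/-! ### Expectations -/

section Expectation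

variable {β : Type*} [Fintype β]

/-- The expectation of a function under a distribution on a finite type. -/
def ex (μ : PMF β) (g : β → ℝ) : ℝ := ∑ b, (μ b).toReal * g b

theorem ex_add (μ : PMF β) (g h : β → ℝ) : ex μ (fun b => g b + h b) = ex μ g + ex μ h := by
  simp [ex, mul_add, Finset.sum_add_distrib]

theorem ex_sub (μ : PMF β) (g h : β → ℝ) : ex μ (fun b => g b - h b) = ex μ g - ex μ h := by
  simp [ex, mul_sub, Finset.sum_sub_distrib]

theorem ex_const_mul (μ : PMF β) (c : ℝ) (g : β → ℝ) : ex μ (fun b => c * g b) = c * ex μ g := by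
  simp only [ex, Finset.mul_sum]
  exact Finset.sum_congr rfl fun b _ => by ring

theorem ex_const (μ : PMF β) (c : ℝ) : ex μ (fun _ => c) = c := by
  simp [ex, ← Finset.sum_mul, sum_pmf]

theorem ex_mono {μ : PMF β} {g h : β → ℝ} (H : ∀ b, μ b ≠ 0 → g b ≤ h b) : ex μ g ≤ ex μ h := by
  refine Finset.sum_le_sum fun b _ => ?_
  by_cases hb : μ b = 0
  · simp [hb]
  · exact mul_le_mul_of_nonneg_left (H b hb) ENNReal.toReal_nonneg

theorem ex_congr {μ : PMF β} {g h : β → ℝ} (H : ∀ b, μ b ≠ 0 → g b = h b) : ex μ g = ex μ h :=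
  le_antisymm (ex_mono fun b hb => (H b hb).le) (ex_mono fun b hb => (H b hb).ge)

theorem pr_eq_ex (μ : PMF β) (X : β → Prop) : pr μ X = ex μ (fun b => if X b then 1 else 0) :=
  Finset.sum_congr rfl fun b _ => by by_cases h : X b <;> simp [h]

variable {α : Type*} [Fintype α]

/-- The indicator of the sets that contain a given element. -/
def ind (e : α) (F : Finset α) : ℝ := if e ∈ F then 1 else 0

theorem ind_of_mem {e : α} {F : Finset α} (h : e ∈ F) : ind e F = 1 := if_pos h

theorem ind_of_notMem {e : α} {F : Finset α} (h : e ∉ F) : ind e F = 0 := if_neg h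

theorem ind_nonneg (e : α) (F : Finset α) : 0 ≤ ind e F := by
  unfold ind; split_ifs <;> norm_num

theorem ind_le_one (e : α) (F : Finset α) : ind e F ≤ 1 := by
  unfold ind; split_ifs <;> norm_num

theorem pr_mem_eq_ex (μ : PMF (Finset α)) (e : α) : pr μ (fun F => e ∈ F) = ex μ (ind e) := by
  rw [pr_eq_ex]
  exact ex_congr fun F _ => by
    by_cases h : e ∈ F
    · rw [if_pos h, ind_of_mem h]
    · rw [if_neg h, ind_of_notMem h]

/-- Negative correlation of any two elements, also after conditioning on the presence of one
element, or on the presence of one and the absence of another. -/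
structure IsNegDep (μ : PMF (Finset α)) : Prop where
  corr : ∀ e f, e ≠ f → ex μ (fun F => ind e F * ind f F) *
      ex μ (fun F => (1 - ind e F) * (1 - ind f F)) ≤
    ex μ (fun F => ind e F * (1 - ind f F)) * ex μ (fun F => (1 - ind e F) * ind f F)
  corr_in : ∀ g e f, e ≠ f → ex μ (fun F => ind g F * (ind e F * ind f F)) *
      ex μ (fun F => ind g F * ((1 - ind e F) * (1 - ind f F))) ≤
    ex μ (fun F => ind g F * (ind e F * (1 - ind f F))) *
      ex μ (fun F => ind g F * ((1 - ind e F) * ind f F))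
  corr_in_out : ∀ g k e f, e ≠ f →
      ex μ (fun F => ind g F * (1 - ind k F) * (ind e F * ind f F)) *
      ex μ (fun F => ind g F * (1 - ind k F) * ((1 - ind e F) * (1 - ind f F))) ≤
    ex μ (fun F => ind g F * (1 - ind k F) * (ind e F * (1 - ind f F))) *
      ex μ (fun F => ind g F * (1 - ind k F) * ((1 - ind e F) * ind f F))

/-- The factor `y` restricts the family to the sets satisfying `Y`, and the normalising constant
enters both sides as `c ^ 2`. Conditional correlation is thus handled without dividing by a
probability. -/
theorem ex_ind_le {μ : PMF (Finset α)} {T : Finset (Finset α)} {w : α → ℝ} {c : ℝ}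
    (hw : ∀ e, 0 ≤ w e) (hμ : ∀ F, (μ F).toReal = if F ∈ T then c * ∏ e ∈ F, w e else 0)
    (Y : Finset α → Prop) (y : Finset α → ℝ) (hy : ∀ F, y F = if Y F then 1 else 0)
    (hT : IsRayleigh (T.filter Y)) (e f : α) (hef : e ≠ f) :
    ex μ (fun F => y F * (ind e F * ind f F)) *
      ex μ (fun F => y F * ((1 - ind e F) * (1 - ind f F))) ≤
    ex μ (fun F => y F * (ind e F * (1 - ind f F))) *
      ex μ (fun F => y F * ((1 - ind e F) * ind f F)) := by
  have key : ∀ (X : Finset α → Prop) (z : Finset α → ℝ), (∀ F, z F = if X F then 1 else 0) →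
      ex μ (fun F => y F * z F) = c * weightSum (T.filter Y) w X := by
    intro X z hz
    rw [weightSum, Finset.mul_sum, Finset.sum_filter, Finset.sum_filter, ex,
      ← Finset.sum_subset (Finset.subset_univ T)]
    · refine Finset.sum_congr rfl fun F hF => ?_
      rw [hμ, hy, hz, if_pos hF]
      by_cases h1 : Y F <;> by_cases h2 : X F <;> simp [h1, h2]
    · intro F _ hF
      rw [hμ, if_neg hF, zero_mul]
  have h1 := hT w hw e f hef
  rw [key (fun F => e ∈ F ∧ f ∈ F), key (fun F => e ∉ F ∧ f ∉ F), key (fun F => e ∈ F ∧ f ∉ F),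
    key (fun F => e ∉ F ∧ f ∈ F)]
  · nlinarith [mul_le_mul_of_nonneg_left h1 (mul_self_nonneg c)]
  all_goals
    intro F
    by_cases h1 : e ∈ F <;> by_cases h2 : f ∈ F <;> simp [ind, h1, h2]

theorem isNegDep_of_isRayleigh {μ : PMF (Finset α)} {T : Finset (Finset α)} {w : α → ℝ} {c : ℝ}
    (hw : ∀ e, 0 ≤ w e) (hμ : ∀ F, (μ F).toReal = if F ∈ T then c * ∏ e ∈ F, w e else 0)
    (hT : IsRayleigh T) : IsNegDep μ where
  corr e f hef := by
    have := ex_ind_le hw hμ (fun _ => True) (fun _ => 1) (by simp) (by simpa using hT) e f hef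
    simpa only [one_mul] using this
  corr_in g e f hef := ex_ind_le hw hμ (fun F => g ∈ F) (fun F => ind g F)
    (fun F => by by_cases h : g ∈ F <;> simp [ind, h]) (by convert hT.contraction g) e f hef
  corr_in_out g k e f hef := by
    refine ex_ind_le hw hμ (fun F => g ∈ F ∧ k ∉ F) (fun F => ind g F * (1 - ind k F))
      (fun F => ?_) ?_ e f hef
    · by_cases h : g ∈ F <;> by_cases h' : k ∈ F <;> simp [ind, h, h']
    · have := (hT.contraction g).deletion k
      rw [Finset.filter_filter] at this
      convert this

/-- With z the joint probability, the marginals make the inequality read z² ≤ (1/2 − z)². -/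
theorem IsNegDep.pair_le {μ : PMF (Finset α)} (hμ : IsNegDep μ) {e f : α} (hef : e ≠ f)
    (he : ex μ (ind e) = 1 / 2) (hf : ex μ (ind f) = 1 / 2) :
    ex μ (fun F => ind e F * ind f F) ≤ 1 / 4 := by
  have h := hμ.corr e f hef
  have h1 : ex μ (fun F => (1 - ind e F) * (1 - ind f F)) =
      ex μ (fun _ => 1) - ex μ (ind e) - ex μ (ind f) + ex μ (fun F => ind e F * ind f F) := by
    rw [← ex_sub, ← ex_sub, ← ex_add]
    exact congrArg _ (funext fun F => by ring)
  rw [ex_const] at h1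
  have h2 : ex μ (fun F => ind e F * (1 - ind f F)) =
      ex μ (ind e) - ex μ (fun F => ind e F * ind f F) := by
    rw [← ex_sub]
    exact congrArg _ (funext fun F => by ring)
  have h3 : ex μ (fun F => (1 - ind e F) * ind f F) =
      ex μ (ind f) - ex μ (fun F => ind e F * ind f F) := by
    rw [← ex_sub]
    exact congrArg _ (funext fun F => by ring)
  rw [h1, h2, h3, he, hf] at h
  nlinarith

/-- Let s and t be the joint probabilities of `g` with `e` and with `f`, both at most 1/4.
Correlation on the event that `g` is present simplifies to z/2 ≤ st for the triple probability z. -/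
theorem IsNegDep.triple_le {μ : PMF (Finset α)} (hμ : IsNegDep μ) {e f g : α} (hef : e ≠ f)
    (hge : g ≠ e) (hgf : g ≠ f) (he : ex μ (ind e) = 1 / 2) (hf : ex μ (ind f) = 1 / 2)
    (hg : ex μ (ind g) = 1 / 2) : ex μ (fun F => ind g F * (ind e F * ind f F)) ≤ 1 / 8 := by
  have h := hμ.corr_in g e f hef
  have hs := hμ.pair_le hge hg he
  have ht := hμ.pair_le hgf hg hf
  have hs0 : 0 ≤ ex μ (fun F => ind g F * ind e F) := by
    rw [← ex_const μ 0]
    exact ex_mono fun F _ => mul_nonneg (ind_nonneg _ _) (ind_nonneg _ _)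
  have ht0 : 0 ≤ ex μ (fun F => ind g F * ind f F) := by
    rw [← ex_const μ 0]
    exact ex_mono fun F _ => mul_nonneg (ind_nonneg _ _) (ind_nonneg _ _)
  have h1 : ex μ (fun F => ind g F * ((1 - ind e F) * (1 - ind f F))) =
      ex μ (ind g) - ex μ (fun F => ind g F * ind e F) - ex μ (fun F => ind g F * ind f F) +
        ex μ (fun F => ind g F * (ind e F * ind f F)) := by
    rw [← ex_sub, ← ex_sub, ← ex_add]
    exact congrArg _ (funext fun F => by ring)
  have h2 : ex μ (fun F => ind g F * (ind e F * (1 - ind f F))) =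
      ex μ (fun F => ind g F * ind e F) - ex μ (fun F => ind g F * (ind e F * ind f F)) := by
    rw [← ex_sub]
    exact congrArg _ (funext fun F => by ring)
  have h3 : ex μ (fun F => ind g F * ((1 - ind e F) * ind f F)) =
      ex μ (fun F => ind g F * ind f F) - ex μ (fun F => ind g F * (ind e F * ind f F)) := by
    rw [← ex_sub]
    exact congrArg _ (funext fun F => by ring)
  rw [h1, h2, h3, hg] at h
  nlinarith [mul_le_mul hs ht ht0 (by norm_num : (0:ℝ) ≤ 1 / 4)]

end Expectation

end

section

/-! ### Parity of the number of tree edges in a cut with four edges -/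

section Parity

variable {α : Type*} [Fintype α]

/-- For a fixed edge of a four-edge cut, `a` is the probability that it is the only tree edge there;
`b`, `c`, `d` belong to the triples and `p`, `q`, `r` to the pairs containing it. Adding the three
inequalities gives `a * (b + c + d)` at most a third of `(p + q + r) ^ 2`. -/
theorem singleton_mass_le {a b c d p q r : ℝ} (ha : 0 ≤ a) (hp : 0 ≤ p) (hq : 0 ≤ q) (hr : 0 ≤ r)
    (hs : 1 / 16 ≤ b + c + d) (hM : p + q + r ≤ 1 / 8) (h1 : a * b ≤ q * r) (h2 : a * c ≤ p * r)
    (h3 : a * d ≤ p * q) : a ≤ 2 / 3 * (p + q + r) := by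
  have h4 : a * (b + c + d) ≤ (p + q + r) ^ 2 / 3 := by
    nlinarith [sq_nonneg (p - q), sq_nonneg (q - r), sq_nonneg (p - r)]
  have h5 : a * (1 / 16) ≤ a * (b + c + d) := mul_le_mul_of_nonneg_left hs ha
  have h6 : (p + q + r) ^ 2 ≤ (p + q + r) * (1 / 8) := by
    rw [pow_two]
    exact mul_le_mul_of_nonneg_left hM (by positivity)
  linarith

theorem card_inter_four {k₁ k₂ k₃ k₄ : α} (h12 : k₁ ≠ k₂) (h13 : k₁ ≠ k₃) (h14 : k₁ ≠ k₄)
    (h23 : k₂ ≠ k₃) (h24 : k₂ ≠ k₄) (h34 : k₃ ≠ k₄) [DecidableEq α] (F : Finset α) :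
    (F ∩ {k₁, k₂, k₃, k₄}).card = (if k₁ ∈ F then 1 else 0) + (if k₂ ∈ F then 1 else 0) +
      (if k₃ ∈ F then 1 else 0) + (if k₄ ∈ F then 1 else 0) := by
  rw [Finset.inter_comm, ← Finset.filter_mem_eq_inter, Finset.card_filter,
    Finset.sum_insert (by simp [h12, h13, h14]), Finset.sum_insert (by simp [h23, h24]),
    Finset.sum_insert (by simp [h34]), Finset.sum_singleton]
  ring

theorem ex_nonneg {β : Type*} [Fintype β] (μ : PMF β) {g : β → ℝ} (h : ∀ b, 0 ≤ g b) :
    0 ≤ ex μ g := by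
  rw [← ex_const μ 0]
  exact ex_mono fun b _ => h b

set_option maxHeartbeats 2000000 in
/-- An even number of tree edges in a cut with four edges. -/
theorem IsNegDep.even_four [DecidableEq α] {μ : PMF (Finset α)} (hμ : IsNegDep μ) {k₁ k₂ k₃ k₄ : α}
    (h12 : k₁ ≠ k₂) (h13 : k₁ ≠ k₃) (h14 : k₁ ≠ k₄) (h23 : k₂ ≠ k₃) (h24 : k₂ ≠ k₄) (h34 : k₃ ≠ k₄)
    (hk : ∀ k ∈ ({k₁, k₂, k₃, k₄} : Finset α), ex μ (ind k) = 1 / 2)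
    (hcut : ∀ F, μ F ≠ 0 → (F ∩ {k₁, k₂, k₃, k₄}).Nonempty) :
    1 / 8 ≤ pr μ (fun F => Even (F ∩ {k₁, k₂, k₃, k₄}).card) := by
  have e1 := hk k₁ (by simp)
  have e2 := hk k₂ (by simp)
  have e3 := hk k₃ (by simp)
  have e4 := hk k₄ (by simp)
  have p12 := hμ.pair_le h12 e1 e2
  have p13 := hμ.pair_le h13 e1 e3
  have p14 := hμ.pair_le h14 e1 e4
  have p23 := hμ.pair_le h23 e2 e3
  have p24 := hμ.pair_le h24 e2 e4
  have p34 := hμ.pair_le h34 e3 e4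
  -- The indicators of the sixteen intersection patterns, as products, so that marginals and
  -- correlations become polynomial identities between them.
  let A : (Bool × Bool × Bool × Bool) → Finset α → ℝ := fun t F =>
    (if t.1 then ind k₁ F else 1 - ind k₁ F) * (if t.2.1 then ind k₂ F else 1 - ind k₂ F) *
    (if t.2.2.1 then ind k₃ F else 1 - ind k₃ F) * (if t.2.2.2 then ind k₄ F else 1 - ind k₄ F)
  let q : (Bool × Bool × Bool × Bool) → ℝ := fun t => ex μ (A t)
  have hq : ∀ t, 0 ≤ q t := by
    rintro ⟨t1, t2, t3, t4⟩
    refine ex_nonneg _ fun F => ?_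
    have n1 := sub_nonneg.2 (ind_le_one k₁ F)
    have n2 := sub_nonneg.2 (ind_le_one k₂ F)
    have n3 := sub_nonneg.2 (ind_le_one k₃ F)
    have n4 := sub_nonneg.2 (ind_le_one k₄ F)
    have m1 := ind_nonneg k₁ F
    have m2 := ind_nonneg k₂ F
    have m3 := ind_nonneg k₃ F
    have m4 := ind_nonneg k₄ F
    refine mul_nonneg (mul_nonneg (mul_nonneg ?_ ?_) ?_) ?_ <;> dsimp only <;> split_ifs <;>
      assumption
  have hz : q (false, false, false, false) = 0 := by
    rw [← ex_const μ 0]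
    refine ex_congr fun F hF => ?_
    obtain ⟨k, hk⟩ := hcut F hF
    rw [Finset.mem_inter] at hk
    simp only [Finset.mem_insert, Finset.mem_singleton] at hk
    obtain ⟨hkF, rfl | rfl | rfl | rfl⟩ := hk <;> simp [A, ind_of_mem hkF]
  have total : 1 = ∑ t, q t := by
    simp only [Fintype.sum_prod_type, Fintype.sum_bool, q, ← ex_add]
    rw [← ex_const μ 1]
    refine congrArg _ (funext fun F => ?_)
    simp only [A, if_true, Bool.false_eq_true, if_false]
    ring
  have marg : ∀ (g : Finset α → ℝ) (c : Bool × Bool × Bool × Bool → ℝ),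
      (∀ F, g F = ∑ t, c t * A t F) → ex μ g = ∑ t, c t * q t := by
    intro g c h
    simp only [q, ← ex_const_mul, Fintype.sum_prod_type, Fintype.sum_bool, ← ex_add]
    refine congrArg _ (funext fun F => ?_)
    rw [h]
    simp only [Fintype.sum_prod_type, Fintype.sum_bool]
  have m1 := marg (ind k₁) (fun t => if t.1 then 1 else 0) (fun F => by
    simp [Fintype.sum_prod_type, A]; ring)
  have m2 := marg (ind k₂) (fun t => if t.2.1 then 1 else 0) (fun F => by
    simp [Fintype.sum_prod_type, A]; ring)
  have m3 := marg (ind k₃) (fun t => if t.2.2.1 then 1 else 0) (fun F => by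
    simp [Fintype.sum_prod_type, A]; ring)
  have m4 := marg (ind k₄) (fun t => if t.2.2.2 then 1 else 0) (fun F => by
    simp [Fintype.sum_prod_type, A]; ring)
  have m12 := marg (fun F => ind k₁ F * ind k₂ F) (fun t => if t.1 ∧ t.2.1 then 1 else 0)
    (fun F => by simp [Fintype.sum_prod_type, A]; ring)
  have m13 := marg (fun F => ind k₁ F * ind k₃ F) (fun t => if t.1 ∧ t.2.2.1 then 1 else 0)
    (fun F => by simp [Fintype.sum_prod_type, A]; ring)
  have m14 := marg (fun F => ind k₁ F * ind k₄ F) (fun t => if t.1 ∧ t.2.2.2 then 1 else 0)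
    (fun F => by simp [Fintype.sum_prod_type, A]; ring)
  have m23 := marg (fun F => ind k₂ F * ind k₃ F) (fun t => if t.2.1 ∧ t.2.2.1 then 1 else 0)
    (fun F => by simp [Fintype.sum_prod_type, A]; ring)
  have m24 := marg (fun F => ind k₂ F * ind k₄ F) (fun t => if t.2.1 ∧ t.2.2.2 then 1 else 0)
    (fun F => by simp [Fintype.sum_prod_type, A]; ring)
  have m34 := marg (fun F => ind k₃ F * ind k₄ F) (fun t => if t.2.2.1 ∧ t.2.2.2 then 1 else 0)
    (fun F => by simp [Fintype.sum_prod_type, A]; ring)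
  have hev : pr μ (fun F => Even (F ∩ {k₁, k₂, k₃, k₄}).card) =
      ∑ t : Bool × Bool × Bool × Bool,
          (if (t.1 ^^ t.2.1 ^^ t.2.2.1 ^^ t.2.2.2) then 0 else 1) * q t := by
    rw [pr_eq_ex]
    refine marg _ _ fun F => ?_
    simp only [card_inter_four h12 h13 h14 h23 h24 h34]
    by_cases c1 : k₁ ∈ F <;> by_cases c2 : k₂ ∈ F <;> by_cases c3 : k₃ ∈ F <;>
      by_cases c4 : k₄ ∈ F <;>
      simp [Fintype.sum_prod_type, A, ind, c1, c2, c3, c4, Nat.even_iff]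
  rw [hev]
  -- With `g` present and `k` absent, the patterns of `e` and `f` are a triple, a singleton and two
  -- pairs: singleton times triple is at most the product of the pairs.
  have r : ∀ g k e f : α, e ≠ f → ∀ t1 t2 t3 t4,
      (∀ F, A t1 F = ind g F * (1 - ind k F) * (ind e F * ind f F)) →
      (∀ F, A t2 F = ind g F * (1 - ind k F) * ((1 - ind e F) * (1 - ind f F))) →
      (∀ F, A t3 F = ind g F * (1 - ind k F) * (ind e F * (1 - ind f F))) →
      (∀ F, A t4 F = ind g F * (1 - ind k F) * ((1 - ind e F) * ind f F)) →
      q t2 * q t1 ≤ q t3 * q t4 := by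
    intro g k e f hef t1 t2 t3 t4 H1 H2 H3 H4
    simp only [q, funext H1, funext H2, funext H3, funext H4]
    rw [mul_comm]
    exact hμ.corr_in_out g k e f hef
  have r12 := r k₁ k₂ k₃ k₄ h34 (true, false, true, true) (true, false, false, false)
    (true, false, true, false) (true, false, false, true) (fun F => by simp [A]; ring)
    (fun F => by simp [A]; ring) (fun F => by simp [A]; ring) (fun F => by simp [A]; ring)
  have r13 := r k₁ k₃ k₂ k₄ h24 (true, true, false, true) (true, false, false, false)
    (true, true, false, false) (true, false, false, true) (fun F => by simp [A]; ring)
    (fun F => by simp [A]; ring) (fun F => by simp [A]; ring) (fun F => by simp [A]; ring)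
  have r14 := r k₁ k₄ k₂ k₃ h23 (true, true, true, false) (true, false, false, false)
    (true, true, false, false) (true, false, true, false) (fun F => by simp [A]; ring)
    (fun F => by simp [A]; ring) (fun F => by simp [A]; ring) (fun F => by simp [A]; ring)
  have r21 := r k₂ k₁ k₃ k₄ h34 (false, true, true, true) (false, true, false, false)
    (false, true, true, false) (false, true, false, true) (fun F => by simp [A]; ring)
    (fun F => by simp [A]; ring) (fun F => by simp [A]; ring) (fun F => by simp [A]; ring)
  have r23 := r k₂ k₃ k₁ k₄ h14 (true, true, false, true) (false, true, false, false)
    (true, true, false, false) (false, true, false, true) (fun F => by simp [A]; ring)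
    (fun F => by simp [A]; ring) (fun F => by simp [A]; ring) (fun F => by simp [A]; ring)
  have r24 := r k₂ k₄ k₁ k₃ h13 (true, true, true, false) (false, true, false, false)
    (true, true, false, false) (false, true, true, false) (fun F => by simp [A]; ring)
    (fun F => by simp [A]; ring) (fun F => by simp [A]; ring) (fun F => by simp [A]; ring)
  have r31 := r k₃ k₁ k₂ k₄ h24 (false, true, true, true) (false, false, true, false)
    (false, true, true, false) (false, false, true, true) (fun F => by simp [A]; ring)
    (fun F => by simp [A]; ring) (fun F => by simp [A]; ring) (fun F => by simp [A]; ring)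
  have r32 := r k₃ k₂ k₁ k₄ h14 (true, false, true, true) (false, false, true, false)
    (true, false, true, false) (false, false, true, true) (fun F => by simp [A]; ring)
    (fun F => by simp [A]; ring) (fun F => by simp [A]; ring) (fun F => by simp [A]; ring)
  have r34 := r k₃ k₄ k₁ k₂ h12 (true, true, true, false) (false, false, true, false)
    (true, false, true, false) (false, true, true, false) (fun F => by simp [A]; ring)
    (fun F => by simp [A]; ring) (fun F => by simp [A]; ring) (fun F => by simp [A]; ring)
  have r41 := r k₄ k₁ k₂ k₃ h23 (false, true, true, true) (false, false, false, true)
    (false, true, false, true) (false, false, true, true) (fun F => by simp [A]; ring)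
    (fun F => by simp [A]; ring) (fun F => by simp [A]; ring) (fun F => by simp [A]; ring)
  have r42 := r k₄ k₂ k₁ k₃ h13 (true, false, true, true) (false, false, false, true)
    (true, false, false, true) (false, false, true, true) (fun F => by simp [A]; ring)
    (fun F => by simp [A]; ring) (fun F => by simp [A]; ring) (fun F => by simp [A]; ring)
  have r43 := r k₄ k₃ k₁ k₂ h12 (true, true, false, true) (false, false, false, true)
    (true, false, false, true) (false, true, false, true) (fun F => by simp [A]; ring)
    (fun F => by simp [A]; ring) (fun F => by simp [A]; ring) (fun F => by simp [A]; ring)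
  simp only [Fintype.sum_prod_type, Fintype.sum_bool, hz]
    at total m1 m2 m3 m4 m12 m13 m14 m23 m24 m34 ⊢
  simp only [Bool.false_eq_true, if_true, if_false, and_true, and_false,
    and_self, one_mul, zero_mul, add_zero, zero_add, Bool.xor_false, Bool.xor_true, Bool.not_true,
    Bool.not_false, mul_zero] at total m1 m2 m3 m4 m12 m13 m14 m23 m24 m34 ⊢
  rw [e1] at m1
  rw [e2] at m2
  rw [e3] at m3
  rw [e4] at m4
  rw [m12] at p12
  rw [m13] at p13
  rw [m14] at p14
  rw [m23] at p23
  rw [m24] at p24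
  rw [m34] at p34
  clear_value q
  clear hev marg r m12 m13 m14 m23 m24 m34 e1 e2 e3 e4 hz
  have a1 := hq (true, false, false, false)
  have a2 := hq (false, true, false, false)
  have a3 := hq (false, false, true, false)
  have a4 := hq (false, false, false, true)
  have b1 := hq (false, true, true, true)
  have b2 := hq (true, false, true, true)
  have b3 := hq (true, true, false, true)
  have b4 := hq (true, true, true, false)
  have c12 := hq (true, true, false, false)
  have c13 := hq (true, false, true, false)
  have c14 := hq (true, false, false, true)
  have c23 := hq (false, true, true, false)
  have c24 := hq (false, true, false, true)
  have c34 := hq (false, false, true, true)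
  have c := hq (true, true, true, true)
  -- Suppose the even patterns have mass below 1/8. Total mass 1 and mean 2 give the triples more
  -- than 5/16 and the singletons more than 7/16. By the pair bound the triple omitting a given edge
  -- has at most 1/4, so the triples containing it keep at least 1/16. Then the singletons have at
  -- most 4/3 of the mass of the pairs, less than 1/6, a contradiction.
  by_contra hlt
  push Not at hlt
  have s1 := singleton_mass_le a1 c12 c13 c14 (by linarith) (by linarith) (r12) (r13) (r14)
  have s2 := singleton_mass_le a2 c12 c23 c24 (by linarith) (by linarith) (r21) (r23) (r24)
  have s3 := singleton_mass_le a3 c13 c23 c34 (by linarith) (by linarith) (r31) (r32) (r34)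
  have s4 := singleton_mass_le a4 c14 c24 c34 (by linarith) (by linarith) (r41) (r42) (r43)
  linarith

/-- An odd number of tree edges in the cut around the two ends of an edge `e`; the other edges at
these ends are `f`, `g` and `h`, `h'`. -/
theorem two_mul_ex_le_odd [DecidableEq α] {μ : PMF (Finset α)} {e f g h h' : α}
    (hfg : f ≠ g) (hfh : f ≠ h) (hfh' : f ≠ h') (hgh : g ≠ h) (hgh' : g ≠ h') (hhh' : h ≠ h')
    (hk : ∀ k ∈ ({f, g, h, h'} : Finset α), ex μ (ind k) = 1 / 2)
    (hcut : ∀ F, μ F ≠ 0 → (F ∩ {f, g, h, h'}).Nonempty)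
    (hend : ∀ F, μ F ≠ 0 → (F ∩ {e, h, h'}).Nonempty) :
    2 * ex μ (fun F => (1 - ind e F) * (ind f F * ind g F)) ≤
      pr μ (fun F => ¬ Even (F ∩ {f, g, h, h'}).card) := by
  have e1 := hk f (by simp)
  have e2 := hk g (by simp)
  have e3 := hk h (by simp)
  have e4 := hk h' (by simp)
  rw [pr_eq_ex, ← ex_const_mul]
  -- The added term has mean zero. If `e` is absent while `f` and `g` are present, then `h` or `h'`
  -- is present, and the right side is 2 both for three edges and for four. In the other cases it is
  -- nonnegative, because the four edges are never all absent.
  have key : ex μ (fun F => 2 * ((1 - ind e F) * (ind f F * ind g F))) ≤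
      ex μ (fun F => (if ¬ Even (F ∩ {f, g, h, h'}).card then 1 else 0) +
        (ind f F + ind g F + ind h F + ind h' F - 2)) := by
    refine ex_mono fun F hF => ?_
    have h1 := hcut F hF
    have h2 := hend F hF
    obtain ⟨k, hk⟩ := h1
    obtain ⟨k', hk'⟩ := h2
    simp only [Finset.mem_inter, Finset.mem_insert, Finset.mem_singleton] at hk hk'
    have h1 : f ∈ F ∨ g ∈ F ∨ h ∈ F ∨ h' ∈ F := by
      obtain ⟨hkF, rfl | rfl | rfl | rfl⟩ := hk <;> simp [hkF]
    have h2 : e ∈ F ∨ h ∈ F ∨ h' ∈ F := by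
      obtain ⟨hkF, rfl | rfl | rfl⟩ := hk' <;> simp [hkF]
    clear hk hk'
    rw [card_inter_four hfg hfh hfh' hgh hgh' hhh']
    by_cases c1 : f ∈ F <;> by_cases c2 : g ∈ F <;> by_cases c3 : h ∈ F <;>
      by_cases c4 : h' ∈ F <;> by_cases c5 : e ∈ F <;> simp only [c1, c2, c3, c4, c5] at h1 h2 <;>
      simp only [c1, c2, c3, c4, c5, ind, if_true, if_false, Nat.even_iff] <;>
      first | (exfalso; simp at h1; done) | (exfalso; simp at h2; done) | norm_num
  refine key.trans (le_of_eq ?_)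
  have h0 := ex_const μ 2
  rw [ex_add, ex_sub, ex_add, ex_add, ex_add, h0]
  have eta : ∀ k, ex μ (fun F => ind k F) = ex μ (ind k) := fun _ => rfl
  rw [eta, eta, eta, eta, e1, e2, e3, e4]
  norm_num

/-- Among two edges `e` and `f` with a common end of degree three, one has an odd number of tree
edges in the cut around its ends with probability at least `1/8`. -/
theorem IsNegDep.odd_four [DecidableEq α] {μ : PMF (Finset α)} (hμ : IsNegDep μ)
    {e f g h h' i i' : α} (hef : e ≠ f) (heg : e ≠ g) (hei : e ≠ i) (hei' : e ≠ i')
    (hfg : f ≠ g) (hfh : f ≠ h) (hfh' : f ≠ h') (hgh : g ≠ h) (hgh' : g ≠ h') (hhh' : h ≠ h')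
    (hgi : g ≠ i) (hgi' : g ≠ i') (hii' : i ≠ i')
    (hk : ∀ k ∈ ({e, f, g, h, h', i, i'} : Finset α), ex μ (ind k) = 1 / 2)
    (hS : ∀ F, μ F ≠ 0 → (F ∩ {e, f, g}).Nonempty)
    (hcut : ∀ F, μ F ≠ 0 → (F ∩ {f, g, h, h'}).Nonempty)
    (hend : ∀ F, μ F ≠ 0 → (F ∩ {e, h, h'}).Nonempty)
    (hcut' : ∀ F, μ F ≠ 0 → (F ∩ {e, g, i, i'}).Nonempty)
    (hend' : ∀ F, μ F ≠ 0 → (F ∩ {f, i, i'}).Nonempty) :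
    1 / 8 ≤ pr μ (fun F => ¬ Even (F ∩ {f, g, h, h'}).card) ∨
      1 / 8 ≤ pr μ (fun F => ¬ Even (F ∩ {e, g, i, i'}).card) := by
  have he := hk e (by simp)
  have hf := hk f (by simp)
  have hg := hk g (by simp)
  have o1 := two_mul_ex_le_odd hfg hfh hfh' hgh hgh' hhh'
    (fun k hk' => hk k (by
      simp only [Finset.mem_insert, Finset.mem_singleton] at hk'
      rcases hk' with rfl | rfl | rfl | rfl <;> simp)) hcut hend
  have o2 := two_mul_ex_le_odd heg hei hei' hgi hgi' hii'
    (fun k hk' => hk k (by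
      simp only [Finset.mem_insert, Finset.mem_singleton] at hk'
      rcases hk' with rfl | rfl | rfl | rfl <;> simp)) hcut' hend'
  have t := hμ.triple_le hef heg.symm hfg.symm he hf hg
  have p := hμ.pair_le hef he hf
  -- Inclusion–exclusion, with the fact that one of `e`, `f`, `g` is always present. The pair and
  -- triple bounds leave at least 3/2 − 1 − 1/4 − 1/8 = 1/8, and doubling it bounds the sum of the
  -- two odd probabilities below by 1/4.
  have key : ex μ (fun F => (1 - ind e F) * (ind f F * ind g F)) +
      ex μ (fun F => (1 - ind f F) * (ind e F * ind g F)) =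
      ex μ (ind e) + ex μ (ind f) + ex μ (ind g) - ex μ (fun _ => 1) -
        ex μ (fun F => ind e F * ind f F) - ex μ (fun F => ind g F * (ind e F * ind f F)) := by
    rw [← ex_add, ← ex_add, ← ex_add, ← ex_sub, ← ex_sub, ← ex_sub]
    refine ex_congr fun F hF => ?_
    obtain ⟨k, hk⟩ := hS F hF
    simp only [Finset.mem_inter, Finset.mem_insert, Finset.mem_singleton] at hk
    have h1 : (1 - ind e F) * (1 - ind f F) * (1 - ind g F) = 0 := by
      obtain ⟨hkF, rfl | rfl | rfl⟩ := hk <;> simp [ind_of_mem hkF]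
    linear_combination h1
  rw [ex_const, he, hf, hg] at key
  by_contra hcon
  push Not at hcon
  linarith

end Parity

end

section

variable {V : Type*} [Fintype V] {x : Sym2 V → ℝ} {ePlus : Sym2 V} {P : Finset (Finset V)}
  {D : Finset V}

/-! ### The local graph of a selected set -/

theorem isPart_local (hP : IsPart P) (hD : IsVertexSet P D) (hne : Dᶜ.Nonempty) :
    IsPart (insert Dᶜ (nodesIn P D)) := by
  have h1 : ∀ B ∈ nodesIn P D, ∀ v ∈ B, v ∉ Dᶜ := fun B hB v hv => by
    simpa using (mem_nodesIn.1 hB).2 hv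
  refine ⟨fun B hB => ?_, fun B hB C hC v hvB hvC => ?_, fun v => ?_⟩
  · rcases Finset.mem_insert.1 hB with rfl | hB
    · exact hne
    · exact hP.nonempty B (mem_nodesIn.1 hB).1
  · rcases Finset.mem_insert.1 hB with hB' | hB' <;> rcases Finset.mem_insert.1 hC with hC' | hC'
    · rw [hB', hC']
    · exact (h1 C hC' v hvC (hB' ▸ hvB)).elim
    · exact (h1 B hB' v hvB (hC' ▸ hvC)).elim
    · exact hP.eq_of_mem B (mem_nodesIn.1 hB').1 C (mem_nodesIn.1 hC').1 v hvB hvC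
  · by_cases hv : v ∈ D
    · obtain ⟨B, hB, hvB⟩ := hP.cover v
      exact ⟨B, Finset.mem_insert_of_mem (mem_nodesIn.2 ⟨hB, fun u hu =>
        isVertexSet_iff.1 hD B hB v hvB u hu hv⟩), hvB⟩
    · exact ⟨Dᶜ, Finset.mem_insert_self _ _, Finset.mem_compl.2 hv⟩

/-- If the local graph of a selected set is not a cycle of doubled edges, it is a simple graph. -/
theorem local_simple (hx : IsHeldKarp x) (hhalf : IsHalfIntegral x) (hP : IsState x ePlus P)
    (hD : IsSelectable x ePlus P D) {S : Finset V} (hS : S ∈ P) (hSD : S ⊆ D)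
    (h0 : flow x S Dᶜ ≠ 0) (h1 : flow x S Dᶜ ≠ 1) :
    3 ≤ (nodesIn P D).card ∧ ∀ B ∈ P, ∀ C ∈ P, B ⊆ D → C ⊆ D → B ≠ C →
      (edgesBetween x B C).card ≤ 1 ∧ (edgesBetween x B Dᶜ).card ≤ 1 := by
  obtain ⟨⟨⟨hDt, hDp, hDc⟩, hDplus⟩, hDmin⟩ := hD
  rw [isTight_iff hhalf] at hDt
  have hDcne : Dᶜ.Nonempty := nonempty_of_two_le hP.part hDp.2
  have hP' := isPart_local hP.part hDt.1 hDcne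
  set P' := insert Dᶜ (nodesIn P D) with hP'def
  have hDmem : Dᶜ ∈ P' := Finset.mem_insert_self _ _
  have hnot : Dᶜ ∉ nodesIn P D := by
    intro h
    obtain ⟨v, hv⟩ := hDcne
    exact Finset.mem_compl.1 hv ((mem_nodesIn.1 h).2 hv)
  have hcard : P'.card = (nodesIn P D).card + 1 := Finset.card_insert_of_notMem hnot
  have hcard3 : 3 ≤ P'.card := by have := hDp.1; omega
  have hco : Coarser P P' := by
    intro B hB
    rcases Finset.mem_insert.1 hB with rfl | hB
    · exact hDt.1.compl
    · exact hP.part.isVertexSet (mem_nodesIn.1 hB).1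
  have hdeg : ∀ B ∈ P', flow x B Bᶜ = 2 := by
    intro B hB
    rcases Finset.mem_insert.1 hB with rfl | hB
    · rw [flow_compl]; exact hDt.2
    · exact hP.deg B (mem_nodesIn.1 hB).1
  -- By minimality of `D`, a proper tight set inside it is not a candidate, so some tight `Q`
  -- crosses it. As `Q` does not cross `D`, it does not split `Dᶜ` and lives in the local graph.
  have hsub : ∀ R ⊆ D, IsVertexSet P' R → flow x R Rᶜ = 2 → IsProper P' R →
      ∃ Q, IsVertexSet P' Q ∧ flow x Q Qᶜ = 2 ∧ Cross R Q := by
    intro R hRD hR hRt hRp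
    have hRvs := hco.isVertexSet hP' hR
    have hRpP : IsProper P R := ⟨hco.two_le_card_nodesIn hP.part hP' hRp.1,
      hco.two_le_card_nodesIn hP.part hP' hRp.2⟩
    have hnc : ¬ IsCandidate x P R := by
      intro hc
      have hDR : D ≤ R := hDmin ⟨hc, fun h => hDplus fun v hv => hRD (h v hv)⟩ hRD
      have : R = D := Finset.Subset.antisymm hRD hDR
      exact hP'.not_two_le_card_nodesIn hDmem (this ▸ hRp.2)
    obtain ⟨Q, hQ, hQt, hRQ⟩ := exists_cross_of_not_isCandidate hhalf hRvs hRt hRpP hnc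
    refine ⟨Q, ?_, hQt, hRQ⟩
    have hDQ := hDc Q ((isTight_iff hhalf).2 ⟨hQ, hQt⟩)
    rw [cross_iff] at hDQ hRQ
    obtain ⟨⟨a, ha, ha'⟩, -, ⟨c, hc, hc'⟩, -⟩ := hRQ
    intro B hB
    rcases Finset.mem_insert.1 hB with rfl | hB
    · by_contra hcon
      rw [not_or, Finset.not_subset, Finset.not_disjoint_iff] at hcon
      obtain ⟨⟨p, hp, hpQ⟩, ⟨q, hq, hqQ⟩⟩ := hcon
      exact hDQ ⟨⟨a, hRD ha, ha'⟩, ⟨q, hqQ, Finset.mem_compl.1 hq⟩, ⟨c, hRD hc, hc'⟩,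
        ⟨p, Finset.mem_compl.1 hp, hpQ⟩⟩
    · exact hQ B (mem_nodesIn.1 hB).1
  have hcross : ∀ R, IsVertexSet P' R → flow x R Rᶜ = 2 → IsProper P' R →
      ∃ Q, IsVertexSet P' Q ∧ flow x Q Qᶜ = 2 ∧ Cross R Q := by
    intro R hR hRt hRp
    rcases hR Dᶜ hDmem with h | h
    · obtain ⟨Q, h1, h2, h3⟩ := hsub Rᶜ (by rwa [← Finset.compl_subset_compl, compl_compl]) hR.compl
        (by rw [flow_compl]; exact hRt) ⟨hRp.2, by rw [compl_compl]; exact hRp.1⟩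
      exact ⟨Q, h1, h2, by simpa using h3.compl_left⟩
    · refine hsub R (fun v hv => ?_) hR hRt hRp
      by_contra hvD
      exact Finset.disjoint_left.1 h (Finset.mem_compl.2 hvD) hv
  have hSP' : S ∈ P' := Finset.mem_insert_of_mem (mem_nodesIn.2 ⟨hS, hSD⟩)
  have hSne : S ≠ Dᶜ := fun h => hnot (h ▸ mem_nodesIn.2 ⟨hS, hSD⟩)
  have hno : ¬ (P'.card = 3 ∨ ∃ R, IsVertexSet P' R ∧ flow x R Rᶜ = 2 ∧ IsProper P' R) := by
    intro hex
    rcases flow_eq_zero_or_one_of_crossed hx _ P' rfl hcard3 hP' hdeg hcross hex S hSP' Dᶜ hDmem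
      hSne with h | h
    · exact h0 h
    · exact h1 h
  rw [not_or] at hno
  have hcard4 : 4 ≤ P'.card := by omega
  have hle : ∀ B ∈ P', ∀ C ∈ P', B ≠ C → (edgesBetween x B C).card ≤ 1 := by
    intro B hB C hC hBC
    have hd := hP'.disjoint hB hC hBC
    have hle := hP'.flow_le_one hx hcard3 hdeg hB hC hBC
    -- A parallel pair would make the union of its ends a proper tight set of the local graph, and
    -- there is none.
    have hne1 : flow x B C ≠ 1 := by
      intro h
      refine hno.2 ⟨B ∪ C, hP'.isVertexSet_union hB hC, ?_, two_le_card_nodesIn.2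
        ⟨B, C, hB, hC, Finset.subset_union_left, Finset.subset_union_right, hBC⟩,
        hP'.two_le_card_compl_union hcard4 hB hC⟩
      rw [flow_union_compl hd (hdeg B hB) (hdeg C hC), h]
      norm_num
    have h1 := card_edgesBetween hhalf hd
    have h2 : ((edgesBetween x B C).card : ℝ) < 2 := by
      rw [h1]
      have := lt_of_le_of_ne hle hne1
      linarith
    have : (edgesBetween x B C).card < 2 := by exact_mod_cast h2
    omega
  refine ⟨by omega, fun B hB C hC hBD hCD hBC => ?_⟩
  have hB' : B ∈ P' := Finset.mem_insert_of_mem (mem_nodesIn.2 ⟨hB, hBD⟩)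
  have hC' : C ∈ P' := Finset.mem_insert_of_mem (mem_nodesIn.2 ⟨hC, hCD⟩)
  exact ⟨hle B hB' C hC' hBC, hle B hB' Dᶜ hDmem fun h => hnot (h ▸ mem_nodesIn.2 ⟨hB, hBD⟩)⟩

/-- The edges of `δ(B)` that have both ends in `D`. -/
def innerCut (x : Sym2 V → ℝ) (D B : Finset V) : Finset (Edge V) := cut x B \ cut x D

theorem mem_innerCut (hP : IsPart P) (hD : IsVertexSet P D) {B : Finset V} (hB : B ∈ P)
    (hBD : B ⊆ D) {e : Edge V} : e ∈ innerCut x D B ↔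
      ∃ C ∈ P, C ⊆ D ∧ C ≠ B ∧ e ∈ edgesBetween x B C := by
  rw [innerCut, Finset.mem_sdiff]
  constructor
  · rintro ⟨h, h'⟩
    obtain ⟨C, hC, hCB, he⟩ := hP.exists_edgesBetween_of_mem_cut h
    refine ⟨C, hC, ?_, hCB, he⟩
    rcases hD C hC with hCD | hCD
    · exact hCD
    · obtain ⟨hs, u, v, huv, hu, hv⟩ := mem_edgesBetween.1 he
      exact (h' (mem_cut.2 ⟨hs, u, v, huv, hBD hu, Finset.disjoint_left.1 hCD hv⟩)).elim
  · rintro ⟨C, hC, hCD, hCB, he⟩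
    refine ⟨edgesBetween_subset_cut (hP.disjoint hB hC hCB.symm) he, fun h => ?_⟩
    obtain ⟨hs, u, v, huv, hu, hv⟩ := mem_edgesBetween.1 he
    obtain ⟨-, u', v', huv', hu', hv'⟩ := mem_cut.1 h
    rw [huv, Sym2.eq_iff] at huv'
    rcases huv' with ⟨-, rfl⟩ | ⟨rfl, -⟩
    · exact hv' (hCD hv)
    · exact hv' (hBD hu)

theorem innerCut_subset_innerEdges (hP : IsPart P) (hD : IsVertexSet P D) {B : Finset V}
    (hB : B ∈ P) (hBD : B ⊆ D) : innerCut x D B ⊆ innerEdges x P D := by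
  intro e he
  obtain ⟨C, hC, hCD, hCB, he⟩ := (mem_innerCut hP hD hB hBD).1 he
  have h1 := hP.mem_innerEdges_univ.2 ⟨B, hB, C, hC, hCB.symm, he⟩
  rw [mem_innerEdges] at h1 ⊢
  obtain ⟨-, u, v, huv, hu, hv⟩ := mem_edgesBetween.1 he
  refine ⟨h1.1, fun w hw => ?_, h1.2.2⟩
  rw [huv, Sym2.mem_iff] at hw
  rcases hw with rfl | rfl
  · exact hBD hu
  · exact hCD hv

theorem mem_edgesBetween_of_mem_innerCut (hP : IsPart P) (hD : IsVertexSet P D) {B C : Finset V}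
    (hB : B ∈ P) (hBD : B ⊆ D) (hC : C ∈ P) (hBC : B ≠ C) {e : Edge V}
    (h : e ∈ innerCut x D B) (h' : e ∈ innerCut x D C) : e ∈ edgesBetween x B C := by
  obtain ⟨C', hC', -, -, he⟩ := (mem_innerCut hP hD hB hBD).1 h
  obtain ⟨-, u, v, huv, hu, hv⟩ := mem_edgesBetween.1 he
  obtain ⟨-, u', v', huv', hu', -⟩ := mem_cut.1 (Finset.mem_sdiff.1 h').1
  rw [huv, Sym2.eq_iff] at huv'
  rcases huv' with ⟨rfl, -⟩ | ⟨-, rfl⟩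
  · exact (hBC (hP.eq_of_mem B hB C hC _ hu hu')).elim
  · rwa [hP.eq_of_mem C' hC' C hC _ hv hu'] at he

theorem notMem_cut_of_mem_innerEdges {e : Edge V} (he : e ∈ innerEdges x P D) : e ∉ cut x D := by
  intro h
  obtain ⟨-, u, v, huv, -, hv⟩ := mem_cut.1 h
  exact hv ((mem_innerEdges.1 he).2.1 v (by rw [huv]; simp))

theorem edgesBetween_compl_eq {B : Finset V} (hBD : B ⊆ D) :
    edgesBetween x B Dᶜ = cut x B ∩ cut x D := by
  ext e
  rw [Finset.mem_inter, mem_edgesBetween, mem_cut, mem_cut]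
  constructor
  · rintro ⟨hs, u, v, huv, hu, hv⟩
    have hv' := Finset.mem_compl.1 hv
    exact ⟨⟨hs, u, v, huv, hu, fun h => hv' (hBD h)⟩, ⟨hs, u, v, huv, hBD hu, hv'⟩⟩
  · rintro ⟨⟨hs, u, v, huv, hu, hv⟩, -, u', v', huv', hu', hv'⟩
    refine ⟨hs, u, v, huv, hu, Finset.mem_compl.2 ?_⟩
    rw [huv, Sym2.eq_iff] at huv'
    rcases huv' with ⟨-, rfl⟩ | ⟨rfl, -⟩
    · exact hv'
    · exact (hv' (hBD hu)).elim

theorem card_innerCut_add (B : Finset V) :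
    (innerCut x D B).card + (cut x B ∩ cut x D).card = (cut x B).card :=
  Finset.card_sdiff_add_card_inter _ _

/-! ### Tree edges in the cuts of the local graph. -/

section Tree

variable {F : Finset (Edge V)}

theorem IsSpanningTree.inter_innerCut_nonempty (hP : IsPart P)
    (hcard : 2 ≤ (nodesIn P D).card) (hF : IsSpanningTree x P D F) {B : Finset V} (hB : B ∈ P)
    (hBD : B ⊆ D) : (F ∩ innerCut x D B).Nonempty := by
  obtain ⟨C, hC, hCB⟩ := Finset.exists_mem_ne hcard B
  obtain ⟨hC, hCD⟩ := mem_nodesIn.1 hC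
  obtain ⟨u, hu⟩ := hP.nonempty B hB
  obtain ⟨v, hv⟩ := hP.nonempty C hC
  obtain ⟨f, hf, p, q, hpq, hp, hq⟩ := hF.2.1.exists_cut (hP.isVertexSet hB) (hBD hu) (hCD hv) hu
    (fun h => hCB (hP.eq_of_mem C hC B hB v hv h))
  exact ⟨f, Finset.mem_inter.2 ⟨hf, Finset.mem_sdiff.2
    ⟨mem_cut.2 ⟨(mem_innerEdges.1 (hF.1 hf)).1, p, q, hpq, hp, hq⟩,
      notMem_cut_of_mem_innerEdges (hF.1 hf)⟩⟩⟩

/-- The tree must join `B ∪ C` to a third vertex inside `D`. -/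
theorem IsSpanningTree.exists_mem_innerCut (hP : IsPart P)
    (hcard : 3 ≤ (nodesIn P D).card) (hF : IsSpanningTree x P D F) {B C : Finset V} (hB : B ∈ P)
    (hBD : B ⊆ D) (hC : C ∈ P) :
    ∃ f ∈ F, (f ∈ innerCut x D B ∨ f ∈ innerCut x D C) ∧ f ∉ edgesBetween x B C := by
  obtain ⟨A, hA, hAB, hAC⟩ := exists_third hcard B C
  obtain ⟨hA, hAD⟩ := mem_nodesIn.1 hA
  obtain ⟨u, hu⟩ := hP.nonempty B hB
  obtain ⟨v, hv⟩ := hP.nonempty A hA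
  obtain ⟨f, hf, p, q, hpq, hp, hq⟩ := hF.2.1.exists_cut (hP.isVertexSet_union hB hC) (hBD hu)
    (hAD hv) (Finset.mem_union_left _ hu) (hP.notMem_union hB hC hA hAB hAC hv)
  have hfs := (mem_innerEdges.1 (hF.1 hf)).1
  have hfD := notMem_cut_of_mem_innerEdges (hF.1 hf)
  refine ⟨f, hf, ?_, ?_⟩
  · rw [Finset.mem_union, not_or] at hq
    rcases Finset.mem_union.1 hp with hp | hp
    · exact .inl (Finset.mem_sdiff.2 ⟨mem_cut.2 ⟨hfs, p, q, hpq, hp, hq.1⟩, hfD⟩)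
    · exact .inr (Finset.mem_sdiff.2 ⟨mem_cut.2 ⟨hfs, p, q, hpq, hp, hq.2⟩, hfD⟩)
  · intro h
    obtain ⟨-, u', v', huv', hu', hv'⟩ := mem_edgesBetween.1 h
    rw [hpq, Sym2.eq_iff] at huv'
    rcases huv' with ⟨-, rfl⟩ | ⟨-, rfl⟩
    · exact hq (Finset.mem_union_right _ hv')
    · exact hq (Finset.mem_union_left _ hu')

/-- Edges of δ(B) inside `D` can only come from the tree `F`; edges leaving `D` only from the later
sample `F'`. -/
theorem card_union_inter_cut {F' : Finset (Edge V)} (hF : F ⊆ innerEdges x P D)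
    (hF' : F' ⊆ innerEdges x (contract P D) Finset.univ) {B : Finset V} (hBD : B ⊆ D) :
    ((F ∪ F') ∩ cut x B).card = (F ∩ innerCut x D B).card + (F' ∩ (cut x B ∩ cut x D)).card := by
  have hdis : Disjoint F F' := by
    refine (disjoint_innerEdges (x := x) (P := P) (Q := contract P D)
      ⟨D, mem_contract.2 (.inl rfl), le_rfl⟩).mono hF hF'
  have h1 : F ∩ innerCut x D B = F ∩ cut x B := by
    ext e
    simp only [Finset.mem_inter, innerCut, Finset.mem_sdiff]
    exact ⟨fun h => ⟨h.1, h.2.1⟩, fun h => ⟨h.1, h.2, notMem_cut_of_mem_innerEdges (hF h.1)⟩⟩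
  have h2 : F' ∩ (cut x B ∩ cut x D) = F' ∩ cut x B := by
    ext e
    simp only [Finset.mem_inter]
    refine ⟨fun h => ⟨h.1, h.2.1⟩, fun h => ⟨h.1, h.2, ?_⟩⟩
    obtain ⟨hs, u, v, huv, hu, -⟩ := mem_cut.1 h.2
    refine mem_cut.2 ⟨hs, u, v, huv, hBD hu, fun hv => ?_⟩
    refine (mem_innerEdges.1 (hF' h.1)).2.2 D (mem_contract.2 (.inl rfl)) fun w hw => ?_
    rw [huv, Sym2.mem_iff] at hw
    rcases hw with rfl | rfl
    · exact hBD hu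
    · exact hv
  rw [h1, h2, Finset.union_inter_distrib_right, Finset.card_union_of_disjoint]
  exact hdis.mono Finset.inter_subset_left Finset.inter_subset_left

end Tree

theorem IsMaxEntropy.isNegDep {μ : PMF (Finset (Edge V))} (hP : IsPart P) (hD : IsVertexSet P D)
    (hne : D.Nonempty) (hμ : IsMaxEntropy x P D μ) : IsNegDep μ := by
  obtain ⟨⟨w, c, h⟩, -⟩ := hμ
  refine isNegDep_of_isRayleigh (w := fun e => (w e : ℝ)) (c := c) (fun e => (w e).2) (fun F => ?_)
    (isRayleigh_isSpanningTree (x := x) hP hD hne)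
  rw [h]
  simp only [Finset.mem_filter, Finset.mem_univ, true_and]
  split_ifs <;> simp

theorem IsMaxEntropy.ex_ind {μ : PMF (Finset (Edge V))} (hμ : IsMaxEntropy x P D μ) {e : Edge V}
    (he : e ∈ innerEdges x P D) : ex μ (ind e) = 1 / 2 := by
  rw [← pr_mem_eq_ex, ← toReal_toOuterMeasure, hμ.2 e he]
  simp

end

section

variable {V : Type*} [Fintype V] {x : Sym2 V → ℝ} {ePlus : Sym2 V} {P : Finset (Finset V)}
  {D : Finset V} {l : List (Finset V)} {μ τ' : PMF (Finset (Edge V))}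

theorem ex_ite_eq_pr {β : Type*} [Fintype β] (μ : PMF β) (X : β → Prop) [DecidablePred X] :
    ex μ (fun b => if X b then 1 else 0) = pr μ X := by
  rw [pr_eq_ex]
  exact ex_congr fun b _ => by by_cases h : X b <;> simp [h]

/-- The shared edge `a` is counted twice and drops out modulo 2. -/
theorem even_card_add_iff {α : Type*} [Fintype α] [DecidableEq α] {a b c d d' : α}
    (hab : a ≠ b) (hac : a ≠ c)
    (had : a ≠ d) (had' : a ≠ d') (hbc : b ≠ c) (hbd : b ≠ d) (hbd' : b ≠ d') (hcd : c ≠ d)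
    (hcd' : c ≠ d') (hdd' : d ≠ d') (F : Finset α) :
    Even ((F ∩ {a, b, c}).card + (F ∩ {a, d, d'}).card) ↔ Even (F ∩ {b, c, d, d'}).card := by
  have t : ∀ {p q r : α}, p ≠ q → p ≠ r → q ≠ r → (F ∩ {p, q, r}).card =
      (if p ∈ F then 1 else 0) + (if q ∈ F then 1 else 0) + (if r ∈ F then 1 else 0) := by
    intro p q r hpq hpr hqr
    rw [Finset.inter_comm, ← Finset.filter_mem_eq_inter, Finset.card_filter,
      Finset.sum_insert (by simp [hpq, hpr]), Finset.sum_insert (by simp [hqr]),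
      Finset.sum_singleton]
    ring
  rw [t hab hac hbc, t had had' hdd', card_inter_four hbc hbd hbd' hcd hcd' hdd']
  by_cases h1 : a ∈ F <;> simp only [h1, if_true, if_false, Nat.even_iff] <;> omega

/-! ### Two adjacent vertices of the local graph -/

theorem even_union_iff {F F' : Finset (Edge V)} (hF : F ⊆ innerEdges x P D)
    (hF' : F' ⊆ innerEdges x (contract P D) Finset.univ) {B : Finset V} (hBD : B ⊆ D) {b : Edge V}
    (hb : cut x B ∩ cut x D = {b}) :
    Even ((F ∪ F') ∩ cut x B).card ↔ (b ∉ F' ↔ Even (F ∩ innerCut x D B).card) := by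
  rw [card_union_inter_cut hF hF' hBD, hb, Nat.even_add]
  by_cases h : b ∈ F'
  · rw [Finset.inter_singleton_of_mem h]; simp [h]
  · rw [Finset.inter_singleton_of_notMem h]; simp [h]

theorem mem_innerEdges_of_mem_cut (hP : IsPart P) (hD : D ∈ P) {e : Edge V} (he : e ∈ cut x D) :
    e ∈ innerEdges x P Finset.univ := by
  obtain ⟨C, hC, hCD, h⟩ := hP.exists_edgesBetween_of_mem_cut he
  exact hP.mem_innerEdges_univ.2 ⟨D, hD, C, hC, hCD.symm, h⟩

section

variable (hx : IsHeldKarp x) (hhalf : IsHalfIntegral x) (hePlus : x ePlus = 1)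
  (hP : IsState x ePlus P) (hD : IsSelectable x ePlus P D) (hμ : IsMaxEntropy x P D μ)
  (hτ : IsExecution x ePlus (contract P D) l τ')

include hx hhalf hePlus hP hD hμ hτ

theorem pr_mem_half {e : Edge V} (he : e ∈ cut x D) : pr τ' (fun F => e ∈ F) = 1 / 2 := by
  have hst := hP.step hhalf hD
  exact hτ.pr_mem hx hhalf hePlus hst e
    (mem_innerEdges_of_mem_cut hst.part (mem_contract.2 (.inl rfl)) he)

theorem sum_congr_of_support {X : Finset (Edge V) → Prop} {g : Finset (Edge V) → ℝ}
    (h : ∀ F, IsSpanningTree x P D F → pr τ' (fun F' => X (F ∪ F')) = g F) :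
    ∑ F, (μ F).toReal * pr τ' (fun F' => X (F ∪ F')) = ex μ g := by
  refine Finset.sum_congr rfl fun F _ => ?_
  by_cases hF : μ F = 0
  · simp [hF]
  · rw [h F (hμ.isSpanningTree hF)]

/-- The case in which only one of the two vertices is joined to the rest of the graph. -/
theorem even_even_of_not_adj {S W : Finset V} (hSD : S ⊆ D) (hW : W ∈ P) (hWD : W ⊆ D)
    (hS1 : (cut x S ∩ cut x D).card = 1) (hW0 : cut x W ∩ cut x D = ∅) :
    1 / 16 ≤ ∑ F, (μ F).toReal * pr τ' (fun F' =>
      Even ((F ∪ F') ∩ cut x S).card ∧ Even ((F ∪ F') ∩ cut x W).card) := by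
  have hst := hP.step hhalf hD
  have hDv : IsVertexSet P D := hD.1.1.1.1
  have hDne := nonempty_of_two_le hP.part hD.1.1.2.1.1
  obtain ⟨b, hb⟩ := Finset.card_eq_one.1 hS1
  have hbD : b ∈ cut x D := by
    have : b ∈ cut x S ∩ cut x D := by rw [hb]; simp
    exact (Finset.mem_inter.1 this).2
  have hhalfb := pr_mem_half hx hhalf hePlus hP hD hμ hτ hbD
  -- Given the tree, exactly one of the two states of `b` makes δ(S) even, and each has probability
  -- 1/2.
  rw [sum_congr_of_support hx hhalf hePlus hP hD hμ hτ
    (X := fun T => Even (T ∩ cut x S).card ∧ Even (T ∩ cut x W).card)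
    (g := fun F => (1 / 2) * if Even (F ∩ innerCut x D W).card then 1 else 0)]
  · rw [ex_const_mul, ex_ite_eq_pr μ (fun F => Even (F ∩ innerCut x D W).card)]
    have h4 : (innerCut x D W).card = 4 := by
      have := card_innerCut_add (x := x) (D := D) W
      rwa [hW0, Finset.card_empty, add_zero, hP.card_cut hhalf hW] at this
    obtain ⟨k₁, k₂, k₃, k₄, h12, h13, h14, h23, h24, h34, hK⟩ := Finset.card_eq_four.1 h4
    have := (hμ.isNegDep hP.part hDv hDne).even_four h12 h13 h14 h23 h24 h34
      (fun k hk => hμ.ex_ind (innerCut_subset_innerEdges hP.part hDv hW hWD (hK ▸ hk)))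
      (fun F hF => hK ▸ (hμ.isSpanningTree hF).inter_innerCut_nonempty hP.part hD.1.1.2.1.1 hW hWD)
    rw [← hK] at this
    linarith
  · intro F hF
    have h1 : pr τ' (fun F' => Even ((F ∪ F') ∩ cut x S).card ∧ Even ((F ∪ F') ∩ cut x W).card) =
        pr τ' (fun F' => (b ∉ F' ↔ Even (F ∩ innerCut x D S).card) ∧
          Even (F ∩ innerCut x D W).card) := by
      refine pr_congr fun F' hF' => ?_
      have hF's := hτ.subset_innerEdges hhalf hst F' hF'
      rw [even_union_iff hF.1 hF's hSD hb, card_union_inter_cut hF.1 hF's hWD, hW0]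
      simp
    rw [h1]
    by_cases hWe : Even (F ∩ innerCut x D W).card
    · by_cases hSe : Even (F ∩ innerCut x D S).card
      · simp only [hWe, hSe, iff_true, and_true, if_true, mul_one]
        rw [pr_compl, hhalfb]; norm_num
      · simp only [hWe, hSe, iff_false, not_not, and_true, if_true, mul_one]
        exact hhalfb
    · simp only [hWe, and_false, if_false, mul_zero]
      exact pr_eq_zero fun _ _ h => h

/-- The case in which both vertices are joined to the rest of the graph. -/
theorem even_even_of_adj {S W : Finset V} (hSD : S ⊆ D) (hWD : W ⊆ D)
    (hS1 : (cut x S ∩ cut x D).card = 1) (hW1 : (cut x W ∩ cut x D).card = 1)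
    (he : 1 / 8 ≤ pr μ (fun F => Even ((F ∩ innerCut x D S).card + (F ∩ innerCut x D W).card)))
    (ho : 1 / 8 ≤ pr μ (fun F => ¬ Even ((F ∩ innerCut x D S).card + (F ∩ innerCut x D W).card))) :
    1 / 16 ≤ ∑ F, (μ F).toReal * pr τ' (fun F' =>
      Even ((F ∪ F') ∩ cut x S).card ∧ Even ((F ∪ F') ∩ cut x W).card) := by
  have hst := hP.step hhalf hD
  obtain ⟨a, ha⟩ := Finset.card_eq_one.1 hS1
  obtain ⟨b, hb⟩ := Finset.card_eq_one.1 hW1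
  have haD : a ∈ cut x D := by
    have : a ∈ cut x S ∩ cut x D := by rw [ha]; simp
    exact (Finset.mem_inter.1 this).2
  have hbD : b ∈ cut x D := by
    have : b ∈ cut x W ∩ cut x D := by rw [hb]; simp
    exact (Finset.mem_inter.1 this).2
  have ea := pr_mem_half hx hhalf hePlus hP hD hμ hτ haD
  have eb := pr_mem_half hx hhalf hePlus hP hD hμ hτ hbD
  -- With both marginals 1/2, the joint law of `a` and `b` depends on `r` alone; no correlation
  -- bound is needed. The case `a = b` is not excluded.
  set r := pr τ' (fun F => a ∈ F ∧ b ∈ F) with hr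
  have r10 : pr τ' (fun F => a ∈ F ∧ b ∉ F) = 1 / 2 - r := by
    have := pr_split τ' (fun F => a ∈ F) (fun F => b ∈ F)
    linarith
  have r01 : pr τ' (fun F => a ∉ F ∧ b ∈ F) = 1 / 2 - r := by
    have h1 := pr_split τ' (fun F => b ∈ F) (fun F => a ∈ F)
    have h2 : pr τ' (fun F => b ∈ F ∧ a ∈ F) = r := pr_congr fun F _ => and_comm
    have h3 : pr τ' (fun F => a ∉ F ∧ b ∈ F) = pr τ' (fun F => b ∈ F ∧ a ∉ F) :=
      pr_congr fun F _ => and_comm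
    linarith
  have r00 : pr τ' (fun F => a ∉ F ∧ b ∉ F) = r := by
    have h1 := pr_split τ' (fun F => a ∉ F) (fun F => b ∈ F)
    have h2 := pr_compl τ' (fun F => a ∈ F)
    linarith
  have hr0 : 0 ≤ r := pr_nonneg _ _
  have hr1 : 0 ≤ 1 / 2 - r := r10 ▸ pr_nonneg _ _
  rw [sum_congr_of_support hx hhalf hePlus hP hD hμ hτ
    (X := fun T => Even (T ∩ cut x S).card ∧ Even (T ∩ cut x W).card)
    (g := fun F => r * (if Even ((F ∩ innerCut x D S).card + (F ∩ innerCut x D W).card)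
        then 1 else 0)
      + (1 / 2 - r) *
        (if ¬ Even ((F ∩ innerCut x D S).card + (F ∩ innerCut x D W).card) then 1 else 0))]
  · rw [ex_add, ex_const_mul, ex_const_mul,
      ex_ite_eq_pr μ (fun F => Even ((F ∩ innerCut x D S).card + (F ∩ innerCut x D W).card)),
      ex_ite_eq_pr μ (fun F => ¬ Even ((F ∩ innerCut x D S).card + (F ∩ innerCut x D W).card))]
    -- The weights `r` and `1 / 2 - r` add up to 1/2, which halves 1/8.
    have h1 := mul_le_mul_of_nonneg_left he hr0
    have h2 := mul_le_mul_of_nonneg_left ho hr1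
    linarith
  · intro F hF
    have h1 : pr τ' (fun F' => Even ((F ∪ F') ∩ cut x S).card ∧ Even ((F ∪ F') ∩ cut x W).card) =
        pr τ' (fun F' => (a ∉ F' ↔ Even (F ∩ innerCut x D S).card) ∧
          (b ∉ F' ↔ Even (F ∩ innerCut x D W).card)) := by
      refine pr_congr fun F' hF' => ?_
      have hF's := hτ.subset_innerEdges hhalf hst F' hF'
      rw [even_union_iff hF.1 hF's hSD ha, even_union_iff hF.1 hF's hWD hb]
    rw [h1]
    by_cases hWe : Even (F ∩ innerCut x D W).card <;>
      by_cases hSe : Even (F ∩ innerCut x D S).card <;>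
      simp only [hWe, hSe, iff_true, iff_false, not_not, Nat.even_add, if_true, if_false, mul_one,
        mul_zero, add_zero, zero_add, not_true, not_false_iff, r00, r01, r10, hr]

set_option maxHeartbeats 1000000 in
/-- Two edges at a vertex of the local graph that is joined to the rest of the graph by one edge:
the ends of one of them have even cuts with probability at least `1/16`. -/
theorem even_even_or {S : Finset V} (hS : S ∈ P) (hSD : S ⊆ D)
    (hS1 : (cut x S ∩ cut x D).card = 1) {e f : Edge V} (hef : e ≠ f) {W W' : Finset V}
    (hW : W ∈ P) (hWD : W ⊆ D) (hWS : W ≠ S) (he : e ∈ edgesBetween x S W)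
    (hW' : W' ∈ P) (hWD' : W' ⊆ D) (hWS' : W' ≠ S) (hf : f ∈ edgesBetween x S W') :
    1 / 16 ≤ ∑ F, (μ F).toReal * pr τ' (fun F' =>
      Even ((F ∪ F') ∩ cut x S).card ∧ Even ((F ∪ F') ∩ cut x W).card) ∨
    1 / 16 ≤ ∑ F, (μ F).toReal * pr τ' (fun F' =>
      Even ((F ∪ F') ∩ cut x S).card ∧ Even ((F ∪ F') ∩ cut x W').card) := by
  have hDv : IsVertexSet P D := hD.1.1.1.1
  have hDne := nonempty_of_two_le hP.part hD.1.1.2.1.1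
  -- A single edge is half a unit of flow, neither 0 nor 1, which makes the local graph simple.
  have hflow : flow x S Dᶜ = 1 / 2 := by
    have := card_edgesBetween (x := x) hhalf (A := S) (B := Dᶜ)
      (Finset.disjoint_left.2 fun v hv => by simpa using hSD hv)
    rw [edgesBetween_compl_eq hSD, hS1] at this
    push_cast at this
    linarith
  obtain ⟨hcard, hsimple⟩ := local_simple hx hhalf hP hD hS hSD (by rw [hflow]; norm_num)
    (by rw [hflow]; norm_num)
  by_cases hW0 : cut x W ∩ cut x D = ∅
  · exact .inl (even_even_of_not_adj hx hhalf hePlus hP hD hμ hτ hSD hW hWD hS1 hW0)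
  by_cases hW0' : cut x W' ∩ cut x D = ∅
  · exact .inr (even_even_of_not_adj hx hhalf hePlus hP hD hμ hτ hSD hW' hWD' hS1 hW0')
  have hW1 : (cut x W ∩ cut x D).card = 1 := by
    have h1 := (hsimple W hW S hS hWD hSD hWS).2
    rw [edgesBetween_compl_eq hWD] at h1
    have := Finset.card_pos.2 (Finset.nonempty_iff_ne_empty.2 hW0)
    omega
  have hW1' : (cut x W' ∩ cut x D).card = 1 := by
    have h1 := (hsimple W' hW' S hS hWD' hSD hWS').2
    rw [edgesBetween_compl_eq hWD'] at h1
    have := Finset.card_pos.2 (Finset.nonempty_iff_ne_empty.2 hW0')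
    omega
  have three : ∀ B ∈ P, (cut x B ∩ cut x D).card = 1 → (innerCut x D B).card = 3 := by
    intro B hB h
    have := card_innerCut_add (x := x) (D := D) B
    rw [h, hP.card_cut hhalf hB] at this
    omega
  -- By simplicity only one edge joins `S` to a neighbour, so the remaining edges at the two ends
  -- are distinct.
  have uniq : ∀ B ∈ P, B ⊆ D → B ≠ S → ∀ k ∈ edgesBetween x S B, ∀ k' ∈ innerCut x D S,
      k' ∈ innerCut x D B → k' = k := by
    intro B hB hBD hBS k hk k' h1 h2
    exact Finset.card_le_one.1 (hsimple S hS B hB hSD hBD hBS.symm).1 k'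
      (mem_edgesBetween_of_mem_innerCut hP.part hDv hS hSD hB hBS.symm h1 h2) k hk
  have heS : e ∈ innerCut x D S := (mem_innerCut hP.part hDv hS hSD).2 ⟨W, hW, hWD, hWS, he⟩
  have hfS : f ∈ innerCut x D S := (mem_innerCut hP.part hDv hS hSD).2 ⟨W', hW', hWD', hWS', hf⟩
  have heW : e ∈ innerCut x D W := (mem_innerCut hP.part hDv hW hWD).2
    ⟨S, hS, hSD, hWS.symm, by rwa [edgesBetween_comm]⟩
  have hfW : f ∈ innerCut x D W' := (mem_innerCut hP.part hDv hW' hWD').2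
    ⟨S, hS, hSD, hWS'.symm, by rwa [edgesBetween_comm]⟩
  obtain ⟨g, hgne, hgS⟩ : ∃ g, (e ≠ g ∧ f ≠ g) ∧ innerCut x D S = {e, f, g} := by
    have hc : ((innerCut x D S).erase e).card = 2 := by
      rw [Finset.card_erase_of_mem heS, three S hS hS1]
    have hc2 : (((innerCut x D S).erase e).erase f).card = 1 := by
      rw [Finset.card_erase_of_mem (Finset.mem_erase.2 ⟨hef.symm, hfS⟩), hc]
    obtain ⟨g, hg⟩ := Finset.card_eq_one.1 hc2
    have hg' : g ∈ ((innerCut x D S).erase e).erase f := by rw [hg]; simp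
    simp only [Finset.mem_erase] at hg'
    refine ⟨g, ⟨hg'.2.1.symm, hg'.1.symm⟩, ?_⟩
    rw [← Finset.insert_erase heS, ← Finset.insert_erase (Finset.mem_erase.2 ⟨hef.symm, hfS⟩), hg]
  have pair : ∀ B ∈ P, (cut x B ∩ cut x D).card = 1 → ∀ k ∈ innerCut x D B,
      ∃ h h', (k ≠ h ∧ k ≠ h' ∧ h ≠ h') ∧ innerCut x D B = {k, h, h'} := by
    intro B hB hB1 k hk
    have hc : ((innerCut x D B).erase k).card = 2 := by
      rw [Finset.card_erase_of_mem hk, three B hB hB1]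
    obtain ⟨h, h', hhh', hh⟩ := Finset.card_eq_two.1 hc
    have h1 : h ∈ (innerCut x D B).erase k := by rw [hh]; simp
    have h2 : h' ∈ (innerCut x D B).erase k := by rw [hh]; simp
    refine ⟨h, h', ⟨(Finset.ne_of_mem_erase h1).symm, (Finset.ne_of_mem_erase h2).symm, hhh'⟩, ?_⟩
    rw [← Finset.insert_erase hk, hh]
  obtain ⟨h, h', ⟨heh, heh', hhh'⟩, hhW⟩ := pair W hW hW1 e heW
  obtain ⟨i, i', ⟨hfi, hfi', hii'⟩, hiW⟩ := pair W' hW' hW1' f hfW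
  have hgS' : g ∈ innerCut x D S := by rw [hgS]; simp
  have hhW1 : h ∈ innerCut x D W := by rw [hhW]; simp
  have hhW2 : h' ∈ innerCut x D W := by rw [hhW]; simp
  have hiW1 : i ∈ innerCut x D W' := by rw [hiW]; simp
  have hiW2 : i' ∈ innerCut x D W' := by rw [hiW]; simp
  have u := uniq W hW hWD hWS e he
  have u' := uniq W' hW' hWD' hWS' f hf
  have hfh : f ≠ h := fun hh => hef (u f hfS (hh ▸ hhW1)).symm
  have hfh' : f ≠ h' := fun hh => hef (u f hfS (hh ▸ hhW2)).symm
  have hgh : g ≠ h := fun hh => hgne.1 (u g hgS' (hh ▸ hhW1)).symm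
  have hgh' : g ≠ h' := fun hh => hgne.1 (u g hgS' (hh ▸ hhW2)).symm
  have hei : e ≠ i := fun hh => hef (u' e heS (hh ▸ hiW1))
  have hei' : e ≠ i' := fun hh => hef (u' e heS (hh ▸ hiW2))
  have hgi : g ≠ i := fun hh => hgne.2 (u' g hgS' (hh ▸ hiW1)).symm
  have hgi' : g ≠ i' := fun hh => hgne.2 (u' g hgS' (hh ▸ hiW2)).symm
  have hneg := hμ.isNegDep hP.part hDv hDne
  have sS := innerCut_subset_innerEdges (x := x) hP.part hDv hS hSD
  have sW := innerCut_subset_innerEdges (x := x) hP.part hDv hW hWD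
  have sW' := innerCut_subset_innerEdges (x := x) hP.part hDv hW' hWD'
  have hk : ∀ k ∈ ({e, f, g, h, h', i, i'} : Finset (Edge V)), ex μ (ind k) = 1 / 2 := by
    intro k hk
    simp only [Finset.mem_insert, Finset.mem_singleton] at hk
    rcases hk with rfl | rfl | rfl | rfl | rfl | rfl | rfl
    · exact hμ.ex_ind (sS heS)
    · exact hμ.ex_ind (sS hfS)
    · exact hμ.ex_ind (sS hgS')
    · exact hμ.ex_ind (sW hhW1)
    · exact hμ.ex_ind (sW hhW2)
    · exact hμ.ex_ind (sW' hiW1)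
    · exact hμ.ex_ind (sW' hiW2)
  have cS : ∀ F, μ F ≠ 0 → (F ∩ {e, f, g}).Nonempty := fun F hF => hgS ▸
    (hμ.isSpanningTree hF).inter_innerCut_nonempty hP.part hD.1.1.2.1.1 hS hSD
  have cW : ∀ F, μ F ≠ 0 → (F ∩ {e, h, h'}).Nonempty := fun F hF => hhW ▸
    (hμ.isSpanningTree hF).inter_innerCut_nonempty hP.part hD.1.1.2.1.1 hW hWD
  have cW' : ∀ F, μ F ≠ 0 → (F ∩ {f, i, i'}).Nonempty := fun F hF => hiW ▸
    (hμ.isSpanningTree hF).inter_innerCut_nonempty hP.part hD.1.1.2.1.1 hW' hWD'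
  have cSW : ∀ F, μ F ≠ 0 → (F ∩ {f, g, h, h'}).Nonempty := by
    intro F hF
    obtain ⟨k, hk, hk', hkn⟩ := (hμ.isSpanningTree hF).exists_mem_innerCut hP.part hcard hS hSD hW
    refine ⟨k, Finset.mem_inter.2 ⟨hk, ?_⟩⟩
    have hke : k ≠ e := fun hh => hkn (hh ▸ he)
    rw [hgS, hhW] at hk'
    simp only [Finset.mem_insert, Finset.mem_singleton] at hk' ⊢
    tauto
  have cSW' : ∀ F, μ F ≠ 0 → (F ∩ {e, g, i, i'}).Nonempty := by
    intro F hF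
    obtain ⟨k, hk, hk', hkn⟩ := (hμ.isSpanningTree hF).exists_mem_innerCut hP.part hcard hS hSD hW'
    refine ⟨k, Finset.mem_inter.2 ⟨hk, ?_⟩⟩
    have hke : k ≠ f := fun hh => hkn (hh ▸ hf)
    rw [hgS, hiW] at hk'
    simp only [Finset.mem_insert, Finset.mem_singleton] at hk' ⊢
    tauto
  have evenW := hneg.even_four hgne.2 hfh hfh' hgh hgh' hhh'
    (fun k hk' => hk k (by
      simp only [Finset.mem_insert, Finset.mem_singleton] at hk'
      rcases hk' with rfl | rfl | rfl | rfl <;> simp)) cSW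
  have evenW' := hneg.even_four hgne.1 hei hei' hgi hgi' hii'
    (fun k hk' => hk k (by
      simp only [Finset.mem_insert, Finset.mem_singleton] at hk'
      rcases hk' with rfl | rfl | rfl | rfl <;> simp)) cSW'
  have pW := even_card_add_iff hef hgne.1 heh heh' hgne.2 hfh hfh' hgh hgh' hhh'
  have pW' := even_card_add_iff hef.symm hgne.2 hfi hfi' hgne.1 hei hei' hgi hgi' hii'
  -- The second alternative repeats the first with `e` and `f` exchanged.
  have hgS2 : innerCut x D S = {f, e, g} := by rw [hgS, Finset.insert_comm]
  rcases hneg.odd_four hef hgne.1 hei hei' hgne.2 hfh hfh' hgh hgh' hhh' hgi hgi' hii' hk cS cSW cW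
    cSW' cW' with ho | ho
  · left
    refine even_even_of_adj hx hhalf hePlus hP hD hμ hτ hSD hWD hS1 hW1 ?_ ?_
    · rw [hgS, hhW, pr_congr fun F _ => pW F]
      exact evenW
    · rw [hgS, hhW, pr_congr fun F _ => not_congr (pW F)]
      exact ho
  · right
    refine even_even_of_adj hx hhalf hePlus hP hD hμ hτ hSD hWD' hS1 hW1' ?_ ?_
    · rw [hgS2, hiW, pr_congr fun F _ => pW' F]
      exact evenW'
    · rw [hgS2, hiW, pr_congr fun F _ => not_congr (pW' F)]
      exact ho

end

end

section

variable {V : Type*} [Fintype V] {x : Sym2 V → ℝ} {ePlus : Sym2 V} {P : Finset (Finset V)}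
  {D S W : Finset V} {l : List (Finset V)} {e : Edge V}

/-! ### The hierarchy around a selected set -/

theorem mem_critical {R : Finset V} : R ∈ critical l ↔ R ∈ singletons V ∨ R ∈ l := by
  simp [critical]

/-- The blocks of `P` are critical, and every critical set lies in a block of `P`, contains `D`
or is disjoint from `D`. -/
structure IsLevel (l : List (Finset V)) (P : Finset (Finset V)) (D : Finset V) : Prop where
  part : IsPart P
  isVertexSet : IsVertexSet P D
  notMem : D ∉ P
  compl_nonempty : Dᶜ.Nonempty
  mem_critical : D ∈ critical l
  block_mem : ∀ B ∈ P, B ∈ critical l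
  trichotomy : ∀ R ∈ critical l, (∃ B ∈ P, R ⊆ B) ∨ D ⊆ R ∨ Disjoint D R

theorem IsExecution.exists_isLevel (hhalf : IsHalfIntegral x) {P₀ : Finset (Finset V)}
    (hP₀ : P₀ = singletons V) (hstate : IsState x ePlus P₀) {τ : PMF (Finset (Edge V))}
    (hrun : IsExecution x ePlus P₀ l τ) (hD : D ∈ l) :
    ∃ (P : Finset (Finset V)) (l₂ : List (Finset V)) (μ τ' : PMF (Finset (Edge V))),
      IsLevel l P D ∧ IsState x ePlus P ∧ IsSelectable x ePlus P D ∧ IsMaxEntropy x P D μ ∧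
      IsExecution x ePlus (contract P D) l₂ τ' ∧
      ∀ X : Finset (Edge V) → Prop, (∀ T, X T ↔ X (T ∩ innerEdges x P Finset.univ)) →
        pr τ X = ∑ F, (μ F).toReal * pr τ' (fun F' => X (F ∪ F')) := by
  obtain ⟨l₁, l₂, rfl⟩ := List.append_of_mem hD
  obtain ⟨P, μ, τ', hP, hco, hsel, hμ, hτ', hl₁, hblock, hpr⟩ := hrun.split hhalf hstate
  refine ⟨P, l₂, μ, τ', ⟨hP.part, hsel.1.1.1.1,
    fun h => hP.part.not_two_le_card_nodesIn h hsel.1.1.2.1.1,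
    nonempty_of_two_le hP.part hsel.1.1.2.1.2, mem_critical.2 (.inr hD), fun B hB => ?_,
    fun R hR => ?_⟩, hP, hsel, hμ, hτ', hpr⟩
  · rw [mem_critical, List.mem_append]
    rcases hblock B hB with h | h
    · exact .inl (hP₀ ▸ h)
    · exact .inr (.inl h)
  · rw [mem_critical, List.mem_append, List.mem_cons] at hR
    rcases hR with h | h | rfl | h
    · exact .inl (hco.exists_superset hstate.part hP.part (hP₀ ▸ h))
    · exact .inl (hl₁ R h)
    · exact .inr (.inl le_rfl)
    -- Sets selected after `D` see it as one vertex, so they contain it or avoid it.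
    · exact .inr ((hτ'.isVertexSet hhalf (hP.step hhalf hsel) R h).1 D
        (mem_contract.2 (.inl rfl)))

namespace IsLevel

variable (hL : IsLevel l P D)

include hL

/-- A block strictly containing `S` would be a critical set strictly between `S` and its parent. -/
theorem mem_of_minimal (hS : S ∈ critical l) (hne : S.Nonempty)
    (hD : Minimal (fun R => R ∈ critical l ∧ S ⊂ R) D) : S ∈ P := by
  have hSD := hD.1.2
  obtain ⟨v, hv⟩ := hne
  rcases hL.trichotomy S hS with ⟨B, hB, hSB⟩ | h | h
  · have hBD : B ⊆ D := by
      rcases hL.isVertexSet B hB with h | h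
      · exact h
      · exact (Finset.disjoint_left.1 h (hSB hv) (hSD.1 hv)).elim
    rcases hSB.eq_or_ssubset with rfl | hlt
    · exact hB
    · have : D ≤ B := hD.2 ⟨hL.block_mem B hB, hlt⟩ hBD
      exact (hL.notMem (Finset.Subset.antisymm hBD this ▸ hB)).elim
  · exact (hSD.2 h).elim
  · exact (Finset.disjoint_left.1 h (hSD.1 hv) hv).elim

theorem subset_of_ssubset (hS : S ∈ P) (hSD : S ⊆ D) {R : Finset V} (hR : R ∈ critical l)
    (hSR : S ⊂ R) : D ⊆ R := by
  obtain ⟨v, hv⟩ := hL.part.nonempty S hS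
  rcases hL.trichotomy R hR with ⟨B, hB, hRB⟩ | h | h
  · have : S = B := hL.part.eq_of_mem S hS B hB v hv (hRB (hSR.1 hv))
    exact (hSR.2 (this ▸ hRB)).elim
  · exact h
  · exact (Finset.disjoint_left.1 h (hSD hv) (hSR.1 hv)).elim

theorem ssubset (hS : S ∈ P) (hSD : S ⊆ D) : S ⊂ D :=
  hSD.ssubset_of_ne fun h => hL.notMem (h ▸ hS)

theorem goesHigher_iff (hS : S ∈ P) (hSD : S ⊆ D) : GoesHigher x l S e ↔ e ∈ cut x D := by
  have hD : Minimal (fun R => R ∈ critical l ∧ S ⊂ R) D :=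
    ⟨⟨hL.mem_critical, hL.ssubset hS hSD⟩, fun R hR _ => hL.subset_of_ssubset hS hSD hR.1 hR.2⟩
  constructor
  · rintro ⟨R, hR, he⟩
    rwa [← Finset.Subset.antisymm (hL.subset_of_ssubset hS hSD hR.1.1 hR.1.2)
      (hR.2 hD.1 (hL.subset_of_ssubset hS hSD hR.1.1 hR.1.2))] at he
  · exact fun he => ⟨D, hD, he⟩

theorem isChild_iff (hS : S ∈ P) (hSD : S ⊆ D) {R : Finset V} : IsChild l S R ↔ R = D := by
  have hle : ∀ R, R ∈ hierarchy l ∧ S ⊂ R → D ≤ R := by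
    rintro R ⟨hR, hSR⟩
    rcases Finset.mem_insert.1 hR with rfl | hR
    · exact Finset.subset_univ _
    · exact hL.subset_of_ssubset hS hSD hR hSR
  have hD : D ∈ hierarchy l ∧ S ⊂ D :=
    ⟨Finset.mem_insert_of_mem hL.mem_critical, hL.ssubset hS hSD⟩
  constructor
  · rintro ⟨-, hR⟩
    exact Finset.Subset.antisymm (hR.2 hD (hle R hR.1)) (hle R hR.1)
  · rintro rfl
    exact ⟨hL.block_mem S hS, hD, fun R hR _ => hle R hR⟩

/-- Any larger critical set contains `D`, hence both ends of `e`. -/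
theorem isHighestCut (hS : S ∈ P) (hSD : S ⊆ D) (he : e ∈ innerCut x D S) :
    IsHighestCut x l e S := by
  refine ⟨⟨hL.block_mem S hS, (Finset.mem_sdiff.1 he).1⟩, fun R hR hSR => ?_⟩
  rcases hSR.eq_or_ssubset with h | h
  · exact h.ge
  · obtain ⟨C, -, hCD, -, he⟩ := (mem_innerCut hL.part hL.isVertexSet hS hSD).1 he
    have hDR := hL.subset_of_ssubset hS hSD hR.1 h
    obtain ⟨-, u, v, huv, hu, hv⟩ := mem_edgesBetween.1 he
    obtain ⟨-, u', v', huv', -, hv'⟩ := mem_cut.1 hR.2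
    rw [huv, Sym2.eq_iff] at huv'
    rcases huv' with ⟨-, rfl⟩ | ⟨rfl, -⟩
    · exact (hv' (hDR (hCD hv))).elim
    · exact (hv' (hDR (hSD hu))).elim

/-- A critical set separating the ends of `e` neither contains `D` nor avoids it, so it lies in `S`
or in `W`, and maximality gives equality. -/
theorem eq_of_isHighestCut (hS : S ∈ P) (hSD : S ⊆ D) (hW : W ∈ P) (hWD : W ⊆ D) (hWS : W ≠ S)
    (he : e ∈ edgesBetween x S W) {A : Finset V} (hA : IsHighestCut x l e A) :
    A = S ∨ A = W := by
  have hcS := edgesBetween_subset_cut (hL.part.disjoint hS hW hWS.symm) he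
  have hcW := edgesBetween_subset_cut (hL.part.disjoint hW hS hWS)
    (edgesBetween_comm (x := x) S W ▸ he)
  obtain ⟨-, u, v, huv, hu, hv⟩ := mem_edgesBetween.1 he
  obtain ⟨-, u', v', huv', hu', hv'⟩ := mem_cut.1 hA.1.2
  have hends : (u' ∈ S ∧ v' ∈ W) ∨ (u' ∈ W ∧ v' ∈ S) := by
    rw [huv, Sym2.eq_iff] at huv'
    rcases huv' with ⟨rfl, rfl⟩ | ⟨rfl, rfl⟩
    · exact .inl ⟨hu, hv⟩
    · exact .inr ⟨hv, hu⟩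
  have hD' : u' ∈ D ∧ v' ∈ D := by
    rcases hends with ⟨h, h'⟩ | ⟨h, h'⟩
    · exact ⟨hSD h, hWD h'⟩
    · exact ⟨hWD h, hSD h'⟩
  rcases hL.trichotomy A hA.1.1 with ⟨B, hB, hAB⟩ | h | h
  · rcases hends with ⟨h, -⟩ | ⟨h, -⟩
    · have hBS := hL.part.eq_of_mem B hB S hS u' (hAB hu') h
      rw [hBS] at hAB
      exact .inl (Finset.Subset.antisymm hAB (hA.2 ⟨hL.block_mem S hS, hcS⟩ hAB))
    · have hBW := hL.part.eq_of_mem B hB W hW u' (hAB hu') h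
      rw [hBW] at hAB
      exact .inr (Finset.Subset.antisymm hAB (hA.2 ⟨hL.block_mem W hW, hcW⟩ hAB))
  · exact (hv' (h hD'.2)).elim
  · exact (Finset.disjoint_left.1 h hD'.1 hu').elim

/-- An edge at a vertex of which exactly one edge goes higher is a top edge. -/
theorem not_isBottom (hS : S ∈ P) (hSD : S ⊆ D) (hS1 : (cut x S ∩ cut x D).card = 1)
    (he : e ∈ innerCut x D S) : ¬ IsBottom x l e := by
  rintro ⟨R, hR, k, c, -, hc, hmem, hcard⟩
  have hRD := (hL.isChild_iff hS hSD).1 (hR S (hL.isHighestCut hS hSD he))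
  subst hRD
  obtain ⟨i, hi⟩ := (hmem S).1 (Finset.mem_filter.2
    ⟨Finset.mem_univ _, .inl ((hL.isChild_iff hS hSD).2 rfl)⟩)
  obtain ⟨j, hj⟩ := (hmem Rᶜ).1 (Finset.mem_filter.2
    ⟨Finset.mem_univ _, .inr ⟨rfl, hL.compl_nonempty⟩⟩)
  have hij : i ≠ j := by
    rintro rfl
    obtain ⟨v, hv⟩ := hL.compl_nonempty
    rw [← hj, hi] at hv
    have hv' : v ∈ Rᶜ := by rwa [← hj, hi]
    exact Finset.mem_compl.1 hv' (hSD hv)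
  -- In a doubled cycle this number would be 0 or 2, but it is 1.
  have := hcard i j hij
  rw [hi, hj, edgesBetween_compl_eq hSD, hS1] at this
  split_ifs at this; all_goals omega

theorem isGood (hS : S ∈ P) (hSD : S ⊆ D) (hS1 : (cut x S ∩ cut x D).card = 1)
    (hW : W ∈ P) (hWD : W ⊆ D) (hWS : W ≠ S) (he : e ∈ edgesBetween x S W)
    {τ : PMF (Finset (Edge V))} (h : 1 / 16 ≤ pr τ fun T =>
      Even (T ∩ cut x S).card ∧ Even (T ∩ cut x W).card) : IsGood x l τ (1 / 16) e := by
  have hei : e ∈ innerCut x D S :=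
    (mem_innerCut hL.part hL.isVertexSet hS hSD).2 ⟨W, hW, hWD, hWS, he⟩
  have hle : (1 / 16 : ℝ) ≤ (τ.toOuterMeasure {T | EvenAtLast x l T e}).toReal := by
    rw [toReal_toOuterMeasure]
    refine h.trans (pr_mono fun T _ hT =>
      ⟨fun hb => (hL.not_isBottom hS hSD hS1 hei hb).elim, fun _ A hA => ?_⟩)
    rcases hL.eq_of_isHighestCut hS hSD hW hWD hWS he hA with rfl | rfl
    · exact hT.1
    · exact hT.2
  rw [IsGood, ← ENNReal.toReal_le_toReal (by norm_num) (toOuterMeasure_ne_top _ _)]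
  simpa using hle

end IsLevel

/-- Among any two edges at `S` that do not go higher, one is good. -/
theorem isGood_or (hx : IsHeldKarp x) (hhalf : IsHalfIntegral x) (hePlus : x ePlus = 1)
    (hP : IsState x ePlus P) (hL : IsLevel l P D) (hD : IsSelectable x ePlus P D)
    {μ τ τ' : PMF (Finset (Edge V))} (hμ : IsMaxEntropy x P D μ) {l₂ : List (Finset V)}
    (hτ' : IsExecution x ePlus (contract P D) l₂ τ')
    (hτ : ∀ X : Finset (Edge V) → Prop, (∀ T, X T ↔ X (T ∩ innerEdges x P Finset.univ)) →
      pr τ X = ∑ F, (μ F).toReal * pr τ' (fun F' => X (F ∪ F')))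
    (hS : S ∈ P) (hSD : S ⊆ D) (hS1 : (cut x S ∩ cut x D).card = 1) {f : Edge V} (hef : e ≠ f)
    (he : e ∈ innerCut x D S) (hf : f ∈ innerCut x D S) :
    IsGood x l τ (1 / 16) e ∨ IsGood x l τ (1 / 16) f := by
  obtain ⟨W, hW, hWD, hWS, he⟩ := (mem_innerCut hL.part hL.isVertexSet hS hSD).1 he
  obtain ⟨W', hW', hWD', hWS', hf⟩ := (mem_innerCut hL.part hL.isVertexSet hS hSD).1 hf
  have key : ∀ B ∈ P, pr τ (fun T => Even (T ∩ cut x S).card ∧ Even (T ∩ cut x B).card) =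
      ∑ F, (μ F).toReal * pr τ' (fun F' =>
        Even ((F ∪ F') ∩ cut x S).card ∧ Even ((F ∪ F') ∩ cut x B).card) := by
    intro B hB
    refine hτ _ fun T => ?_
    -- The cut of a block consists of edges between blocks, so the samples preceding `D` do not
    -- affect the event.
    have hcut : ∀ C ∈ P, T ∩ innerEdges x P Finset.univ ∩ cut x C = T ∩ cut x C := fun C hC => by
      rw [Finset.inter_assoc, Finset.inter_eq_right.2 fun g hg =>
        mem_innerEdges_of_mem_cut hL.part hC hg]
    rw [hcut S hS, hcut B hB]
  rcases even_even_or hx hhalf hePlus hP hD hμ hτ' hS hSD hS1 hef hW hWD hWS he hW' hWD' hWS' hf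
    with h | h
  · exact .inl (hL.isGood hS hSD hS1 hW hWD hWS he (h.trans_eq (key W hW).symm))
  · exact .inr (hL.isGood hS hSD hS1 hW' hWD' hWS' hf (h.trans_eq (key W' hW').symm))

theorem two_le_card_filter {α : Type*} {s : Finset α} {p : α → Prop} [DecidablePred p]
    (hs : 3 ≤ s.card) (h : ∀ a ∈ s, ∀ b ∈ s, a ≠ b → p a ∨ p b) : 2 ≤ (s.filter p).card := by
  have h1 : (s.filter fun a => ¬ p a).card ≤ 1 := by
    rw [Finset.card_le_one]
    intro a ha b hb
    rw [Finset.mem_filter] at ha hb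
    by_contra hab
    exact (h a ha.1 b hb.1 hab).elim ha.2 hb.2
  have := Finset.card_filter_add_card_filter_not (s := s) p
  omega

end

end HalfIntegralTSP

end

/-! ### The top edge lemma. -/

theorem mainTheorem5 {V : Type*} [Fintype V] (x : Sym2 V → ℝ)
    (hx : HalfIntegralTSP.IsHeldKarp x) (hhalf : HalfIntegralTSP.IsHalfIntegral x)
    (ePlus : Sym2 V) (hePlus : x ePlus = 1)
    (l : List (Finset V)) (τ : PMF (Finset (HalfIntegralTSP.Edge V)))
    (hrun : HalfIntegralTSP.IsExecution x ePlus (HalfIntegralTSP.singletons V) l τ)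
    (S : Finset V) (hS : S ∈ HalfIntegralTSP.critical l)
    (hone : ((HalfIntegralTSP.cut x S).filter
      fun e => HalfIntegralTSP.GoesHigher x l S e).card = 1) :
    2 ≤ ((HalfIntegralTSP.cut x S).filter
      fun f => ¬ HalfIntegralTSP.GoesHigher x l S f ∧
        HalfIntegralTSP.IsGood x l τ (1 / 16) f).card := by
  open HalfIntegralTSP in
  have hstate := hx.isState_singletons hhalf hePlus
  have hSne : S.Nonempty := by
    rcases mem_critical.1 hS with h | h
    · exact hstate.part.nonempty S h
    · exact (hrun.isVertexSet hhalf hstate S h).2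
  obtain ⟨e, he⟩ := Finset.card_pos.1 (hone.symm ▸ Nat.one_pos)
  obtain ⟨-, D, hD, -⟩ := Finset.mem_filter.1 he
  -- A strict superset of a nonempty set is not a singleton, so the parent is a selected set.
  have hDl : D ∈ l := by
    refine (mem_critical.1 hD.1.1).resolve_left fun h => ?_
    obtain ⟨v, -, rfl⟩ := Finset.mem_image.1 h
    exact hSne.ne_empty (Finset.ssubset_singleton_iff.1 hD.1.2)
  obtain ⟨P, l₂, μ, τ', hL, hP, hsel, hμ, hτ', hτ⟩ := hrun.exists_isLevel hhalf rfl hstate hDl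
  have hSP := hL.mem_of_minimal hS hSne hD
  have hSD : S ⊆ D := hD.1.2.1
  have hgo : ∀ f, GoesHigher x l S f ↔ f ∈ cut x D := fun f => hL.goesHigher_iff hSP hSD
  simp only [hgo] at hone ⊢
  have hS1 : (cut x S ∩ cut x D).card = 1 := by rwa [Finset.filter_mem_eq_inter] at hone
  have h4 := hP.card_cut hhalf hSP
  have h3 := card_innerCut_add (x := x) (D := D) S
  have hset : (cut x S).filter (fun f => f ∉ cut x D ∧ IsGood x l τ (1 / 16) f) =
      (innerCut x D S).filter fun f => IsGood x l τ (1 / 16) f := by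
    rw [innerCut, Finset.sdiff_eq_filter, Finset.filter_filter]
  rw [hset]
  exact two_le_card_filter (by omega) fun f hf g hg hfg =>
    isGood_or hx hhalf hePlus hP hL hsel hμ hτ' hτ hSP hSD hS1 hfg hf hg
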